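/- Let $V$ be a Euclidean space of dimension $n$, $\Phi\subset V$ a finite reduced root system spanning $V$, with reflection group $W$ and simple roots $\Delta$. Let $\mathcal C_\Phi$ be the set of nonzero subspaces spanned by elements of $\Phi$. Let $\mathcal G\subseteq\mathcal C_\Phi$ be a $W$-invariant building set with $V\in\mathcal G$: it contains all lines $\mathbb R\alpha$, $\alpha\in\Phi$, and every $C\in\mathcal C_\Phi$ is the direct sum of the maximal elements of $\mathcal G$ contained in $C$ (its $\mathcal G$-decomposition). The subscript $fund$ selects the subspaces spanned by simple roots. A set $\mathcal S\subseteq\mathcal G$ is $\mathcal G$-nested if any two or more pairwise non comparable elements of $\mathcal S$ have a direct sum which is not in $\mathcal G$. A nestohedron of $\mathcal G$ is a polytope whose poset of nonempty faces, ordered by reverse inclusion, is isomorphic to the poset of $\mathcal G$-nested sets containing $V$, ordered by inclusion; the same definitions are used for sets of subspaces of a quotient of $V$. Let $\delta$ be half the sum of the positive roots. Let $\pi_A$ be the orthogonal projection of $\delta$ to $A$; put $\delta_A=\delta-\pi_A$ for $A\ne V$ and $\delta_V=\delta$. For $B\subsetneq A$ in $\mathcal G_{fund}$ let $R^A_B\,(\ge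 1)$ be the largest coefficient of $\pi_A$ at a simple root in $A$ divided by the smallest coefficient of $\pi_B$ at a simple root in $B$, and let $R^i_j$ be the maximum of the $R^A_B$ with $\dim A=i$, $\dim B=j$, with $R^i_j=1$ if there is no such pair. A list $0<\epsilon_1<\dots<\epsilon_n=a$ is suitable if $\epsilon_i>2R^i_{i-1}\epsilon_{i-1}$ for $i=2,\dots,n$. Fix a suitable list. The permutonestohedron $P_{\mathcal G}(\Phi)$ is the set of points lying in the images under all elements of $W$ of the half-spaces $(x,\delta)\le a$; $(x,\delta_A)\le a-\epsilon_{\dim A}$ for $A\in\mathcal G_{fund}\setminus\{V\}$; and $(x,\delta-\sum_j\pi_{B_j})\le a-\sum_j\epsilon_{\dim B_j}$ for $B\in(\mathcal C_\Phi)_{fund}\setminus\mathcal G_{fund}$ with $\mathcal G_{fund}$-decomposition $B=\bigoplus_j B_j$. Let $H_V$ and $H_A$ be the boundary hyperplanes of the first two kinds of half-spaces, and let $P_{\mathcal G_{fund}}$ be the intersection of $H_V$ with the half-spaces bounded by the $H_A$, $A\in\mathcal G_{fund}\setminus\{V\}$. Let $A_1,\dots,A_k\in\mathcal G_{fund}\setminus\{V\}$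 ($k\ge 0$) be distinct and pairwise non comparable with $\{V,A_1,\dots,A_k\}$ nested in $\mathcal G_{fund}$, and let $\sigma\in W$. Let $W_{A_i}$ be generated by the reflections in the roots lying in $A_i$. The pair $(\sigma W_{A_1}\times\dots\times W_{A_k},\{V,\underline{A_1},\dots,\underline{A_k}\})$ denotes the image under $\sigma$ of the convex hull of all $h(P_{\mathcal G_{fund}}\cap H_{A_1}\cap\dots\cap H_{A_k})$, $h\in W_{A_1}\times\dots\times W_{A_k}$. **Theorem.** This set is a facet of $P_{\mathcal G}(\Phi)$, and it is combinatorially equivalent (it has an isomorphic face poset) to the product $$P_{\overline{\mathcal G}}\times P_{\mathcal G^{A_1}}(\Phi\cap A_1)\times\dots\times P_{\mathcal G^{A_k}}(\Phi\cap A_k).$$ Here $\overline{\mathcal G}$ is the set of nonzero subspaces $(C+D)/D$ of $V/D$ with $C\in\mathcal G_{fund}$ and $D=A_1\oplus\dots\oplus A_k$; $P_{\overline{\mathcal G}}$ is any nestohedron of $\overline{\mathcal G}$ (one exists); $\mathcal G^{A_i}$ is the set of elements of $\mathcal G$ included in $A_i$; and $P_{\mathcal G^{A_i}}(\Phi\cap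 A_i)\subset A_i$ is the permutonestohedron built from the simple roots in $A_i$ and any suitable list for $(\Phi\cap A_i,\mathcal G^{A_i})$. -/

import Mathlib

namespace Permutonestohedron

open scoped InnerProductSpace NNReal

noncomputable section

/-! Root systems in a Euclidean space. -/

section Roots

variable {V : Type*} [NormedAddCommGroup V] [InnerProductSpace ℝ V]

/-- A (reduced, finite) root system in a Euclidean space, spanning the space. Crystallographic
integrality is not required, so all finite Coxeter groups are covered. -/
structure IsRootSystem (Φ : Set V) : Prop where
  finite : Φ.Finite
  span_eq_top : Submodule.span ℝ Φ = ⊤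
  zero_notMem : (0 : V) ∉ Φ
  reduced : ∀ α ∈ Φ, ∀ c : ℝ, c • α ∈ Φ → c = 1 ∨ c = -1
  reflection_mem : ∀ α ∈ Φ, ∀ β ∈ Φ, (ℝ ∙ α)ᗮ.reflection β ∈ Φ

/-- `Δ` is a set of simple roots of `Φ`: it is linearly independent and each root is a linear
combination of elements of `Δ` whose coefficients are all nonnegative or all nonpositive. -/
structure IsSimpleSystem (Φ Δ : Set V) : Prop where
  subset : Δ ⊆ Φ
  linearIndepOn : LinearIndepOn ℝ id Δ
  mem_or_neg_mem : ∀ α ∈ Φ, α ∈ Submodule.span ℝ≥0 Δ ∨ -α ∈ Submodule.span ℝ≥0 Δ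

/-- The positive roots: the roots that are nonnegative combinations of simple roots. -/
def positiveRoots (Φ Δ : Set V) : Set V := {α ∈ Φ | α ∈ Submodule.span ℝ≥0 Δ}

/-- The vector `δ`, half the sum of the positive roots. -/
def delta (Φ Δ : Set V) : V := (1 / 2 : ℝ) • ∑ᶠ α ∈ positiveRoots Φ Δ, α

/-- The group generated by the reflections `s_α`, `α ∈ Ψ`. For `Ψ = Φ` it is `W`; for
`Ψ = Φ ∩ A` it is the parabolic subgroup `W_A`. -/
def weylGroup (Ψ : Set V) : Subgroup (V ≃ₗᵢ[ℝ] V) :=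
  Subgroup.closure {s | ∃ α ∈ Ψ, s = (ℝ ∙ α)ᗮ.reflection}

end Roots

/-! Building sets and nested sets of subspaces. -/

section Building

variable {M : Type*} [AddCommGroup M] [Module ℝ M]

/-- `C_Φ`: the (nonzero) subspaces that are spanned by some elements of `Φ`. -/
def spans (Φ : Set M) : Set (Submodule ℝ M) :=
  {C | C ≠ ⊥ ∧ ∃ T ⊆ Φ, Submodule.span ℝ T = C}

/-- The maximal elements of `G` contained in `C`; for a building set `G` they form the
`G`-decomposition of `C`. -/
def decomposition (G : Set (Submodule ℝ M)) (C : Submodule ℝ M) : Set (Submodule ℝ M) :=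
  {A | Maximal (fun X => X ∈ G ∧ X ≤ C) A}

/-- `G` is a building set associated to `Φ` (that is, to the arrangement of the lines `ℝα`). -/
structure IsBuildingSet (Φ : Set M) (G : Set (Submodule ℝ M)) : Prop where
  subset : G ⊆ spans Φ
  line_mem : ∀ α ∈ Φ, ℝ ∙ α ∈ G
  indep : ∀ C ∈ spans Φ, sSupIndep (decomposition G C)
  sSup_eq : ∀ C ∈ spans Φ, sSup (decomposition G C) = C

/-- `G_fund`: the elements of `G` that are spanned by some of the simple roots. -/
def fund (Δ : Set M) (G : Set (Submodule ℝ M)) : Set (Submodule ℝ M) :=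
  {A ∈ G | ∃ T ⊆ Δ, Submodule.span ℝ T = A}

/-- `S` is `G`-nested: any two or more pairwise non comparable elements of `S` are in direct sum,
and this direct sum does not belong to `G`. -/
def IsNested (G S : Set (Submodule ℝ M)) : Prop :=
  S ⊆ G ∧ ∀ T ⊆ S, T.Nontrivial → IsAntichain (· ≤ ·) T → sSupIndep T ∧ sSup T ∉ G

/-- The nested set complex: the `G`-nested sets that contain the whole space, ordered by
inclusion (used for `G` containing the whole space, its only maximal element). -/
abbrev NestedComplex (G : Set (Submodule ℝ M)) : Type _ :=
  {S : Set (Submodule ℝ M) // IsNested G S ∧ ⊤ ∈ S}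

/-- `G^A`: the elements of `G` included in `A`, as subspaces of `A`. -/
def restrictBuilding (G : Set (Submodule ℝ M)) (A : Submodule ℝ M) : Set (Submodule ℝ A) :=
  {C | C.map A.subtype ∈ G}

/-- The (nonzero) subspaces `(C + D) / D` of the quotient by `D`, for `C ∈ G`. -/
def quotientBuilding (G : Set (Submodule ℝ M)) (D : Submodule ℝ M) :
    Set (Submodule ℝ (M ⧸ D)) :=
  {K | K ≠ ⊥ ∧ ∃ C ∈ G, C.map D.mkQ = K}

end Building

/-! Polytopes and their faces. -/

section Polytopes

variable {E F : Type*} [AddCommGroup E] [Module ℝ E] [TopologicalSpace E]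
  [AddCommGroup F] [Module ℝ F] [TopologicalSpace F]

/-- A polytope is the convex hull of a finite set. -/
def IsPolytope (P : Set E) : Prop := ∃ s : Set E, s.Finite ∧ P = convexHull ℝ s

/-- The faces of a polytope (the empty face and the polytope included), ordered by inclusion. -/
abbrev Face (P : Set E) : Type _ := {X : Set E // IsExposed ℝ P X}

/-- The nonempty faces of a polytope, ordered by inclusion. -/
abbrev NonemptyFace (P : Set E) : Type _ := {X : Set E // X.Nonempty ∧ IsExposed ℝ P X}

/-- Combinatorial equivalence: the face posets are isomorphic. -/
def CombEquiv (P : Set E) (Q : Set F) : Prop := Nonempty (Face P ≃o Face Q)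

/-- `X` is a facet of `P`: a nonempty face of codimension one. -/
def IsFacet (P X : Set E) : Prop :=
  X.Nonempty ∧ IsExposed ℝ P X ∧
    Module.finrank ℝ (vectorSpan ℝ X) + 1 = Module.finrank ℝ (vectorSpan ℝ P)

/-- `N` is a nestohedron `P_G`: a polytope whose poset of (nonempty) faces, ordered by reverse
inclusion, is isomorphic to the nested set complex of `G`. -/
def IsNestohedron {M : Type*} [AddCommGroup M] [Module ℝ M] (G : Set (Submodule ℝ M))
    (N : Set E) : Prop :=
  IsPolytope N ∧ Nonempty ((NonemptyFace N)ᵒᵈ ≃o NestedComplex G)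

end Polytopes

/-! The permutonestohedron. -/

section Permuto

variable {V : Type*} [NormedAddCommGroup V] [InnerProductSpace ℝ V] [FiniteDimensional ℝ V]

/-- `π_A`: the orthogonal projection of `δ` to `A`. -/
def piVec (Φ Δ : Set V) (A : Submodule ℝ V) : V := A.starProjection (delta Φ Δ)

/-- The coefficients, at the simple roots lying in `A`, of `x` written as a linear combination
of simple roots. -/
def simpleCoeffs (Δ : Set V) (A : Submodule ℝ V) (x : V) : Set ℝ :=
  {r | ∃ c ∈ Finsupp.supported ℝ ℝ Δ, Finsupp.linearCombination ℝ id c = x ∧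
    ∃ α ∈ Δ, α ∈ A ∧ c α = r}

/-- `R^A_B`: the largest coefficient of `π_A` divided by the smallest coefficient of `π_B`. -/
def ratio (Φ Δ : Set V) (A B : Submodule ℝ V) : ℝ :=
  sSup (simpleCoeffs Δ A (piVec Φ Δ A)) / sInf (simpleCoeffs Δ B (piVec Φ Δ B))

/-- `R^i_j`: the maximum of the `R^A_B` for `B ⊂ A` in `G_fund` of dimensions `j < i`. Each
`R^A_B` is at least `1`, so inserting `1` only matters when there is no such pair; then
`R^i_j = 1`. -/
def maxRatio (Φ Δ : Set V) (G : Set (Submodule ℝ V)) (i j : ℕ) : ℝ :=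
  sSup (insert 1 {r | ∃ A ∈ fund Δ G, ∃ B ∈ fund Δ G, B < A ∧
    Module.finrank ℝ A = i ∧ Module.finrank ℝ B = j ∧ r = ratio Φ Δ A B})

/-- Suitable lists `ε 1 < ⋯ < ε n`, where `n` is the dimension of `V` (the values of `ε` outside
`1, …, n` play no role). -/
structure IsSuitableList (Φ Δ : Set V) (G : Set (Submodule ℝ V)) (ε : ℕ → ℝ) : Prop where
  pos : ∀ i, 1 ≤ i → i ≤ Module.finrank ℝ V → 0 < ε i
  lt : ∀ i, 1 ≤ i → i + 1 ≤ Module.finrank ℝ V → ε i < ε (i + 1)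
  suitable : ∀ i, 1 ≤ i → i + 1 ≤ Module.finrank ℝ V →
    2 * maxRatio Φ Δ G (i + 1) i * ε i < ε (i + 1)

open scoped Classical in
/-- `δ_A = δ - π_A`, the projection of `δ` to the orthogonal of `A`, for `A ≠ V`, and
`δ_V = δ`. -/
def deltaVec (Φ Δ : Set V) (A : Submodule ℝ V) : V :=
  if A = ⊤ then delta Φ Δ else delta Φ Δ - piVec Φ Δ A

open scoped Classical in
/-- The right-hand side of the equation of `H_A`: it is `a = ε n` for `A = V` and
`a - ε (dim A)` otherwise. -/
def level (ε : ℕ → ℝ) (A : Submodule ℝ V) : ℝ :=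
  if A = ⊤ then ε (Module.finrank ℝ V)
  else ε (Module.finrank ℝ V) - ε (Module.finrank ℝ A)

/-- The hyperplane `H_A`, for `A ∈ G_fund`. -/
def hyperplane (Φ Δ : Set V) (ε : ℕ → ℝ) (A : Submodule ℝ V) : Set V :=
  {x | ⟪x, deltaVec Φ Δ A⟫_ℝ = level ε A}

/-- The half-space `HS_A` bounded by `H_A`, for `A ∈ G_fund`. -/
def halfSpace (Φ Δ : Set V) (ε : ℕ → ℝ) (A : Submodule ℝ V) : Set V :=
  {x | ⟪x, deltaVec Φ Δ A⟫_ℝ ≤ level ε A}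

/-- The half-space attached to a subspace `B` that is spanned by simple roots but is not in
`G_fund`, by means of the `G_fund`-decomposition of `B`. -/
def halfSpaceBar (Φ Δ : Set V) (G : Set (Submodule ℝ V)) (ε : ℕ → ℝ) (B : Submodule ℝ V) :
    Set V :=
  {x | ⟪x, delta Φ Δ - ∑ᶠ A ∈ decomposition (fund Δ G) B, piVec Φ Δ A⟫_ℝ ≤
    ε (Module.finrank ℝ V) - ∑ᶠ A ∈ decomposition (fund Δ G) B, ε (Module.finrank ℝ A)}

/-- The permutonestohedron `P_G(Φ)` determined by the list `ε`. -/
def permutonestohedron (Φ Δ : Set V) (G : Set (Submodule ℝ V)) (ε : ℕ → ℝ) : Set V :=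
  {x | ∀ σ ∈ weylGroup Φ,
    (∀ A ∈ fund Δ G, x ∈ σ '' halfSpace Φ Δ ε A) ∧
    (∀ B ∈ fund Δ (spans Φ) \ fund Δ G, x ∈ σ '' halfSpaceBar Φ Δ G ε B)}

/-- The realization of the nestohedron of `G_fund` in the fundamental chamber: the intersection
of `H_V` with the half-spaces `HS_A`, for `A ∈ G_fund`. -/
def fundNestohedron (Φ Δ : Set V) (G : Set (Submodule ℝ V)) (ε : ℕ → ℝ) : Set V :=
  {x | x ∈ hyperplane Φ Δ ε ⊤ ∧ ∀ A ∈ fund Δ G, x ∈ halfSpace Φ Δ ε A}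

/-- The face of that nestohedron associated with the nested set `S`. -/
def nestedFace (Φ Δ : Set V) (G : Set (Submodule ℝ V)) (ε : ℕ → ℝ)
    (S : Set (Submodule ℝ V)) : Set V :=
  {x | x ∈ fundNestohedron Φ Δ G ε ∧ ∀ A ∈ S, x ∈ hyperplane Φ Δ ε A}

/-- The product, in `W`, of the parabolic subgroups `W_A` for `A ∈ L`. -/
def labelGroup (Φ : Set V) (L : Set (Submodule ℝ V)) : Subgroup (V ≃ₗᵢ[ℝ] V) :=
  ⨆ A ∈ L, weylGroup (Φ ∩ A)

/-- The face of the permutonestohedron denoted by the pair `(σH, S)`, where `L` is the set of the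
minimal elements `A` of `S` labelled by `W_A` (the other ones have trivial label) and `H` is the
product of the labels: the image by `σ` of the convex hull of the images under `H` of the face of
the nestohedron associated with `S`. -/
def labelledFace (Φ Δ : Set V) (G : Set (Submodule ℝ V)) (ε : ℕ → ℝ) (σ : V ≃ₗᵢ[ℝ] V)
    (S L : Set (Submodule ℝ V)) : Set V :=
  σ '' convexHull ℝ (⋃ h ∈ labelGroup Φ L, h '' nestedFace Φ Δ G ε S)

/-- `P_{G^A}(Φ ∩ A)`, a polytope in `A`; its simple roots are those in `A`. -/
def smallPermutonestohedron (Φ Δ : Set V) (G : Set (Submodule ℝ V)) (A : Submodule ℝ V)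
    (η : ℕ → ℝ) : Set A :=
  permutonestohedron ((↑) ⁻¹' Φ : Set A) ((↑) ⁻¹' Δ) (restrictBuilding G A) η

end Permuto

end

end Permutonestohedron

open Permutonestohedron

namespace Permutonestohedron

open scoped InnerProductSpace NNReal

/-! ### Incidence relations and the posets of their extents -/

/-! The nonempty faces of a polytope can be read from any finite system of inequalities defining it
and any family of points whose convex hull it is: they correspond to the nonempty sets of points cut
out by making some inequalities tight (`IsPolyhedron.nonempty_nonemptyFace_orderIso`). These sets
are the extents of an incidence relation. Points tight for the same inequalities may be identified,
and a product of relations has the product of the posets as its poset of extents. The combinatorial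
part of the theorem thus becomes a question about which cells lie on which hyperplanes.

A subspace spanned by simple roots is a set `B` of simple roots, and a point `x` is recorded by its
products with the simple roots. The three kinds of half-spaces form one family: each proper set `B`
has the normal vector `δ - ∑ π_K`, summed over the components `K` of `B`. It is dominant and is
orthogonal to exactly the simple roots in `B`. The difference of the two sides of its inequality is
the excess of the whole set minus the excess of `B` (`inner_normalVec_sub_lev`), so a dominant point
of the polytope is one for which the whole set has minimal excess.

The suitable list enters through `IsWeight`, a growth condition with factors `2 ^ |A|`. Since powers
of two of sizes are superadditive over disjoint unions, the condition yields three facts. Tight sets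
at points of the nestohedron in the chamber are nested (`cnested_tightSet`). Every nested set
containing the whole set occurs (`exists_tightSet_eq`). The sets of minimal excess have a least one,
and coordinates outside any of them are positive (`subset_of_excess_minimal`,
`pos_of_excess_minimal`). If that least set contained `i`, every tight normal would be orthogonal to
`b i`; hence at a dominant vertex it is empty and the vertex lies in the nestohedron. So the
polytope is the convex hull of the `W`-images of the nestohedron. A cell `(h, S)` lies on the
hyperplane `(w, B)` exactly when `h⁻¹ w` fixes the normal vector of `B` and the components of `B`
belong to `S`.

Let `D` be the sum of the `A i`. The labelled face is the part of the polytope on the hyperplane of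
`σ` applied to the normal vector of `D`; a generic point of it lies on no other hyperplane, so it is
a facet (`isFacet_cutFace`). Its cells are pairs `(h, S)` with `h` in the product of the `W_{A i}`
and `S` containing the `A i`. Such an `S` amounts to a nested set of the quotient and one in each `A
i` (`cnested_contr`, `cnested_restr`, `cnested_glue`). Whether an element of `W` fixes a dominant
vector depends only on the simple roots orthogonal to it (`map_eq_self_of_map_eq_self`), so fixing
the normal vector of `B` can be tested in each `A i` separately. Hence the incidence relation of the
face is that of the product (`nonempty_extents_cutIncidence`). The relations no longer mention the
lists, so any suitable lists and any nestohedron will do. -/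

section Extents

/-- The nonempty sets of objects that are cut out by a set of attributes. -/
abbrev Extents {O A : Type*} (r : O → A → Prop) : Type _ :=
  {T : Set O // T.Nonempty ∧ ∃ s : Set A, T = {o | ∀ a ∈ s, r o a}}

/-- Taking preimages under a surjection embeds sets of objects, and the two hypotheses say that both
relations cut out the same sets. An attribute held by no object is harmless because extents are
nonempty; this allows hyperplanes that miss a face altogether to be discarded. -/
theorem Extents.nonempty_orderIso_of_surjective {O A O' A' : Type*} {r : O → A → Prop}
    {r' : O' → A' → Prop} (φ : O → O') (hφ : Function.Surjective φ)
    (h : ∀ a, (∀ o, ¬ r o a) ∨ ∃ s : Set A', ∀ o, r o a ↔ ∀ a' ∈ s, r' (φ o) a')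
    (h' : ∀ a', ∃ s : Set A, ∀ o, r' (φ o) a' ↔ ∀ a ∈ s, r o a) :
    Nonempty (Extents r ≃o Extents r') := by
  choose S hS using h'
  let F : Extents r' → Extents r := fun T => ⟨φ ⁻¹' T.1, by
    obtain ⟨⟨o', ho'⟩, s, hs⟩ := T.2
    obtain ⟨o, rfl⟩ := hφ o'
    refine ⟨⟨o, ho'⟩, ⋃ a' ∈ s, S a', ?_⟩
    ext x
    rw [hs]
    simp only [Set.mem_preimage, Set.mem_ofPred_eq, Set.mem_iUnion, hS]
    constructor
    · rintro hx a ⟨a', ha', ha⟩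
      exact hx a' ha' a ha
    · intro hx a' ha' a ha
      exact hx a ⟨a', ha', ha⟩⟩
  have hF : ∀ T U, F T ≤ F U ↔ T ≤ U := fun T U => by
    change φ ⁻¹' T.1 ⊆ φ ⁻¹' U.1 ↔ T.1 ⊆ U.1
    exact hφ.preimage_subset_preimage_iff
  refine ⟨(RelIso.ofSurjective (OrderEmbedding.ofMapLEIff F hF) ?_).symm⟩
  rintro ⟨T, ⟨o, ho⟩, s, hs⟩
  have hs' : ∀ a ∈ s, ∃ u : Set A', ∀ o, r o a ↔ ∀ a' ∈ u, r' (φ o) a' := fun a ha => by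
    rcases h a with h | h
    · rw [hs] at ho
      exact absurd (ho a ha) (h o)
    · exact h
  choose! u hu using hs'
  have key : T = φ ⁻¹' {o' | ∀ a' ∈ ⋃ a ∈ s, u a, r' o' a'} := by
    ext x
    rw [hs]
    simp only [Set.mem_preimage, Set.mem_ofPred_eq, Set.mem_iUnion]
    constructor
    · rintro hx a' ⟨a, ha, ha'⟩
      exact (hu a ha x).1 (hx a ha) a' ha'
    · intro hx a ha
      exact (hu a ha x).2 fun a' ha' => hx a' ⟨a, ha, ha'⟩
  refine ⟨⟨_, ⟨φ o, ?_⟩, ⋃ a ∈ s, u a, rfl⟩, Subtype.ext key.symm⟩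
  rw [key] at ho
  exact ho

/-- The product of two incidence relations. -/
def prodRel {O A O' A' : Type*} (r : O → A → Prop) (r' : O' → A' → Prop) :
    O × O' → A ⊕ A' → Prop := fun o a => Sum.elim (r o.1) (r' o.2) a

/-- The product of a family of incidence relations. -/
def piRel {κ : Type*} {O A : κ → Type*} (r : ∀ i, O i → A i → Prop) :
    (∀ i, O i) → (Σ i, A i) → Prop := fun o a => r a.1 (o a.1) a.2

/-- Each attribute constrains one factor only, so extents are rectangles. Nonemptiness is needed to
recover the two sides from a rectangle. -/
theorem Extents.nonempty_prod_orderIso {O A O' A' : Type*} (r : O → A → Prop)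
    (r' : O' → A' → Prop) :
    Nonempty (Extents (prodRel r r') ≃o Extents r × Extents r') := by
  let F : Extents r × Extents r' → Extents (prodRel r r') := fun T => ⟨T.1.1 ×ˢ T.2.1, by
    obtain ⟨⟨T, hT, s, rfl⟩, ⟨T', hT', s', rfl⟩⟩ := T
    refine ⟨hT.prod hT', Sum.inl '' s ∪ Sum.inr '' s', ?_⟩
    ext ⟨x, y⟩
    simp [prodRel, or_imp, forall_and]⟩
  have hF : ∀ T U, F T ≤ F U ↔ T ≤ U := fun T U => by
    change T.1.1 ×ˢ T.2.1 ⊆ U.1.1 ×ˢ U.2.1 ↔ T.1.1 ⊆ U.1.1 ∧ T.2.1 ⊆ U.2.1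
    rw [Set.prod_subset_prod_iff]
    simp [T.1.2.1.ne_empty, T.2.2.1.ne_empty]
  refine ⟨(RelIso.ofSurjective (OrderEmbedding.ofMapLEIff F hF) ?_).symm⟩
  rintro ⟨T, ⟨⟨o, o'⟩, ho⟩, s, rfl⟩
  simp only [Set.mem_ofPred_eq] at ho
  refine ⟨⟨⟨{x | ∀ a ∈ Sum.inl ⁻¹' s, r x a}, ⟨o, fun a ha => ho _ ha⟩, _, rfl⟩,
    ⟨{x | ∀ a ∈ Sum.inr ⁻¹' s, r' x a}, ⟨o', fun a ha => ho _ ha⟩, _, rfl⟩⟩, Subtype.ext ?_⟩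
  change _ ×ˢ _ = _
  ext ⟨x, y⟩
  simp [prodRel, Sum.forall]

theorem Extents.nonempty_pi_orderIso {κ : Type*} {O A : κ → Type*}
    (r : ∀ i, O i → A i → Prop) :
    Nonempty (Extents (piRel r) ≃o ∀ i, Extents (r i)) := by
  let F : (∀ i, Extents (r i)) → Extents (piRel r) := fun T =>
    ⟨Set.univ.pi fun i => (T i).1, by
    have hT := fun i => (T i).2.1
    have hs := fun i => (T i).2.2
    choose s hs using hs
    refine ⟨Set.univ_pi_nonempty_iff.2 hT, {a | a.2 ∈ s a.1}, ?_⟩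
    ext x
    simp only [Set.mem_univ_pi, hs, Set.mem_ofPred_eq, piRel, Sigma.forall]⟩
  have hF : ∀ T U, F T ≤ F U ↔ T ≤ U := fun T U => by
    change (Set.univ.pi fun i => (T i).1) ⊆ (Set.univ.pi fun i => (U i).1) ↔
      ∀ i, (T i).1 ⊆ (U i).1
    rw [Set.univ_pi_subset_univ_pi_iff]
    simp [fun i => (T i).2.1.ne_empty]
  refine ⟨(RelIso.ofSurjective (OrderEmbedding.ofMapLEIff F hF) ?_).symm⟩
  rintro ⟨T, ⟨o, ho⟩, s, rfl⟩
  refine ⟨fun i => ⟨{x | ∀ a ∈ {a | Sigma.mk i a ∈ s}, r i x a},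
    ⟨o i, fun a ha => ho ⟨i, a⟩ ha⟩, _, rfl⟩, Subtype.ext ?_⟩
  change Set.univ.pi _ = _
  ext x
  simp [piRel, Sigma.forall]

end Extents

/-! ### Faces of polytopes -/

section Faces

variable {E F : Type*} [AddCommGroup E] [Module ℝ E] [TopologicalSpace E]
  [AddCommGroup F] [Module ℝ F] [TopologicalSpace F]

open scoped Classical in
/-- The face poset is the poset of nonempty faces with a least element added. -/
theorem nonempty_face_orderIso_withBot (P : Set E) :
    Nonempty (Face P ≃o WithBot (NonemptyFace P)) := by
  let f : WithBot (NonemptyFace P) → Face P := fun X =>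
    -- Exposedness only asks something of nonempty sets, so the empty set is a face and serves as
    -- the bottom element.
    WithBot.recBotCoe ⟨∅, fun h => absurd h (by simp)⟩ (fun X => ⟨X.1, X.2.2⟩) X
  have hf : ∀ X Y, f X ≤ f Y ↔ X ≤ Y := by
    intro X Y
    induction X with
    | bot => exact iff_of_true (Set.empty_subset _) bot_le
    | coe X =>
      induction Y with
      | bot =>
        simp only [f, WithBot.recBotCoe_coe, WithBot.recBotCoe_bot, WithBot.not_coe_le_bot,
          iff_false]
        intro h
        exact X.2.1.ne_empty (Set.subset_empty_iff.1 h)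
      | coe Y => exact (WithBot.coe_le_coe (a := X) (b := Y)).symm
  refine ⟨(RelIso.ofSurjective (OrderEmbedding.ofMapLEIff f hf) ?_).symm⟩
  rintro ⟨X, hX⟩
  rcases X.eq_empty_or_nonempty with rfl | h
  · exact ⟨⊥, rfl⟩
  · exact ⟨((⟨X, h, hX⟩ : NonemptyFace P) : WithBot (NonemptyFace P)), rfl⟩

theorem combEquiv_of_nonemptyFace {P : Set E} {Q : Set F}
    (e : NonemptyFace P ≃o NonemptyFace Q) : CombEquiv P Q := by
  obtain ⟨f⟩ := nonempty_face_orderIso_withBot P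
  obtain ⟨g⟩ := nonempty_face_orderIso_withBot Q
  exact ⟨f.trans (e.withBotCongr.trans g.symm)⟩

/-- A functional on a product is a sum of functionals on the factors, and such a sum is maximal
exactly where both terms are. -/
theorem nonempty_nonemptyFace_prod (P : Set E) (Q : Set F) :
    Nonempty (NonemptyFace (P ×ˢ Q) ≃o NonemptyFace P × NonemptyFace Q) := by
  let f : NonemptyFace P × NonemptyFace Q → NonemptyFace (P ×ˢ Q) := fun X =>
    ⟨X.1.1 ×ˢ X.2.1, X.1.2.1.prod X.2.2.1, fun _ => by
      obtain ⟨⟨X, ⟨x, hx⟩, hX⟩, ⟨Y, ⟨y, hy⟩, hY⟩⟩ := X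
      obtain ⟨l, rfl⟩ := hX ⟨x, hx⟩
      obtain ⟨m, rfl⟩ := hY ⟨y, hy⟩
      refine ⟨l.comp (ContinuousLinearMap.fst ℝ E F) + m.comp (ContinuousLinearMap.snd ℝ E F), ?_⟩
      ext ⟨p, q⟩
      simp only [Set.mem_prod, Set.mem_ofPred_eq, add_apply,
        ContinuousLinearMap.comp_apply, ContinuousLinearMap.coe_fst',
        ContinuousLinearMap.coe_snd', Prod.forall]
      constructor
      · rintro ⟨⟨h1, h2⟩, h3, h4⟩
        exact ⟨⟨h1, h3⟩, fun a b hab => add_le_add (h2 a hab.1) (h4 b hab.2)⟩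
      · rintro ⟨⟨h1, h3⟩, h⟩
        exact ⟨⟨h1, fun a ha => by simpa using h a q ⟨ha, h3⟩⟩,
          h3, fun b hb => by simpa using h p b ⟨h1, hb⟩⟩⟩
  have hf : ∀ X Y, f X ≤ f Y ↔ X ≤ Y := fun X Y => by
    change X.1.1 ×ˢ X.2.1 ⊆ Y.1.1 ×ˢ Y.2.1 ↔ X.1.1 ⊆ Y.1.1 ∧ X.2.1 ⊆ Y.2.1
    rw [Set.prod_subset_prod_iff]
    simp [X.1.2.1.ne_empty, X.2.2.1.ne_empty]
  refine ⟨(RelIso.ofSurjective (OrderEmbedding.ofMapLEIff f hf) ?_).symm⟩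
  rintro ⟨X, ⟨⟨x, y⟩, hxy⟩, hX⟩
  obtain ⟨l, rfl⟩ := hX ⟨_, hxy⟩
  have hl : ∀ a b, l (a, b) = l (a, 0) + l (0, b) := fun a b => by simp [← map_add]
  obtain ⟨⟨hx, hy⟩, hmax⟩ := hxy
  have hx' : ∀ a ∈ P, l (a, 0) ≤ l (x, 0) := fun a ha => by
    have := hmax (a, y) ⟨ha, hy⟩
    rw [hl a, hl x] at this
    simpa using this
  have hy' : ∀ b ∈ Q, l (0, b) ≤ l (0, y) := fun b hb => by
    have := hmax (x, b) ⟨hx, hb⟩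
    rw [hl x b, hl x y] at this
    simpa using this
  refine ⟨⟨⟨{p | p ∈ P ∧ ∀ a ∈ P, l (a, 0) ≤ l (p, 0)}, ⟨x, hx, hx'⟩,
      fun _ => ⟨l.comp (ContinuousLinearMap.inl ℝ E F), by ext; simp⟩⟩,
    ⟨{q | q ∈ Q ∧ ∀ b ∈ Q, l (0, b) ≤ l (0, q)}, ⟨y, hy, hy'⟩,
      fun _ => ⟨l.comp (ContinuousLinearMap.inr ℝ E F), by ext; simp⟩⟩⟩, Subtype.ext ?_⟩
  change _ ×ˢ _ = _
  ext ⟨p, q⟩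
  simp only [Set.mem_prod, Set.mem_ofPred_eq, Prod.forall]
  constructor
  · rintro ⟨⟨h1, h2⟩, h3, h4⟩
    refine ⟨⟨h1, h3⟩, fun a b hab => ?_⟩
    rw [hl a, hl p]
    exact add_le_add (h2 a hab.1) (h4 b hab.2)
  · rintro ⟨⟨h1, h3⟩, h⟩
    refine ⟨⟨h1, fun a ha => ?_⟩, h3, fun b hb => ?_⟩
    · have := h a q ⟨ha, h3⟩
      rw [hl a, hl p] at this
      simpa using this
    · have := h p b ⟨h1, hb⟩
      rw [hl p b, hl p q] at this
      simpa using this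

theorem nonempty_nonemptyFace_pi {κ : Type*} [Finite κ] {E : κ → Type*}
    [∀ i, AddCommGroup (E i)] [∀ i, Module ℝ (E i)] [∀ i, TopologicalSpace (E i)]
    (P : ∀ i, Set (E i)) :
    Nonempty (NonemptyFace (Set.univ.pi P) ≃o ∀ i, NonemptyFace (P i)) := by
  classical
  have := Fintype.ofFinite κ
  have key : ∀ (l : ∀ i, StrongDual ℝ (E i)) (x : ∀ i, E i), x ∈ Set.univ.pi P →
      ((∀ y ∈ Set.univ.pi P, ∑ i, l i (y i) ≤ ∑ i, l i (x i)) ↔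
        ∀ i, ∀ y ∈ P i, l i y ≤ l i (x i)) := by
    intro l x hx
    constructor
    · intro h i y hy
      -- Comparison with a point that differs from `x` in the coordinate `i` only isolates one term
      -- of the sum.
      have := h (Function.update x i y) (fun j _ => by
        by_cases hj : j = i
        · subst hj; simpa using hy
        · simpa [hj] using hx j trivial)
      rw [← Finset.add_sum_erase _ _ (Finset.mem_univ i),
        ← Finset.add_sum_erase _ (fun j => l j (x j)) (Finset.mem_univ i)] at this
      rw [Finset.sum_congr rfl (g := fun j => l j (x j))
        (fun j hj => by simp [Finset.ne_of_mem_erase hj])] at this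
      simpa only [Function.update_self, add_le_add_iff_right] using this
    · intro h y hy
      exact Finset.sum_le_sum fun i _ => h i _ (hy i trivial)
  let f : (∀ i, NonemptyFace (P i)) → NonemptyFace (Set.univ.pi P) := fun X =>
    ⟨Set.univ.pi fun i => (X i).1, Set.univ_pi_nonempty_iff.2 fun i => (X i).2.1, fun _ => by
      have := fun i => (X i).2.2 (X i).2.1
      choose l hl using this
      refine ⟨∑ i, (l i).comp (ContinuousLinearMap.proj i), ?_⟩
      ext x
      simp only [hl, Set.mem_univ_pi, Set.mem_ofPred_eq, sum_apply,
        ContinuousLinearMap.comp_apply, ContinuousLinearMap.proj_apply]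
      rw [forall_and]
      refine and_congr_right fun hx => ?_
      simpa using (key l x (by simpa using hx)).symm⟩
  have hf : ∀ X Y, f X ≤ f Y ↔ X ≤ Y := fun X Y => by
    change (Set.univ.pi fun i => (X i).1) ⊆ (Set.univ.pi fun i => (Y i).1) ↔
      ∀ i, (X i).1 ⊆ (Y i).1
    rw [Set.univ_pi_subset_univ_pi_iff]
    simp [fun i => (X i).2.1.ne_empty]
  refine ⟨(RelIso.ofSurjective (OrderEmbedding.ofMapLEIff f hf) ?_).symm⟩
  rintro ⟨X, ⟨x, hx⟩, hX⟩
  obtain ⟨L, rfl⟩ := hX ⟨_, hx⟩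
  let l : ∀ i, StrongDual ℝ (E i) := fun i => L.comp (ContinuousLinearMap.single ℝ E i)
  have hL : ∀ y, L y = ∑ i, l i (y i) := fun y => by
    conv_lhs => rw [← Finset.univ_sum_single y]
    simp [l]
  simp only [hL] at hx ⊢
  have hx2 := (key l x hx.1).1 hx.2
  refine ⟨fun i => ⟨{p | p ∈ P i ∧ ∀ a ∈ P i, l i a ≤ l i p}, ⟨x i, hx.1 i trivial, hx2 i⟩,
    fun _ => ⟨l i, rfl⟩⟩, Subtype.ext ?_⟩
  change Set.univ.pi _ = _
  ext y
  simp only [Set.mem_univ_pi, Set.mem_ofPred_eq]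
  rw [forall_and]
  refine and_congr_right fun hy => ?_
  simpa using (key l y (by simpa using hy)).symm

end Faces

end Permutonestohedron

namespace Permutonestohedron

/-! ### Polyhedra given by finitely many inequalities and equalities -/

section Polyhedra

variable {E : Type*} [AddCommGroup E] [Module ℝ E] [TopologicalSpace E]

/-- `P` is the solution set of the inequalities `f j x ≤ c j`, those with `j ∈ K` being
equalities. -/
def IsPolyhedron {J : Type*} (P : Set E) (f : J → StrongDual ℝ E) (c : J → ℝ) (K : Set J) : Prop :=
  ∀ x, x ∈ P ↔ (∀ j, f j x ≤ c j) ∧ ∀ j ∈ K, f j x = c j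

namespace IsPolyhedron

variable {J : Type*} {P : Set E} {f : J → StrongDual ℝ E} {c : J → ℝ} {K : Set J}

theorem convex (hP : IsPolyhedron P f c K) : Convex ℝ P := by
  intro x hx y hy a b ha hb hab
  rw [hP] at hx hy ⊢
  have h1 : ∀ j, a * c j + b * c j = c j := fun j => by rw [← add_mul, hab, one_mul]
  refine ⟨fun j => ?_, fun j hj => ?_⟩
  · rw [map_add, map_smul, map_smul, smul_eq_mul, smul_eq_mul, ← h1 j]
    exact add_le_add (mul_le_mul_of_nonneg_left (hx.1 j) ha)
      (mul_le_mul_of_nonneg_left (hy.1 j) hb)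
  · rw [map_add, map_smul, map_smul, smul_eq_mul, smul_eq_mul, hx.2 j hj, hy.2 j hj, h1 j]

/-- In a nonempty convex part of `P` there is a point at which the fewest inequalities are
tight. -/
theorem exists_tight_minimal [Finite J] (hP : IsPolyhedron P f c K) {X : Set E} (hX : Convex ℝ X)
    (hXP : X ⊆ P) (hne : X.Nonempty) :
    ∃ x ∈ X, ∀ y ∈ X, ∀ j, f j x = c j → f j y = c j := by
  obtain ⟨_, ⟨x, hx, rfl⟩, hmin⟩ := WellFounded.has_min (wellFounded_lt (α := ℕ))
    ((fun x => {j | f j x = c j}.ncard) '' X) (hne.image _)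
  refine ⟨x, hx, fun y hy j hj => ?_⟩
  -- An inequality tight at the midpoint is tight at both ends, so minimality of `x` makes the tight
  -- sets at `m` and at `x` coincide.
  set m : E := (1 / 2 : ℝ) • x + (1 / 2 : ℝ) • y with hm
  have hmX : m ∈ X := hX hx hy (by norm_num) (by norm_num) (by norm_num)
  have htight : ∀ j, f j m = c j → f j x = c j ∧ f j y = c j := fun j h => by
    have h1 := ((hP x).1 (hXP hx)).1 j
    have h2 := ((hP y).1 (hXP hy)).1 j
    rw [hm, map_add, map_smul, map_smul, smul_eq_mul, smul_eq_mul] at h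
    constructor <;> linarith
  have hsub : {j | f j m = c j} ⊆ {j | f j x = c j} := fun j h => (htight j h).1
  have heq := Set.eq_of_subset_of_ncard_le hsub
    (not_lt.1 (hmin _ ⟨m, hmX, rfl⟩)) (Set.toFinite _)
  exact (htight j (heq.symm.subset hj)).2

/-- A point of `P` can be moved a little in the directions that keep the tight inequalities
tight. -/
theorem exists_add_smul_mem [Finite J] (hP : IsPolyhedron P f c K) {x v : E} (hx : x ∈ P)
    (hv : ∀ j, f j x = c j → f j v = 0) :
    ∃ t : ℝ, 0 < t ∧ ∀ s : ℝ, |s| ≤ t → x + s • v ∈ P := by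
  have hx' := (hP x).1 hx
  have : ∀ j, ∀ᶠ t in nhdsWithin (0 : ℝ) (Set.Ioi 0), ∀ s : ℝ, |s| ≤ t →
      f j (x + s • v) ≤ c j := fun j => by
    rcases (hx'.1 j).eq_or_lt with h | h
    · filter_upwards with t s _
      rw [map_add, map_smul, hv j h, smul_zero, add_zero, h]
    -- The slack at `x` divided by a bound for the speed; adding one avoids division by zero.
    · have h0 : 0 < (c j - f j x) / (|f j v| + 1) := div_pos (by linarith) (by positivity)
      filter_upwards [nhdsWithin_le_nhds (Iio_mem_nhds h0)] with t ht s hs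
      rw [map_add, map_smul, smul_eq_mul]
      have h1 : s * f j v ≤ t * (|f j v| + 1) := calc
        s * f j v ≤ |s| * |f j v| := by rw [← abs_mul]; exact le_abs_self _
        _ ≤ t * (|f j v| + 1) :=
          mul_le_mul hs (by linarith) (abs_nonneg _) ((abs_nonneg s).trans hs)
      have h2 := (lt_div_iff₀ (by positivity)).1 (Set.mem_Iio.1 ht)
      linarith
  obtain ⟨t, ht, ht0⟩ := ((Filter.eventually_all.2 this).and self_mem_nhdsWithin).exists
  refine ⟨t, ht0, fun s hs => (hP _).2 ⟨fun j => ht j s hs, fun j hj => ?_⟩⟩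
  rw [map_add, map_smul, hv j (hx'.2 j hj), smul_zero, add_zero, hx'.2 j hj]

/-- A direction killed by all tight functionals could be followed a little both ways, which would
make `x` the midpoint of a segment. -/
theorem mem_extremePoints_eq_zero [Finite J] (hP : IsPolyhedron P f c K) {x v : E}
    (hx : x ∈ P.extremePoints ℝ) (hv : ∀ j, f j x = c j → f j v = 0) : v = 0 := by
  obtain ⟨t, ht, h⟩ := hP.exists_add_smul_mem hx.1 hv
  have h1 := h t (abs_of_pos ht).le
  have h2 := h (-t) (by rw [abs_neg, abs_of_pos ht])
  have := hx.2 h1 h2 ⟨1 / 2, 1 / 2, by norm_num, by norm_num, by norm_num, by module⟩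
  have h3 : t • v = 0 := by simpa using this
  exact (smul_eq_zero.1 h3).resolve_left ht.ne'

/-- An extreme point is determined by its tight set, and there are finitely many of these. -/
theorem finite_extremePoints [Finite J] (hP : IsPolyhedron P f c K) :
    (P.extremePoints ℝ).Finite := by
  have : Set.InjOn (fun x => {j | f j x = c j}) (P.extremePoints ℝ) := by
    intro x hx y hy hxy
    refine (sub_eq_zero.1 (hP.mem_extremePoints_eq_zero hx (v := y - x) fun j hj => ?_)).symm
    have : f j y = c j := hxy.subset hj
    rw [map_sub, this, hj, sub_self]
  exact Set.Finite.of_finite_image (Set.toFinite _) this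

/-- A face of `P` is determined by the inequalities that are tight on it. -/
theorem mem_of_tight_imp [Finite J] (hP : IsPolyhedron P f c K) {X : Set E} (hX : IsExposed ℝ P X)
    {x y : E} (hx : x ∈ X) (hy : y ∈ P) (h : ∀ j, f j x = c j → f j y = c j) : y ∈ X := by
  obtain ⟨l, rfl⟩ := hX ⟨x, hx⟩
  -- The segment from `y` to `x` can be prolonged beyond `x` inside `P`; since `l` is maximal at
  -- `x`, it cannot be smaller at `y`.
  obtain ⟨t, ht, hmem⟩ := hP.exists_add_smul_mem hx.1 (v := y - x) fun j hj => by
    rw [map_sub, h j hj, hj, sub_self]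
  have h1 := hx.2 _ (hmem (-t) (by rw [abs_neg, abs_of_pos ht]))
  rw [map_add, map_smul, map_sub, smul_eq_mul] at h1
  have h2 : l x ≤ l y := by nlinarith
  exact ⟨hy, fun z hz => (hx.2 z hz).trans h2⟩

/-- The sum of the functionals indexed by `s` exposes this set: once the set is nonempty, the
maximum is the sum of the `c j`, and it is attained only where every term attains its bound. -/
theorem isExposed_of_tight [Finite J] [ContinuousAdd E] [ContinuousConstSMul ℝ E]
    (hP : IsPolyhedron P f c K) (s : Set J) :
    IsExposed ℝ P {x ∈ P | ∀ j ∈ s, f j x = c j} := by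
  rintro ⟨z, hz, hzs⟩
  classical
  have := Fintype.ofFinite J
  refine ⟨∑ j ∈ s.toFinset, f j, ?_⟩
  ext x
  simp only [Set.mem_ofPred_eq, sum_apply]
  refine and_congr_right fun hx => ⟨fun h y hy => ?_, fun h => ?_⟩
  · refine Finset.sum_le_sum fun j hj => ?_
    rw [h j (Set.mem_toFinset.1 hj)]
    exact ((hP y).1 hy).1 j
  · have h1 : ∀ j ∈ s.toFinset, f j x ≤ f j z := fun j hj => by
      rw [hzs j (Set.mem_toFinset.1 hj)]
      exact ((hP x).1 hx).1 j
    have h2 := (Finset.sum_eq_sum_iff_of_le h1).1 (le_antisymm (Finset.sum_le_sum h1) (h z hz))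
    exact fun j hj => (h2 j (Set.mem_toFinset.2 hj)).trans (hzs j hj)

end IsPolyhedron

/-- With `l` exposing `X` and `x` in `X`, the points where `l` is at most `l x`, and which lie in
the hull of `T ∩ X` in case of equality, form a convex set containing `T`. -/
theorem subset_convexHull_inter_of_isExposed {P X : Set E} (hX : IsExposed ℝ P X) {T : Set E}
    (hP : P = convexHull ℝ T) : X ⊆ convexHull ℝ (T ∩ X) := by
  rintro x hx
  obtain ⟨l, hl⟩ := hX ⟨x, hx⟩
  have hTP : T ⊆ P := hP ▸ subset_convexHull ℝ T
  have hxP : x ∈ P := hX.subset hx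
  rw [hl] at hx
  have hsub : convexHull ℝ T ⊆ {y | l y ≤ l x ∧ (l y = l x → y ∈ convexHull ℝ (T ∩ X))} := by
    refine convexHull_min (fun y hy => ⟨hx.2 y (hTP hy), fun h => subset_convexHull ℝ _ ⟨hy, ?_⟩⟩) ?_
    · rw [hl]
      exact ⟨hTP hy, fun z hz => (hx.2 z hz).trans h.ge⟩
    · intro y hy z hz a b ha hb hab
      simp only [Set.mem_ofPred_eq, map_add, map_smul, smul_eq_mul]
      have h1 : a * l x + b * l x = l x := by rw [← add_mul, hab, one_mul]
      have h2 := mul_le_mul_of_nonneg_left hy.1 ha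
      have h3 := mul_le_mul_of_nonneg_left hz.1 hb
      refine ⟨by linarith, fun h => ?_⟩
      rcases ha.eq_or_lt with rfl | ha
      · obtain rfl : b = 1 := by linarith
        simpa using hz.2 (by linarith)
      rcases hb.eq_or_lt with rfl | hb
      · obtain rfl : a = 1 := by linarith
        simpa using hy.2 (by linarith)
      refine convex_convexHull ℝ _ (hy.2 ?_) (hz.2 ?_) ha.le hb.le hab
      · exact mul_left_cancel₀ ha.ne' (by linarith)
      · exact mul_left_cancel₀ hb.ne' (by linarith)
  exact (hsub (hP ▸ hxP)).2 rfl

/-- The nonempty faces of a polyhedron that is the convex hull of some points are the extents of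
the incidence relation between these points and the inequalities. -/
theorem IsPolyhedron.nonempty_nonemptyFace_orderIso {J O : Type*} [Finite J] [ContinuousAdd E]
    [ContinuousConstSMul ℝ E] {P : Set E} {f : J → StrongDual ℝ E} {c : J → ℝ} {K : Set J}
    (hP : IsPolyhedron P f c K) (pt : O → E) (hpt : P = convexHull ℝ (Set.range pt)) :
    Nonempty (NonemptyFace P ≃o Extents fun o j => f j (pt o) = c j) := by
  have hmem : ∀ o, pt o ∈ P := fun o => hpt ▸ subset_convexHull ℝ _ ⟨o, rfl⟩
  let F : NonemptyFace P → Extents (fun o j => f j (pt o) = c j) := fun X =>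
    ⟨{o | pt o ∈ X.1}, by
      obtain ⟨x, hx⟩ := convexHull_nonempty_iff.1 (X.2.1.mono (subset_convexHull_inter_of_isExposed X.2.2 hpt))
      obtain ⟨⟨o, rfl⟩, hx⟩ := hx
      exact ⟨o, hx⟩, by
      -- A generic point of the face: whatever is tight there is tight on the whole face, so its
      -- tight set defines the face.
      obtain ⟨x, hx, hmin⟩ := hP.exists_tight_minimal (X.2.2.convex hP.convex) X.2.2.subset X.2.1
      refine ⟨{j | f j x = c j}, ?_⟩
      ext o
      exact ⟨fun h j hj => hmin _ h j hj, fun h => hP.mem_of_tight_imp X.2.2 hx (hmem o) h⟩⟩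
  have hF : ∀ X Y, F X ≤ F Y ↔ X ≤ Y := fun X Y => by
    refine ⟨fun h => ?_, fun h o ho => h ho⟩
    change X.1 ⊆ Y.1
    refine (subset_convexHull_inter_of_isExposed X.2.2 hpt).trans (convexHull_min ?_ (Y.2.2.convex hP.convex))
    rintro _ ⟨⟨o, rfl⟩, ho⟩
    exact h ho
  refine ⟨RelIso.ofSurjective (OrderEmbedding.ofMapLEIff F hF) ?_⟩
  rintro ⟨T, ⟨o, ho⟩, s, rfl⟩
  refine ⟨⟨{x ∈ P | ∀ j ∈ s, f j x = c j}, ⟨pt o, hmem o, ho⟩, hP.isExposed_of_tight s⟩,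
    Subtype.ext ?_⟩
  ext o
  exact ⟨fun h => h.2, fun h => ⟨hmem o, h⟩⟩

/-- Krein–Milman; the closure is superfluous because there are finitely many extreme points. -/
theorem IsPolyhedron.convexHull_extremePoints {J : Type*} [Finite J] [IsTopologicalAddGroup E]
    [ContinuousSMul ℝ E] [T2Space E] [LocallyConvexSpace ℝ E] {P : Set E}
    {f : J → StrongDual ℝ E} {c : J → ℝ} {K : Set J}
    (hP : IsPolyhedron P f c K) (hc : IsCompact P) :
    convexHull ℝ (P.extremePoints ℝ) = P := by
  have h : IsClosed (convexHull ℝ (P.extremePoints ℝ)) :=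
    hP.finite_extremePoints.isClosed_convexHull ℝ
  rw [← h.closure_eq]
  exact closure_convexHull_extremePoints hc hP.convex

theorem IsPolyhedron.isClosed {J : Type*} {P : Set E}
    {f : J → StrongDual ℝ E} {c : J → ℝ} {K : Set J} (hP : IsPolyhedron P f c K) :
    IsClosed P := by
  have : P = (⋂ j, {x | f j x ≤ c j}) ∩ ⋂ j ∈ K, {x | f j x = c j} := by
    ext x
    simp [hP x]
  rw [this]
  exact (isClosed_iInter fun j => isClosed_le (f j).continuous continuous_const).inter
    (isClosed_biInter fun j _ => isClosed_eq (f j).continuous continuous_const)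

end Polyhedra

end Permutonestohedron

namespace Permutonestohedron

set_option linter.unusedSectionVars false

/-! ### Building sets of subsets of a finite set -/

section Combinatorics

variable {ι : Type*} [Fintype ι] [DecidableEq ι]

/-- A building set of nonempty subsets of a finite set. -/
structure IsBuilding (𝓑 : Set (Finset ι)) : Prop where
  nonempty : ∀ B ∈ 𝓑, B.Nonempty
  singleton : ∀ i, {i} ∈ 𝓑
  union : ∀ B ∈ 𝓑, ∀ C ∈ 𝓑, ¬ Disjoint B C → B ∪ C ∈ 𝓑

open scoped Classical in
/-- The components of `B`: the maximal elements of the building set contained in `B`. -/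
noncomputable def comps (𝓑 : Set (Finset ι)) (B : Finset ι) : Finset (Finset ι) :=
  Finset.univ.filter fun K => Maximal (fun X => X ∈ 𝓑 ∧ X ⊆ B) K

/-- Nested sets for a building set of subsets. -/
structure CNested (𝓑 S : Set (Finset ι)) : Prop where
  subset : S ⊆ 𝓑
  comparable : ∀ B ∈ S, ∀ C ∈ S, B ⊆ C ∨ C ⊆ B ∨ Disjoint B C
  sup_notMem : ∀ T : Finset (Finset ι), (T : Set (Finset ι)) ⊆ S →
    (T : Set (Finset ι)).Nontrivial → (T : Set (Finset ι)).PairwiseDisjoint id → T.sup id ∉ 𝓑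

theorem CNested.mono {𝓑 S S' : Set (Finset ι)} (h : CNested 𝓑 S) (hS : S' ⊆ S) :
    CNested 𝓑 S' where
  subset := hS.trans h.subset
  comparable B hB C hC := h.comparable B (hS hB) C (hS hC)
  sup_notMem T hT := h.sup_notMem T (hT.trans hS)

theorem mem_comps {𝓑 : Set (Finset ι)} {B K : Finset ι} :
    K ∈ comps 𝓑 B ↔ Maximal (fun X => X ∈ 𝓑 ∧ X ⊆ B) K := by
  simp [comps]

theorem exists_mem_comps_superset {𝓑 : Set (Finset ι)} {B K : Finset ι} (hK : K ∈ 𝓑)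
    (hKB : K ⊆ B) : ∃ C ∈ comps 𝓑 B, K ⊆ C := by
  obtain ⟨C, h1, h2⟩ := Finite.exists_le_maximal (p := fun X => X ∈ 𝓑 ∧ X ⊆ B) ⟨hK, hKB⟩
  exact ⟨C, mem_comps.2 h2, h1⟩

theorem mem_of_mem_comps {𝓑 : Set (Finset ι)} {B K : Finset ι} (h : K ∈ comps 𝓑 B) : K ∈ 𝓑 :=
  (mem_comps.1 h).prop.1

theorem subset_of_mem_comps {𝓑 : Set (Finset ι)} {B K : Finset ι} (h : K ∈ comps 𝓑 B) : K ⊆ B :=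
  (mem_comps.1 h).prop.2

namespace IsBuilding

variable {𝓑 : Set (Finset ι)} (h𝓑 : IsBuilding 𝓑)

include h𝓑

/-- The union of two meeting members is a member still contained in `B`, so maximality of `K`
absorbs it. -/
theorem subset_of_not_disjoint {B K X : Finset ι} (hK : K ∈ comps 𝓑 B) (hX : X ∈ 𝓑)
    (hXB : X ⊆ B) (h : ¬ Disjoint K X) : X ⊆ K := by
  have hK' := mem_comps.1 hK
  have := hK'.le_of_ge ⟨h𝓑.union K hK'.prop.1 X hX h, Finset.union_subset hK'.prop.2 hXB⟩
    Finset.subset_union_left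
  exact Finset.subset_union_right.trans this

theorem eq_of_not_disjoint {B K K' : Finset ι} (hK : K ∈ comps 𝓑 B) (hK' : K' ∈ comps 𝓑 B)
    (h : ¬ Disjoint K K') : K = K' :=
  (h𝓑.subset_of_not_disjoint hK' (mem_of_mem_comps hK) (subset_of_mem_comps hK)
    fun h' => h h'.symm).antisymm
    (h𝓑.subset_of_not_disjoint hK (mem_of_mem_comps hK') (subset_of_mem_comps hK') h)

theorem pairwiseDisjoint_comps (B : Finset ι) :
    (comps 𝓑 B : Set (Finset ι)).PairwiseDisjoint id := fun K hK K' hK' hne => by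
  by_contra h
  exact hne (h𝓑.eq_of_not_disjoint hK hK' h)

theorem exists_mem_comps {B : Finset ι} {i : ι} (hi : i ∈ B) : ∃ K ∈ comps 𝓑 B, i ∈ K := by
  obtain ⟨C, h1, h2⟩ := exists_mem_comps_superset (h𝓑.singleton i) (Finset.singleton_subset_iff.2 hi)
  exact ⟨C, h1, h2 (Finset.mem_singleton_self i)⟩

theorem sup_comps (B : Finset ι) : (comps 𝓑 B).sup id = B := by
  ext i
  simp only [Finset.mem_sup, id]
  exact ⟨fun ⟨K, hK, hi⟩ => subset_of_mem_comps hK hi, fun hi => h𝓑.exists_mem_comps hi⟩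

theorem comps_eq {T : Finset (Finset ι)} (hT : ∀ K ∈ T, K ∈ 𝓑)
    (hd : (T : Set (Finset ι)).PairwiseDisjoint id)
    (h : ∀ K ∈ 𝓑, K ⊆ T.sup id → ∃ C ∈ T, K ⊆ C) : comps 𝓑 (T.sup id) = T := by
  have hsub : ∀ C ∈ T, C ⊆ T.sup id := fun C hC => Finset.le_sup (f := id) hC
  ext K
  constructor
  · intro hK
    obtain ⟨C, hC, hKC⟩ := h K (mem_of_mem_comps hK) (subset_of_mem_comps hK)
    have := (mem_comps.1 hK).eq_of_le ⟨hT C hC, hsub C hC⟩ hKC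
    exact this ▸ hC
  · intro hK
    obtain ⟨C, hC, hKC⟩ := exists_mem_comps_superset (hT K hK) (hsub K hK)
    obtain ⟨C', hC', hCC'⟩ := h C (mem_of_mem_comps hC) (subset_of_mem_comps hC)
    have h1 : K = C' := hd.elim hK hC' fun hdis => (h𝓑.nonempty K (hT K hK)).ne_empty
      (Finset.disjoint_self_iff_empty _ |>.1 (hdis.mono_right (hKC.trans hCC')))
    have h2 : C = K := (hCC'.trans h1.ge).antisymm hKC
    exact h2 ▸ hC

/-- Components can be dropped without disturbing the remaining ones. This produces the competitors
in the arguments on minimal excess. -/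
theorem comps_sup {B : Finset ι} {T : Finset (Finset ι)} (hT : T ⊆ comps 𝓑 B) :
    comps 𝓑 (T.sup id) = T := by
  have hsub : T.sup id ⊆ B := by
    refine Finset.sup_le ?_
    exact fun K hK => subset_of_mem_comps (hT hK)
  refine h𝓑.comps_eq (fun K hK => mem_of_mem_comps (hT hK))
    ((h𝓑.pairwiseDisjoint_comps B).subset (by exact_mod_cast hT)) fun K hK hKT => ?_
  obtain ⟨i, hi⟩ := h𝓑.nonempty K hK
  obtain ⟨C, hC, hiC⟩ := Finset.mem_sup.1 (hKT hi)
  exact ⟨C, hC, h𝓑.subset_of_not_disjoint (hT hC) hK (hKT.trans hsub)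
    (Finset.not_disjoint_iff.2 ⟨i, hiC, hi⟩)⟩

theorem comps_of_mem {B : Finset ι} (hB : B ∈ 𝓑) : comps 𝓑 B = {B} := by
  have := h𝓑.comps_eq (T := {B}) (by simpa using hB) (by simp) fun K _ hK => ⟨B, by simpa using hK⟩
  simpa using this

theorem comps_empty : comps 𝓑 ∅ = ∅ := by
  have := h𝓑.comps_eq (T := ∅) (by simp) (by simp) fun K hK hK' => by
    exact absurd (Finset.subset_empty.1 (by simpa using hK')) (h𝓑.nonempty K hK).ne_empty
  simpa using this

/-- Adding an element of the building set to `B` merges some components of `B` with it. -/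
theorem exists_sum_comps_union {X : Finset ι} (hX : X ∈ 𝓑) (B : Finset ι) (w : Finset ι → ℝ) :
    ∃ K ∈ 𝓑, ∃ L ⊆ comps 𝓑 B, K = X ∪ L.sup id ∧
      ∑ C ∈ comps 𝓑 (X ∪ B), w C = w K + ∑ C ∈ comps 𝓑 B, w C - ∑ C ∈ L, w C := by
  obtain ⟨K, hK, hXK⟩ := exists_mem_comps_superset hX (Finset.subset_union_left (s₂ := B))
  have hsubB : ∀ C ∈ comps 𝓑 B, C ⊆ X ∪ B := fun C hC =>
    (subset_of_mem_comps hC).trans Finset.subset_union_right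
  have hK𝓑 := mem_of_mem_comps hK
  refine ⟨K, hK𝓑, (comps 𝓑 B).filter (· ⊆ K), Finset.filter_subset _ _, ?_, ?_⟩
  · apply Finset.Subset.antisymm
    · intro i hi
      by_cases hiX : i ∈ X
      · exact Finset.mem_union_left _ hiX
      have hiB : i ∈ B := (Finset.mem_union.1 (subset_of_mem_comps hK hi)).resolve_left hiX
      obtain ⟨C, hC, hiC⟩ := h𝓑.exists_mem_comps hiB
      refine Finset.mem_union_right _ (Finset.mem_sup.2 ⟨C, Finset.mem_filter.2 ⟨hC, ?_⟩, hiC⟩)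
      exact h𝓑.subset_of_not_disjoint hK (mem_of_mem_comps hC) (hsubB C hC)
        (Finset.not_disjoint_iff.2 ⟨i, hi, hiC⟩)
    · refine Finset.union_subset hXK ?_
      refine Finset.sup_le ?_
      exact fun C hC => (Finset.mem_filter.1 hC).2
  -- Only the component containing `X` is new; the components of `B` outside it survive unchanged.
  · have hcomps : comps 𝓑 (X ∪ B) = insert K ((comps 𝓑 B).filter (¬ · ⊆ K)) := by
      ext C
      simp only [Finset.mem_insert, Finset.mem_filter]
      constructor
      · intro hC
        by_cases hCK : Disjoint K C
        · right
          have hCB : C ⊆ B := fun i hi => (Finset.mem_union.1 (subset_of_mem_comps hC hi)).resolve_left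
            fun hiX => Finset.disjoint_left.1 hCK (hXK hiX) hi
          refine ⟨mem_comps.2 ⟨⟨mem_of_mem_comps hC, hCB⟩, fun D hD hCD => ?_⟩, fun h => ?_⟩
          · exact (mem_comps.1 hC).le_of_ge ⟨hD.1, hD.2.trans Finset.subset_union_right⟩ hCD
          · exact (h𝓑.nonempty C (mem_of_mem_comps hC)).ne_empty
              (Finset.disjoint_self_iff_empty _ |>.1 (hCK.mono_left h))
        · exact Or.inl (h𝓑.eq_of_not_disjoint hK hC hCK).symm
      · rintro (rfl | ⟨hC, hCK⟩)
        · exact hK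
        · refine mem_comps.2 ⟨⟨mem_of_mem_comps hC, hsubB C hC⟩, fun D hD hCD => ?_⟩
          have hDB : D ⊆ B := fun i hi => (Finset.mem_union.1 (hD.2 hi)).resolve_left fun hiX =>
            hCK (hCD.trans (h𝓑.subset_of_not_disjoint hK hD.1 hD.2
              (Finset.not_disjoint_iff.2 ⟨i, hXK hiX, hi⟩)))
          exact (mem_comps.1 hC).le_of_ge ⟨hD.1, hDB⟩ hCD
    rw [hcomps, Finset.sum_insert (by simp),
      ← Finset.sum_filter_add_sum_filter_not (comps 𝓑 B) (· ⊆ K) w]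
    ring

end IsBuilding

theorem two_pow_add_le {a b : ℕ} (ha : 1 ≤ a) (hb : 1 ≤ b) : 2 ^ a + 2 ^ b ≤ 2 ^ (a + b) := by
  obtain ⟨a, rfl⟩ := Nat.exists_eq_add_of_le ha
  obtain ⟨b, rfl⟩ := Nat.exists_eq_add_of_le hb
  have h1 := Nat.one_le_two_pow (n := a)
  have h2 := Nat.one_le_two_pow (n := b)
  simp only [pow_add, pow_one]
  nlinarith

/-- The sum of the powers of two of the sizes of the members of a disjoint family. -/
theorem sum_two_pow_card_le {T : Finset (Finset ι)} (hT : T.Nonempty)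
    (hne : ∀ K ∈ T, K.Nonempty) (hd : (T : Set (Finset ι)).PairwiseDisjoint id) :
    ∑ K ∈ T, 2 ^ K.card ≤ 2 ^ (T.sup id).card := by
  induction hT using Finset.Nonempty.cons_induction with
  | singleton K => simp
  | cons K T hK hT ih =>
    rw [Finset.sum_cons, Finset.sup_cons, id, Finset.sup_eq_union, Finset.card_union_of_disjoint]
    · refine (Nat.add_le_add_left (ih (fun L hL => hne L (Finset.mem_cons_of_mem hL))
        (hd.subset (by simp))) _).trans (two_pow_add_le ?_ ?_)
      · exact (hne K (Finset.mem_cons_self _ _)).card_pos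
      · obtain ⟨L, hL⟩ := hT
        exact ((hne L (Finset.mem_cons_of_mem hL)).mono (Finset.le_sup (f := id) hL)).card_pos
    · rw [Finset.disjoint_sup_right]
      intro L hL
      exact hd (by simp) (by simp [hL]) (fun h => hK (h ▸ hL))

/-- The set `X` may overlap the members of `T`, so superadditivity alone is not enough. If `T` has
one member, both terms are at most half of `2 ^ |K|`. If it has two, `K` has at least two points
outside `X`, so `2 ^ |X|` is at most a quarter, while the disjoint family takes about half. -/
theorem two_pow_add_sum_two_pow_card_le {K X : Finset ι} {T : Finset (Finset ι)}
    (hXne : X.Nonempty) (hX : X ⊂ K) (hTne : T.Nonempty) (hTK : ∀ L ∈ T, L ⊂ K)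
    (hTX : ∀ L ∈ T, ¬ L ⊆ X) (hd : (T : Set (Finset ι)).PairwiseDisjoint id) :
    2 ^ X.card + ∑ L ∈ T, 2 ^ L.card ≤ 2 ^ K.card := by
  have hne : ∀ L ∈ T, L.Nonempty := fun L hL => by
    by_contra h
    rw [Finset.not_nonempty_iff_eq_empty] at h
    exact hTX L hL (h ▸ Finset.empty_subset _)
  have h1 : X.card + 1 ≤ K.card := Finset.card_lt_card hX
  obtain ⟨L, hL⟩ := hTne
  have h2 : L.card + 1 ≤ K.card := Finset.card_lt_card (hTK L hL)
  have hXc := hXne.card_pos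
  have hLc := (hne L hL).card_pos
  rw [← Finset.add_sum_erase _ _ hL]
  rcases (T.erase L).eq_empty_or_nonempty with he | ⟨M, hM⟩
  · rw [he, Finset.sum_empty, add_zero]
    calc 2 ^ X.card + 2 ^ L.card ≤ 2 ^ (K.card - 1) + 2 ^ (K.card - 1) :=
          add_le_add (Nat.pow_le_pow_right (by norm_num) (by omega))
            (Nat.pow_le_pow_right (by norm_num) (by omega))
      _ = 2 ^ K.card := by
          rw [← mul_two, ← pow_succ]
          congr 1
          omega
  · have hM' := Finset.mem_erase.1 hM
    set U := (T.erase L).sup id with hU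
    have h3 := sum_two_pow_card_le ⟨M, hM⟩ (fun N hN => hne N (Finset.mem_of_mem_erase hN))
      (hd.subset (by simp))
    have hLU : Disjoint L U := by
      rw [hU, Finset.disjoint_sup_right]
      intro N hN
      exact hd hL (Finset.mem_of_mem_erase hN) (Finset.ne_of_mem_erase hN).symm
    have hUK : U ⊆ K := by
      refine Finset.sup_le ?_
      exact fun N hN => (hTK N (Finset.mem_of_mem_erase hN)).subset
    have hUc : 1 ≤ U.card := ((hne M hM'.2).mono (Finset.le_sup (f := id) hM)).card_pos
    have h4 : L.card + U.card ≤ K.card := by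
      rw [← Finset.card_union_of_disjoint hLU]
      exact Finset.card_le_card (Finset.union_subset (hTK L hL).subset hUK)
    have h5 : X.card + 2 ≤ K.card := by
      obtain ⟨i, hi, hiX⟩ := Finset.not_subset.1 (hTX L hL)
      obtain ⟨j, hj, hjX⟩ := Finset.not_subset.1 (hTX M hM'.2)
      have hij : i ≠ j := fun h => Finset.disjoint_left.1 (hd hM'.2 hL hM'.1) hj (h ▸ hi)
      have : insert i (insert j X) ⊆ K := by
        simp [Finset.insert_subset_iff, (hTK L hL).subset hi, (hTK M hM'.2).subset hj, hX.subset]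
      have := Finset.card_le_card this
      rwa [Finset.card_insert_of_notMem (by simp [hij, hiX]), Finset.card_insert_of_notMem hjX]
        at this
    obtain ⟨l, hl⟩ := Nat.exists_eq_add_of_le hLc
    obtain ⟨u, hu⟩ := Nat.exists_eq_add_of_le hUc
    obtain ⟨x, hx⟩ := Nat.exists_eq_add_of_le hXc
    -- This comes from `(2 ^ |L| - 2) * (2 ^ |U| - 2) ≥ 0`; the surplus `4` is paid back by `e2`.
    have e1 : 2 * (2 ^ L.card + 2 ^ U.card) ≤ 2 ^ K.card + 4 := by
      have : 2 ^ (L.card + U.card) ≤ 2 ^ K.card := Nat.pow_le_pow_right (by norm_num) h4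
      rw [hl, hu] at this ⊢
      have h6 := Nat.one_le_two_pow (n := l)
      have h7 := Nat.one_le_two_pow (n := u)
      simp only [pow_add, pow_one] at this ⊢
      nlinarith
    have e2 : 2 * (2 ^ X.card + 2) ≤ 2 ^ K.card := by
      have : 2 ^ (X.card + 2) ≤ 2 ^ K.card := Nat.pow_le_pow_right (by norm_num) h5
      rw [hx] at this ⊢
      have h6 := Nat.one_le_two_pow (n := x)
      simp only [pow_add, pow_one] at this ⊢
      nlinarith
    rw [← hU] at h3
    omega

end Combinatorics

end Permutonestohedron

namespace Permutonestohedron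

set_option linter.unusedSectionVars false

/-! ### Weights on a building set, and the tight sets of points -/

section Weights

variable {ι : Type*} [Fintype ι] [DecidableEq ι]

theorem sum_sup_id {T : Finset (Finset ι)} (hd : (T : Set (Finset ι)).PairwiseDisjoint id)
    (f : ι → ℝ) : ∑ i ∈ T.sup id, f i = ∑ C ∈ T, ∑ i ∈ C, f i := by
  rw [Finset.sup_eq_biUnion, Finset.sum_biUnion hd]
  rfl

/-- Coefficients `c B i` and right-hand sides `e B` that grow fast enough. -/
structure IsWeight (𝓑 : Set (Finset ι)) (c : Finset ι → ι → ℝ) (e : Finset ι → ℝ) : Prop where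
  pos : ∀ B ∈ 𝓑, ∀ i ∈ B, 0 < c B i
  e_pos : ∀ B ∈ 𝓑, 0 < e B
  growth : ∀ A ∈ 𝓑, ∀ B ∈ 𝓑, B ⊂ A → ∀ i ∈ B,
    2 ^ A.card * (c A i * e B) < 2 ^ B.card * (c B i * e A)
  e_growth : ∀ A ∈ 𝓑, ∀ B ∈ 𝓑, B ⊂ A → 2 ^ A.card * e B < 2 ^ B.card * e A

/-- The value of the linear form with coefficients `c B i`, `i ∈ B`. -/
def wsum (c : Finset ι → ι → ℝ) (t : ι → ℝ) (B : Finset ι) : ℝ := ∑ i ∈ B, c B i * t i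

/-- The sum over the components of `B` of the differences of the two sides of the
inequalities. -/
noncomputable def excess (𝓑 : Set (Finset ι)) (c : Finset ι → ι → ℝ) (e : Finset ι → ℝ)
    (t : ι → ℝ) (B : Finset ι) : ℝ := ∑ K ∈ comps 𝓑 B, (wsum c t K - e K)

/-- The points of the nestohedron defined by the weights. -/
structure IsNestPoint (𝓑 : Set (Finset ι)) (c : Finset ι → ι → ℝ) (e : Finset ι → ℝ)
    (t : ι → ℝ) : Prop where
  eq : wsum c t Finset.univ = e Finset.univ
  le : ∀ B ∈ 𝓑, e B ≤ wsum c t B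

/-- The elements of the building set whose inequality is tight. -/
def tightSet (𝓑 : Set (Finset ι)) (c : Finset ι → ι → ℝ) (e : Finset ι → ℝ)
    (t : ι → ℝ) : Set (Finset ι) := {B ∈ 𝓑 | wsum c t B = e B}

namespace IsWeight

variable {𝓑 : Set (Finset ι)} {c : Finset ι → ι → ℝ} {e : Finset ι → ℝ} (hw : IsWeight 𝓑 c e)

include hw

theorem sum_le {A B : Finset ι} (hA : A ∈ 𝓑) (hB : B ∈ 𝓑) (hBA : B ⊂ A) {t : ι → ℝ}
    (ht : ∀ i ∈ B, 0 ≤ t i) :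
    2 ^ A.card * (∑ i ∈ B, c A i * t i) * e B ≤ 2 ^ B.card * e A * wsum c t B := by
  rw [wsum, Finset.mul_sum, Finset.mul_sum, Finset.sum_mul]
  refine Finset.sum_le_sum fun i hi => ?_
  have := mul_le_mul_of_nonneg_right (hw.growth A hA B hB hBA i hi).le (ht i hi)
  linarith

/-- The basic estimate: a tight `B` carries less than the fraction `2 ^ |B| / 2 ^ |A|` of `e A` in
the form of `A`. It is the growth condition summed against `t`, strict because the value `e B` is
positive and so some `t i` does not vanish. -/
theorem sum_lt {A B : Finset ι} (hA : A ∈ 𝓑) (hB : B ∈ 𝓑) (hBA : B ⊂ A) {t : ι → ℝ}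
    (ht : ∀ i ∈ B, 0 ≤ t i) (hval : wsum c t B = e B) :
    2 ^ A.card * (∑ i ∈ B, c A i * t i) < 2 ^ B.card * e A := by
  have he := hw.e_pos B hB
  have h1 : 2 ^ A.card * (∑ i ∈ B, c A i * t i) * e B < 2 ^ B.card * e A * e B := by
    conv_rhs => rw [← hval]
    rw [wsum, Finset.mul_sum, Finset.mul_sum, Finset.sum_mul]
    obtain ⟨i, hi, hti⟩ : ∃ i ∈ B, t i ≠ 0 := by
      by_contra! h
      rw [← hval, wsum, Finset.sum_eq_zero fun i hi => by rw [h i hi, mul_zero]] at he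
      exact lt_irrefl _ he
    refine Finset.sum_lt_sum (fun i hi => ?_) ⟨i, hi, ?_⟩
    · have := mul_le_mul_of_nonneg_right (hw.growth A hA B hB hBA i hi).le (ht i hi)
      linarith
    · have := mul_lt_mul_of_pos_right (hw.growth A hA B hB hBA i hi)
        (lt_of_le_of_ne (ht i hi) hti.symm)
      linarith
  exact lt_of_mul_lt_mul_right h1 he.le

/-- The same estimate when `B` falls short of `e B`, with the shortfall added to the left side;
`e_growth` pays for it. Components of sets of minimal excess are in this situation. -/
theorem sum_sub_lt {A B : Finset ι} (hA : A ∈ 𝓑) (hB : B ∈ 𝓑) (hBA : B ⊂ A) {t : ι → ℝ}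
    (ht : ∀ i ∈ B, 0 ≤ t i) (hval : wsum c t B ≤ e B) :
    2 ^ A.card * (∑ i ∈ B, c A i * t i - (wsum c t B - e B)) < 2 ^ B.card * e A := by
  rcases hval.eq_or_lt with hval | hval
  · rw [hval, sub_self, sub_zero]
    exact hw.sum_lt hA hB hBA ht hval
  · have he := hw.e_pos B hB
    have h1 := hw.sum_le hA hB hBA ht
    have h2 := mul_lt_mul_of_pos_right (hw.e_growth A hA B hB hBA) (sub_pos.2 hval)
    refine lt_of_mul_lt_mul_right (a := e B) ?_ he.le
    nlinarith

theorem pos_of_isNestPoint (h𝓑 : IsBuilding 𝓑) {t : ι → ℝ} (ht : IsNestPoint 𝓑 c e t) (i : ι) :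
    0 < t i := by
  have h1 := (hw.e_pos _ (h𝓑.singleton i)).trans_le (ht.le _ (h𝓑.singleton i))
  rw [wsum, Finset.sum_singleton] at h1
  exact (pos_iff_pos_of_mul_pos h1).1 (hw.pos _ (h𝓑.singleton i) i (Finset.mem_singleton_self i))

/-- The tight set of a point of the nestohedron is nested. -/
theorem cnested_tightSet (h𝓑 : IsBuilding 𝓑) {t : ι → ℝ} (ht : IsNestPoint 𝓑 c e t) :
    CNested 𝓑 (tightSet 𝓑 c e t) where
  subset _ h := h.1
  comparable B hB C hC := by
    by_contra! h
    obtain ⟨hBC, hCB, hd⟩ := h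
    have hA := h𝓑.union B hB.1 C hC.1 hd
    have ht0 := fun i => (hw.pos_of_isNestPoint h𝓑 ht i).le
    have hB' : B ⊂ B ∪ C := Finset.ssubset_iff_subset_ne.2 ⟨Finset.subset_union_left, fun h =>
      hCB (h ▸ Finset.subset_union_right)⟩
    have hC' : C ⊂ B ∪ C := Finset.ssubset_iff_subset_ne.2 ⟨Finset.subset_union_right, fun h =>
      hBC (h ▸ Finset.subset_union_left)⟩
    -- Two tight sets that overlap without being nested would leave the form of their union below `e
    -- (B ∪ C)`, since `2 ^ |B| + 2 ^ |C| ≤ 2 ^ |B ∪ C|`.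
    have h1 := hw.sum_lt hA hB.1 hB' (fun i _ => ht0 i) hB.2
    have h2 := hw.sum_lt hA hC.1 hC' (fun i _ => ht0 i) hC.2
    have h3 : wsum c t (B ∪ C) ≤ ∑ i ∈ B, c (B ∪ C) i * t i + ∑ i ∈ C, c (B ∪ C) i * t i := by
      rw [wsum, ← Finset.sum_union_inter]
      refine le_add_of_nonneg_right (Finset.sum_nonneg fun i hi => mul_nonneg ?_ (ht0 i))
      exact (hw.pos _ hA i (Finset.mem_union_left _ (Finset.mem_inter.1 hi).1)).le
    have h4 := ht.le _ hA
    have h5 : (2 : ℝ) ^ B.card + 2 ^ C.card ≤ 2 ^ (B ∪ C).card := by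
      have := two_pow_add_sum_two_pow_card_le (h𝓑.nonempty B hB.1) hB' (T := {C})
        (by simp) (by simpa using hC') (by simpa using hCB) (by simp)
      rw [Finset.sum_singleton] at this
      exact_mod_cast this
    have h6 := mul_le_mul_of_nonneg_right h5 (hw.e_pos _ hA).le
    have h7 := mul_le_mul_of_nonneg_left (h4.trans h3) (pow_nonneg zero_le_two (B ∪ C).card : (0:ℝ) ≤ _)
    linarith
  sup_notMem T hT hnt hd hA := by
    have hne : ∀ K ∈ T, K.Nonempty := fun K hK => h𝓑.nonempty K (hT hK).1
    have ht0 := fun i => (hw.pos_of_isNestPoint h𝓑 ht i).le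
    have hlt : ∀ K ∈ T, K ⊂ T.sup id := fun K hK => by
      refine Finset.ssubset_iff_subset_ne.2 ⟨Finset.le_sup (f := id) hK, fun h => ?_⟩
      obtain ⟨L, hL, hLK⟩ := hnt.exists_ne K
      have h1 := Finset.disjoint_left.1 (hd hL hK hLK)
      obtain ⟨i, hi⟩ := hne L hL
      have h2 : L ⊆ T.sup id := Finset.le_sup (f := id) hL
      exact h1 hi (h ▸ h2 hi)
    -- Likewise for a disjoint family: the estimates add up to a value of the form of the union
    -- below its bound.
    have h1 : ∑ K ∈ T, 2 ^ (T.sup id).card * (∑ i ∈ K, c (T.sup id) i * t i) <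
        ∑ K ∈ T, 2 ^ K.card * e (T.sup id) :=
      Finset.sum_lt_sum_of_nonempty (by exact_mod_cast hnt.nonempty) fun K hK =>
        hw.sum_lt hA (hT hK).1 (hlt K hK) (fun i _ => ht0 i) (hT hK).2
    have h2 : wsum c t (T.sup id) = ∑ K ∈ T, ∑ i ∈ K, c (T.sup id) i * t i := by
      rw [wsum, sum_sup_id hd]
    rw [← Finset.mul_sum, ← h2, ← Finset.sum_mul] at h1
    have h3 : (∑ K ∈ T, (2 : ℝ) ^ K.card) ≤ 2 ^ (T.sup id).card := by
      exact_mod_cast sum_two_pow_card_le (by exact_mod_cast hnt.nonempty) hne hd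
    have h4 := mul_le_mul_of_nonneg_right h3 (hw.e_pos _ hA).le
    have h5 := mul_le_mul_of_nonneg_left (ht.le _ hA)
      (pow_nonneg zero_le_two (T.sup id).card : (0:ℝ) ≤ _)
    linarith

/-! #### Sets of minimal excess -/

section Excess

variable (h𝓑 : IsBuilding 𝓑) {t : ι → ℝ}

include h𝓑

/-- Omitting `K` removes exactly its own term from the excess, so that term cannot be positive. -/
theorem wsum_le_of_excess_minimal {B : Finset ι}
    (hB : ∀ C, excess 𝓑 c e t B ≤ excess 𝓑 c e t C) {K : Finset ι} (hK : K ∈ comps 𝓑 B) :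
    wsum c t K ≤ e K := by
  have h1 := hB (((comps 𝓑 B).erase K).sup id)
  rw [excess, excess, h𝓑.comps_sup (Finset.erase_subset _ _),
    ← Finset.add_sum_erase _ _ hK] at h1
  linarith

/-- If `t i` vanished, adding `i` to `B` would merge the components in `L` into `K` without any
contribution of `i` to the form of `K`. By `sum_sub_lt` the term of `K` is then smaller than the sum
of those it replaces, and the excess would drop. -/
theorem pos_of_excess_minimal (ht : ∀ i, 0 ≤ t i) {B : Finset ι}
    (hB : ∀ C, excess 𝓑 c e t B ≤ excess 𝓑 c e t C) {i : ι} (hi : i ∉ B) : 0 < t i := by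
  by_contra hti
  have hti : t i = 0 := le_antisymm (not_lt.1 hti) (ht i)
  obtain ⟨K, hK, L, hL, hKL, hsum⟩ := h𝓑.exists_sum_comps_union (h𝓑.singleton i) B
    (fun K => wsum c t K - e K)
  have h1 := hB ({i} ∪ B)
  simp only [excess, hsum] at h1
  have hLd : (L : Set (Finset ι)).PairwiseDisjoint id :=
    (h𝓑.pairwiseDisjoint_comps B).subset (by exact_mod_cast hL)
  have hLB : L.sup id ⊆ B := Finset.sup_le fun C hC => subset_of_mem_comps (hL hC)
  have hval : wsum c t K = ∑ C ∈ L, ∑ j ∈ C, c K j * t j := by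
    rw [wsum, ← sum_sup_id hLd]
    conv_lhs => enter [1]; rw [hKL]
    rw [Finset.sum_union (Finset.disjoint_singleton_left.2 fun h => hi (hLB h)),
      Finset.sum_singleton, hti, mul_zero, zero_add]
  have heK := hw.e_pos K hK
  rcases L.eq_empty_or_nonempty with rfl | hLne
  · simp only [hval, Finset.sum_empty] at h1
    linarith
  · have hLK : ∀ C ∈ L, C ⊂ K := fun C hC => by
      refine Finset.ssubset_iff_subset_ne.2 ⟨?_, fun h => ?_⟩
      · rw [hKL]
        exact (Finset.le_sup (f := id) hC).trans Finset.subset_union_right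
      · refine hi (subset_of_mem_comps (hL hC) ?_)
        rw [h, hKL]
        exact Finset.mem_union_left _ (Finset.mem_singleton_self i)
    have h2 : ∑ C ∈ L, 2 ^ K.card * (∑ j ∈ C, c K j * t j - (wsum c t C - e C)) <
        ∑ C ∈ L, 2 ^ C.card * e K := Finset.sum_lt_sum_of_nonempty hLne fun C hC =>
      hw.sum_sub_lt hK (mem_of_mem_comps (hL hC)) (hLK C hC) (fun j _ => ht j)
        (hw.wsum_le_of_excess_minimal h𝓑 hB (hL hC))
    rw [← Finset.mul_sum, Finset.sum_sub_distrib, ← hval, ← Finset.sum_mul] at h2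
    have h3 : (∑ C ∈ L, (2 : ℝ) ^ C.card) ≤ 2 ^ K.card := by
      have := sum_two_pow_card_le hLne
        (fun C hC => h𝓑.nonempty C (mem_of_mem_comps (hL hC))) hLd
      have h4 : (L.sup id).card ≤ K.card := Finset.card_le_card
        (hKL ▸ Finset.subset_union_right)
      exact_mod_cast this.trans (Nat.pow_le_pow_right (by norm_num) h4)
    have h4 := h2.trans_le (mul_le_mul_of_nonneg_right h3 heK.le)
    have h5 := lt_of_mul_lt_mul_left h4 (by positivity)
    linarith

/-- A set of minimal excess and smallest cardinality lies in all the sets of minimal excess. -/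
theorem subset_of_excess_minimal (ht : ∀ i, 0 ≤ t i) {B : Finset ι}
    (hB : ∀ C, excess 𝓑 c e t B ≤ excess 𝓑 c e t C)
    (hcard : ∀ C, excess 𝓑 c e t C ≤ excess 𝓑 c e t B → B.card ≤ C.card) {B' : Finset ι}
    (hB' : ∀ C, excess 𝓑 c e t B' ≤ excess 𝓑 c e t C) : B ⊆ B' := by
  set w : Finset ι → ℝ := fun K => wsum c t K - e K with hwdef
  rw [← h𝓑.sup_comps B]
  refine Finset.sup_le fun X hX => ?_
  by_contra hXB' : ¬ X ⊆ B'
  have hX𝓑 := mem_of_mem_comps hX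
  obtain ⟨K, hK, L, hL, hKL, hsum⟩ := h𝓑.exists_sum_comps_union hX𝓑 B' w
  -- Two minimalities are played against each other. Comparing `B'` with `X ∪ B'` gives this bound;
  -- comparing `B` with the set where `X` is replaced by the part `L₁` of `L` inside `X` gives `w X
  -- ≤ ∑ L₁`. Together `w X + ∑ L₂ ≤ w K` for the remaining part `L₂`.
  have h1 : ∑ C ∈ L, w C ≤ w K := by
    have := hB' (X ∪ B')
    simp only [excess, ← hwdef] at this
    change ∑ C ∈ comps 𝓑 B', w C ≤ ∑ C ∈ comps 𝓑 (X ∪ B'), w C at this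
    rw [hsum] at this
    linarith
  have hLd : (L : Set (Finset ι)).PairwiseDisjoint id :=
    (h𝓑.pairwiseDisjoint_comps B').subset (by exact_mod_cast hL)
  have hwX : w X ≤ 0 := sub_nonpos.2 (hw.wsum_le_of_excess_minimal h𝓑 hB hX)
  -- replace the component `X` of `B` by the components of `B'` inside it
  set L₁ := L.filter (· ⊆ X) with hL₁
  set T := (comps 𝓑 B).erase X ∪ L₁ with hT
  have hL₁X : ∀ C ∈ L₁, C ⊆ X := fun C hC => (Finset.mem_filter.1 hC).2
  have hL₁L : ∀ C ∈ L₁, C ∈ L := fun C hC => (Finset.mem_filter.1 hC).1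
  have hXd : ∀ C ∈ (comps 𝓑 B).erase X, Disjoint X C := fun C hC =>
    h𝓑.pairwiseDisjoint_comps B hX (Finset.mem_of_mem_erase hC) (Finset.ne_of_mem_erase hC).symm
  have hTB : T.sup id ⊆ B := Finset.sup_le fun C hC => by
    rcases Finset.mem_union.1 hC with hC | hC
    · exact subset_of_mem_comps (Finset.mem_of_mem_erase hC)
    · exact (hL₁X C hC).trans (subset_of_mem_comps hX)
  have hTX : ∀ i ∈ T.sup id, i ∈ X → ∃ C ∈ L₁, i ∈ C := fun i hi hiX => by
    obtain ⟨C, hC, hiC⟩ := Finset.mem_sup.1 hi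
    rcases Finset.mem_union.1 hC with hC | hC
    · exact absurd hiC (Finset.disjoint_left.1 (hXd C hC) hiX)
    · exact ⟨C, hC, hiC⟩
  have hcompsT : comps 𝓑 (T.sup id) = T := by
    refine h𝓑.comps_eq (fun C hC => ?_) ?_ fun Y hY hYT => ?_
    · rcases Finset.mem_union.1 hC with hC | hC
      · exact mem_of_mem_comps (Finset.mem_of_mem_erase hC)
      · exact mem_of_mem_comps (hL (hL₁L C hC))
    · rw [hT, Finset.coe_union, Set.pairwiseDisjoint_union]
      refine ⟨(h𝓑.pairwiseDisjoint_comps B).subset (by simp), hLd.subset fun C hC => hL₁L C hC,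
        fun C hC D hD _ => ?_⟩
      exact ((hXd C hC).mono_left (hL₁X D hD)).symm
    · obtain ⟨C, hC, hYC⟩ := exists_mem_comps_superset hY (hYT.trans hTB)
      by_cases hCX : C = X
      · subst hCX
        obtain ⟨i, hi⟩ := h𝓑.nonempty Y hY
        obtain ⟨D, hD, hiD⟩ := hTX i (hYT hi) (hYC hi)
        refine ⟨D, Finset.mem_union_right _ hD,
          h𝓑.subset_of_not_disjoint (hL (hL₁L D hD)) hY (fun j hj => ?_)
            (Finset.not_disjoint_iff.2 ⟨i, hiD, hi⟩)⟩
        obtain ⟨D', hD', hjD'⟩ := hTX j (hYT hj) (hYC hj)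
        exact subset_of_mem_comps (hL (hL₁L D' hD')) hjD'
      · exact ⟨C, Finset.mem_union_left _ (Finset.mem_erase.2 ⟨hCX, hC⟩), hYC⟩
  have hdisj : Disjoint ((comps 𝓑 B).erase X) L₁ := by
    rw [Finset.disjoint_left]
    intro C hC hC'
    exact (h𝓑.nonempty C (mem_of_mem_comps (Finset.mem_of_mem_erase hC))).ne_empty
      (Finset.disjoint_self_iff_empty _ |>.1 ((hXd C hC).mono_left (hL₁X C hC')))
  have hexcT : excess 𝓑 c e t (T.sup id) = excess 𝓑 c e t B - w X + ∑ C ∈ L₁, w C := by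
    simp only [excess, hcompsT]
    change ∑ C ∈ T, w C = ∑ C ∈ comps 𝓑 B, w C - w X + _
    rw [hT, Finset.sum_union hdisj, ← Finset.add_sum_erase _ w hX]
    ring
  have h2 : w X ≤ ∑ C ∈ L₁, w C := by
    have := hB (T.sup id)
    rw [hexcT] at this
    linarith
  have hLsum : ∑ C ∈ L, w C = ∑ C ∈ L₁, w C + ∑ C ∈ L.filter (¬ · ⊆ X), w C :=
    (Finset.sum_filter_add_sum_filter_not _ _ _).symm
  set L₂ := L.filter (¬ · ⊆ X) with hL₂
  have hL₂L : ∀ C ∈ L₂, C ∈ L := fun C hC => (Finset.mem_filter.1 hC).1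
  have hL₂X : ∀ C ∈ L₂, ¬ C ⊆ X := fun C hC => (Finset.mem_filter.1 hC).2
  have hXK : X ⊆ K := hKL ▸ Finset.subset_union_left
  have hKeq : K = X ∪ L₂.sup id := by
    rw [hKL]
    refine Finset.Subset.antisymm (Finset.union_subset Finset.subset_union_left
      (Finset.sup_le fun C hC => ?_)) (Finset.union_subset_union_right
        (Finset.sup_mono (Finset.filter_subset _ _)))
    by_cases hCX : C ⊆ X
    · exact hCX.trans Finset.subset_union_left
    · have : C ∈ L₂ := Finset.mem_filter.2 ⟨hC, hCX⟩
      exact (Finset.le_sup (f := id) this).trans Finset.subset_union_right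
  rcases L₂.eq_empty_or_nonempty with he | hL₂ne
  · -- then `X` can be replaced without changing the excess
    have hKX : K = X := by rw [hKeq, he, Finset.sup_empty]; exact Finset.union_empty X
    rw [he, Finset.sum_empty, add_zero] at hLsum
    have h3 : excess 𝓑 c e t (T.sup id) ≤ excess 𝓑 c e t B := by
      rw [hexcT]
      rw [hKX] at h1
      linarith
    obtain ⟨i, hi, hiB'⟩ := Finset.not_subset.1 hXB'
    have h4 : T.sup id ⊂ B := Finset.ssubset_iff_subset_ne.2 ⟨hTB, fun h => by
      obtain ⟨C, hC, hiC⟩ := hTX i (h.symm ▸ subset_of_mem_comps hX hi) hi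
      exact hiB' (subset_of_mem_comps (hL (hL₁L C hC)) hiC)⟩
    exact absurd (Finset.card_lt_card h4) (not_lt.2 (hcard _ h3))
  · have hXKs : X ⊂ K := Finset.ssubset_iff_subset_ne.2 ⟨hXK, fun h => by
      obtain ⟨C, hC⟩ := hL₂ne
      refine hL₂X C hC (h ▸ hKeq ▸ ?_)
      exact (Finset.le_sup (f := id) hC).trans Finset.subset_union_right⟩
    have hL₂K : ∀ C ∈ L₂, C ⊂ K := fun C hC => Finset.ssubset_iff_subset_ne.2 ⟨by
      rw [hKeq]
      exact (Finset.le_sup (f := id) hC).trans Finset.subset_union_right, fun h => by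
      exact hXB' ((h ▸ hXK).trans (subset_of_mem_comps (hL (hL₂L C hC))))⟩
    have hL₂d := hLd.subset fun C hC => hL₂L C hC
    -- The estimates for `X` and the members of `L₂` add up to `w K < w X + ∑ L₂`, the opposite of
    -- what the two minimalities give.
    have h3 := hw.sum_sub_lt hK hX𝓑 hXKs (fun j _ => ht j)
      (hw.wsum_le_of_excess_minimal h𝓑 hB hX)
    have h4 : ∑ C ∈ L₂, 2 ^ K.card * (∑ j ∈ C, c K j * t j - w C) <
        ∑ C ∈ L₂, 2 ^ C.card * e K := Finset.sum_lt_sum_of_nonempty hL₂ne fun C hC =>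
      hw.sum_sub_lt hK (mem_of_mem_comps (hL (hL₂L C hC))) (hL₂K C hC) (fun j _ => ht j)
        (hw.wsum_le_of_excess_minimal h𝓑 hB' (hL (hL₂L C hC)))
    rw [← Finset.mul_sum, Finset.sum_sub_distrib, ← Finset.sum_mul] at h4
    have h5 : (2 : ℝ) ^ X.card + ∑ C ∈ L₂, (2 : ℝ) ^ C.card ≤ 2 ^ K.card := by
      exact_mod_cast two_pow_add_sum_two_pow_card_le (h𝓑.nonempty X hX𝓑) hXKs hL₂ne hL₂K hL₂X hL₂d
    have h6 : wsum c t K ≤ ∑ i ∈ X, c K i * t i + ∑ C ∈ L₂, ∑ i ∈ C, c K i * t i := by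
      rw [wsum, ← sum_sup_id hL₂d]
      conv_lhs => enter [1]; rw [hKeq]
      rw [← Finset.sum_union_inter]
      refine le_add_of_nonneg_right (Finset.sum_nonneg fun i hi => mul_nonneg ?_ (ht i))
      exact (hw.pos K hK i (hXK (Finset.mem_inter.1 hi).1)).le
    have heK := hw.e_pos K hK
    have h7 := mul_le_mul_of_nonneg_right h5 heK.le
    have h8 : 2 ^ K.card * ((∑ i ∈ X, c K i * t i - w X) + (∑ C ∈ L₂, ∑ i ∈ C, c K i * t i
        - ∑ C ∈ L₂, w C)) < 2 ^ K.card * e K := by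
      rw [mul_add]
      linarith
    have h9 := lt_of_mul_lt_mul_left h8 (by positivity)
    have h10 : w K = wsum c t K - e K := rfl
    linarith

end Excess

end IsWeight

end Weights

end Permutonestohedron

namespace Permutonestohedron

set_option linter.unusedSectionVars false

/-! ### Every nested set is the tight set of a point. -/

section Existence

variable {ι : Type*} [Fintype ι] [DecidableEq ι]

theorem IsBuilding.union_sup_mem {𝓑 : Set (Finset ι)} (h𝓑 : IsBuilding 𝓑) {B : Finset ι}
    (hB : B ∈ 𝓑) {T : Finset (Finset ι)} (hT : ∀ C ∈ T, C ∈ 𝓑 ∧ ¬ Disjoint B C) :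
    B ∪ T.sup id ∈ 𝓑 := by
  induction T using Finset.induction_on with
  | empty => simpa using hB
  | insert C T hC ih =>
    have h1 := ih fun D hD => hT D (Finset.mem_insert_of_mem hD)
    have h2 := hT C (Finset.mem_insert_self _ _)
    rw [Finset.sup_insert, id, Finset.sup_eq_union, Finset.union_left_comm, Finset.union_comm C]
    exact h𝓑.union _ h1 _ h2.1 fun h => h2.2 (h.mono_left Finset.subset_union_left)

/-- A function can be defined by recursion on a rank. -/
theorem exists_eq_of_rank {α : Type*} (rank : α → ℕ) (F : α → (α → ℝ) → ℝ)
    (hF : ∀ i f g, (∀ j, rank j < rank i → f j = g j) → F i f = F i g) :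
    ∃ t : α → ℝ, ∀ i, t i = F i t := by
  classical
  let G : ∀ i, (∀ j, rank j < rank i → ℝ) → ℝ := fun i f =>
    F i fun j => if h : rank j < rank i then f j h else 0
  refine ⟨(measure rank).wf.fix G, fun i => ?_⟩
  rw [WellFounded.fix_eq]
  refine hF _ _ _ fun j hj => ?_
  exact dif_pos hj

/-- Used for a set holding `j` of `p` equal shares: the loss `j / p` is made up by one factor of two
for each of the `p - j` missing elements. -/
theorem le_mul_two_pow_sub {p j : ℕ} (hj : 1 ≤ j) (hjp : j ≤ p) : p ≤ j * 2 ^ (p - j) := by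
  obtain ⟨d, rfl⟩ := Nat.exists_eq_add_of_le hjp
  rw [Nat.add_sub_cancel_left]
  have : d + 1 ≤ 2 ^ d := Nat.lt_two_pow_self
  nlinarith

namespace CNested

variable {𝓑 S : Set (Finset ι)}

/-- Members of a nested set that contain a common point are comparable, so a minimal one containing
`B` is least. -/
theorem exists_least (hS : CNested 𝓑 S) (htop : Finset.univ ∈ S) {B : Finset ι}
    (hB : B.Nonempty) : ∃ A ∈ S, B ⊆ A ∧ ∀ C ∈ S, B ⊆ C → A ⊆ C := by
  obtain ⟨A, -, hA⟩ := Finite.exists_le_minimal (p := fun X => X ∈ S ∧ B ⊆ X)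
    (a := Finset.univ) ⟨htop, Finset.subset_univ _⟩
  refine ⟨A, hA.prop.1, hA.prop.2, fun C hC hBC => ?_⟩
  rcases hS.comparable A hA.prop.1 C hC with h | h | h
  · exact h
  · exact hA.le_of_le ⟨hC, hBC⟩ h
  · obtain ⟨i, hi⟩ := hB
    exact absurd (hBC hi) (Finset.disjoint_left.1 h (hA.prop.2 hi))

open scoped Classical in
/-- The maximal elements of `S` strictly contained in `A`. -/
noncomputable def children (S : Set (Finset ι)) (A : Finset ι) : Finset (Finset ι) :=
  Finset.univ.filter fun K => Maximal (fun X => X ∈ S ∧ X ⊂ A) K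

theorem mem_children {A K : Finset ι} :
    K ∈ children S A ↔ Maximal (fun X => X ∈ S ∧ X ⊂ A) K := by
  simp [children]

theorem exists_children {A B : Finset ι} (hB : B ∈ S) (hBA : B ⊂ A) :
    ∃ C ∈ children S A, B ⊆ C := by
  obtain ⟨C, h1, h2⟩ := Finite.exists_le_maximal (p := fun X => X ∈ S ∧ X ⊂ A) ⟨hB, hBA⟩
  exact ⟨C, mem_children.2 h2, h1⟩

theorem pairwiseDisjoint_children (hS : CNested 𝓑 S) (A : Finset ι) :
    (children S A : Set (Finset ι)).PairwiseDisjoint id := fun B hB C hC hne => by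
  have hB' := mem_children.1 hB
  have hC' := mem_children.1 hC
  rcases hS.comparable B hB'.prop.1 C hC'.prop.1 with h | h | h
  · exact absurd (hB'.eq_of_le hC'.prop h) hne
  · exact absurd (hC'.eq_of_le hB'.prop h).symm hne
  · exact h

end CNested

namespace IsWeight

open CNested

variable {𝓑 S : Set (Finset ι)} {c : Finset ι → ι → ℝ} {e : Finset ι → ℝ}

/-- Every nested set containing the whole set is the tight set of a point of the nestohedron. -/
theorem exists_tightSet_eq (hw : IsWeight 𝓑 c e) (h𝓑 : IsBuilding 𝓑) (hS : CNested 𝓑 S)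
    (htop : Finset.univ ∈ S) : ∃ t, IsNestPoint 𝓑 c e t ∧ tightSet 𝓑 c e t = S := by
  -- `mn i` is the least member of `S` containing `i`; the members of `S` are treated from the
  -- smallest on.
  have hmn : ∀ i, ∃ A ∈ S, i ∈ A ∧ ∀ C ∈ S, i ∈ C → A ⊆ C := fun i => by
    simpa using hS.exists_least htop (Finset.singleton_nonempty i)
  choose mn hmnS himn hmn using hmn
  have hmnA : ∀ A ∈ S, ∀ i ∈ A, mn i ≠ A → mn i ⊂ A := fun A hA i hi hne =>
    Finset.ssubset_iff_subset_ne.2 ⟨hmn i A hA hi, hne⟩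
  -- The equation `wsum c t A = e A` is solved for the elements `i` with `mn i = A`, with equal
  -- products `c A i * t i`; the other coordinates in `A` have already been fixed inside smaller
  -- members of `S`.
  obtain ⟨t, ht⟩ := exists_eq_of_rank (fun i => (mn i).card) (fun i t =>
    (e (mn i) - ∑ j ∈ (mn i).filter (mn · ≠ mn i), c (mn i) j * t j) /
      (((mn i).filter (mn · = mn i)).card * c (mn i) i)) fun i f g hfg => by
    congr 2
    refine Finset.sum_congr rfl fun j hj => ?_
    obtain ⟨hj, hj'⟩ := Finset.mem_filter.1 hj
    rw [hfg j (Finset.card_lt_card (hmnA _ (hmnS i) j hj hj'))]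
  -- the new elements of `A`, and the sum over the other ones
  set core : Finset ι → Finset ι := fun A => A.filter (mn · = A) with hcore
  set st : Finset ι → ℝ := fun A => ∑ j ∈ A.filter (mn · ≠ A), c A j * t j with hst
  have hchild : ∀ A ∈ S, (children S A).sup id = A.filter (mn · ≠ A) := fun A hA => by
    ext j
    simp only [Finset.mem_sup, id, Finset.mem_filter]
    constructor
    · rintro ⟨C, hC, hj⟩
      have hC' := (mem_children.1 hC).prop
      refine ⟨hC'.2.subset hj, fun h => ?_⟩
      exact hC'.2.not_subset (h ▸ hmn j C hC'.1 hj)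
    · rintro ⟨hj, hne⟩
      obtain ⟨C, hC, hjC⟩ := exists_children (hmnS j) (hmnA A hA j hj hne)
      exact ⟨C, hC, hjC (himn j)⟩
  -- Otherwise `A` would be the union of the maximal members of `S` strictly inside it, which are
  -- disjoint; nestedness excludes this.
  have hcore_ne : ∀ A ∈ S, (core A).Nonempty := fun A hA => by
    by_contra hne
    have hAeq : (children S A).sup id = A := by
      rw [hchild A hA, Finset.filter_true_of_mem]
      intro j hj h
      exact hne ⟨j, Finset.mem_filter.2 ⟨hj, h⟩⟩
    by_cases hnt : (children S A : Set (Finset ι)).Nontrivial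
    · refine hS.sup_notMem (children S A) (fun C hC => (mem_children.1 hC).prop.1) hnt
        (hS.pairwiseDisjoint_children A) ?_
      rw [hAeq]
      exact hS.subset hA
    · rcases Set.not_nontrivial_iff.1 hnt |>.eq_empty_or_singleton with h | ⟨C, h⟩
      · rw [Finset.coe_eq_empty.1 h, Finset.sup_empty] at hAeq
        exact (h𝓑.nonempty A (hS.subset hA)).ne_empty hAeq.symm
      · rw [Finset.coe_eq_singleton.1 h, Finset.sup_singleton] at hAeq
        have : C ∈ children S A := by rw [Finset.coe_eq_singleton.1 h]; simp
        exact (mem_children.1 this).prop.2.ne hAeq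
  have hcore_val : ∀ A ∈ S, ∀ i ∈ core A, c A i * t i = (e A - st A) / (core A).card := by
    intro A hA i hi
    obtain ⟨hiA, rfl⟩ := Finset.mem_filter.1 hi
    have h1 := (hw.pos _ (hS.subset hA) i hiA).ne'
    have h2 : ((core (mn i)).card : ℝ) ≠ 0 := by exact_mod_cast (hcore_ne _ hA).card_pos.ne'
    rw [ht i]
    change c (mn i) i * ((e (mn i) - st (mn i)) / ((core (mn i)).card * c (mn i) i)) = _
    field_simp
  have hsplit : ∀ A, ∀ B ⊆ A, ∑ i ∈ B, c A i * t i =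
      ∑ i ∈ B.filter (mn · = A), c A i * t i + ∑ i ∈ B.filter (mn · ≠ A), c A i * t i :=
    fun A B _ => (Finset.sum_filter_add_sum_filter_not _ _ _).symm
  have htight : ∀ A ∈ S, wsum c t A = e A := fun A hA => by
    rw [wsum, hsplit A A Finset.Subset.rfl]
    change ∑ i ∈ core A, c A i * t i + st A = e A
    rw [Finset.sum_congr rfl (hcore_val A hA), Finset.sum_const, nsmul_eq_mul,
      mul_div_cancel₀ _ (by exact_mod_cast (hcore_ne _ hA).card_pos.ne'), sub_add_cancel]
  -- The smaller members leave at least one element of `A` free, so their powers of two add up to at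
  -- most half of `2 ^ |A|`. Hence the old part uses at most half of `e A`, and the new coordinates
  -- are positive.
  have hst_le : ∀ A ∈ S, (∀ j ∈ A, mn j ≠ A → 0 < t j) → 0 ≤ st A ∧ 2 * st A ≤ e A := by
    intro A hA hpos
    have hA𝓑 := hS.subset hA
    have heA := hw.e_pos A hA𝓑
    refine ⟨Finset.sum_nonneg fun j hj => ?_, ?_⟩
    · obtain ⟨hjA, hj⟩ := Finset.mem_filter.1 hj
      exact mul_nonneg (hw.pos A hA𝓑 j hjA).le (hpos j hjA hj).le
    have h1 : st A = ∑ C ∈ children S A, ∑ j ∈ C, c A j * t j := by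
      change ∑ j ∈ A.filter (mn · ≠ A), c A j * t j = _
      rw [← hchild A hA]
      exact sum_sup_id (hS.pairwiseDisjoint_children A) _
    rcases (children S A).eq_empty_or_nonempty with he | hne
    · rw [h1, he, Finset.sum_empty, mul_zero]
      exact heA.le
    have h2 : ∑ C ∈ children S A, 2 ^ A.card * (∑ j ∈ C, c A j * t j) ≤
        ∑ C ∈ children S A, 2 ^ C.card * e A := by
      refine Finset.sum_le_sum fun C hC => ?_
      have hC' := (mem_children.1 hC).prop
      refine (hw.sum_lt hA𝓑 (hS.subset hC'.1) hC'.2 (fun j hj => (hpos j (hC'.2.subset hj) ?_).le)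
        (htight C hC'.1)).le
      exact fun h => hC'.2.not_subset (h ▸ hmn j C hC'.1 hj)
    rw [← Finset.mul_sum, ← h1, ← Finset.sum_mul] at h2
    have h3 := sum_two_pow_card_le hne
      (fun C hC => h𝓑.nonempty C (hS.subset (mem_children.1 hC).prop.1))
      (hS.pairwiseDisjoint_children A)
    have h4 : ((children S A).sup id).card + 1 ≤ A.card := by
      rw [hchild A hA, ← Finset.card_filter_add_card_filter_not (s := A) (mn · = A), add_comm]
      exact Nat.add_le_add_right (hcore_ne A hA).card_pos _
    have h5 : 2 * ∑ C ∈ children S A, 2 ^ C.card ≤ 2 ^ A.card := by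
      refine le_trans ?_ (Nat.pow_le_pow_right (by norm_num) h4)
      rw [pow_succ]
      omega
    have h6 : 2 * ∑ C ∈ children S A, (2 : ℝ) ^ C.card ≤ 2 ^ A.card := by exact_mod_cast h5
    have h7 := mul_le_mul_of_nonneg_right h6 heA.le
    have h8 : 2 ^ A.card * (2 * st A) ≤ 2 ^ A.card * e A := by linarith
    exact le_of_mul_le_mul_left h8 (by positivity)
  have hpos : ∀ i, 0 < t i := by
    intro i
    induction h : (mn i).card using Nat.strong_induction_on generalizing i with
    | _ n ih =>
      have h1 := hst_le (mn i) (hmnS i) fun j hj hne =>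
        ih _ (h ▸ Finset.card_lt_card (hmnA _ (hmnS i) j hj hne)) j rfl
      have h2 := hcore_val _ (hmnS i) i (Finset.mem_filter.2 ⟨himn i, rfl⟩)
      have h3 : 0 < (e (mn i) - st (mn i)) / (core (mn i)).card := by
        have := hw.e_pos _ (hS.subset (hmnS i))
        exact div_pos (by linarith) (by exact_mod_cast (hcore_ne _ (hmnS i)).card_pos)
      rw [← h2] at h3
      exact (pos_iff_pos_of_mul_pos h3).1 (hw.pos _ (hS.subset (hmnS i)) i (himn i))
  have hstrict : ∀ B ∈ 𝓑, B ∉ S → e B < wsum c t B := by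
    intro B hB hBS
    obtain ⟨A, hA, hBA, hmin⟩ := hS.exists_least htop (h𝓑.nonempty B hB)
    have hA𝓑 := hS.subset hA
    have heA := hw.e_pos A hA𝓑
    have hBA' : B ⊂ A := Finset.ssubset_iff_subset_ne.2 ⟨hBA, fun h => hBS (h ▸ hA)⟩
    -- `B` contains a new element of `A`. Otherwise the smaller members met by `B` would have their
    -- union in the building set, so there would be only one, and it would contain `B`, against the
    -- choice of `A`.
    have hcne : (B.filter (mn · = A)).Nonempty := by
      by_contra hne
      have hBc : ∀ i ∈ B, ∃ C ∈ children S A, i ∈ C := fun i hi => by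
        have : i ∈ (children S A).sup id := by
          rw [hchild A hA]
          exact Finset.mem_filter.2 ⟨hBA hi, fun h => hne ⟨i, Finset.mem_filter.2 ⟨hi, h⟩⟩⟩
        simpa using Finset.mem_sup.1 this
      set L := (children S A).filter (¬ Disjoint B ·) with hL
      have hLc : ∀ C ∈ L, C ∈ children S A := fun C hC => (Finset.mem_filter.1 hC).1
      have hBL : B ⊆ L.sup id := fun i hi => by
        obtain ⟨C, hC, hiC⟩ := hBc i hi
        exact Finset.mem_sup.2 ⟨C, Finset.mem_filter.2 ⟨hC,
          Finset.not_disjoint_iff.2 ⟨i, hi, hiC⟩⟩, hiC⟩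
      have h1 : L.sup id ∈ 𝓑 := by
        have := h𝓑.union_sup_mem hB (T := L) fun C hC =>
          ⟨hS.subset (mem_children.1 (hLc C hC)).prop.1, (Finset.mem_filter.1 hC).2⟩
        rwa [Finset.union_eq_right.2 hBL] at this
      by_cases hnt : (L : Set (Finset ι)).Nontrivial
      · exact hS.sup_notMem L (fun C hC => (mem_children.1 (hLc C hC)).prop.1) hnt
          ((hS.pairwiseDisjoint_children A).subset fun C hC => hLc C hC) h1
      · rcases Set.not_nontrivial_iff.1 hnt |>.eq_empty_or_singleton with h | ⟨C, h⟩
        · rw [Finset.coe_eq_empty.1 h, Finset.sup_empty] at h1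
          exact (h𝓑.nonempty _ h1).ne_empty rfl
        · rw [Finset.coe_eq_singleton.1 h, Finset.sup_singleton] at hBL
          have hC : C ∈ L := by rw [Finset.coe_eq_singleton.1 h]; simp
          have hC' := (mem_children.1 (hLc C hC)).prop
          exact hC'.2.not_subset (hmin C hC'.1 hBL)
    obtain ⟨hst0, hst1⟩ := hst_le A hA fun j _ _ => hpos j
    set Q := ∑ i ∈ B, c A i * t i with hQ
    set j := (B.filter (mn · = A)).card with hj
    set p := (core A).card with hp
    have hj1 : 1 ≤ j := hcne.card_pos
    have hjp : j ≤ p := Finset.card_le_card (Finset.filter_subset_filter _ hBA)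
    have hp0 : (0 : ℝ) < p := by exact_mod_cast hj1.trans hjp
    have hQ1 : Q = j * ((e A - st A) / p) + ∑ i ∈ B.filter (mn · ≠ A), c A i * t i := by
      rw [hQ, hsplit A B hBA]
      congr 1
      rw [Finset.sum_congr rfl fun i hi => hcore_val A hA i
        (Finset.filter_subset_filter _ hBA hi), Finset.sum_const, nsmul_eq_mul]
    have hBcard : j + (B.filter (mn · ≠ A)).card = B.card :=
      Finset.card_filter_add_card_filter_not (s := B) (mn · = A)
    have hAcard : p + (A.filter (mn · ≠ A)).card = A.card :=
      Finset.card_filter_add_card_filter_not (s := A) (mn · = A)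
    have hnum := le_mul_two_pow_sub hj1 hjp
    -- Once `B` carries its fraction of `e A` in the form of `A`, the growth condition turns this
    -- into a strict lower bound for the form of `B`.
    have hkey : 2 ^ B.card * e A ≤ 2 ^ A.card * Q := by
      have h0 : ((e A - st A) / p) * p = e A - st A := div_mul_cancel₀ _ hp0.ne'
      have hnumR : (p : ℝ) ≤ j * 2 ^ (p - j) := by exact_mod_cast hnum
      have hsub : B.filter (mn · ≠ A) ⊆ A.filter (mn · ≠ A) := Finset.filter_subset_filter _ hBA
      refine le_of_mul_le_mul_right (a := (p : ℝ)) ?_ hp0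
      -- If `B` contains all the old elements of `A`, their whole contribution is available.
      -- Otherwise `B` misses one more element, and the extra factor of two offsets the at most half
      -- of `e A` used by the old part.
      rcases hsub.eq_or_ssubset with heq | hss
      · have h1 : B.card + (p - j) = A.card := by
          rw [heq] at hBcard
          omega
        have hQ2 : j * e A ≤ Q * p := by
          rw [hQ1, heq, add_mul, mul_assoc, h0]
          change j * e A ≤ j * (e A - st A) + st A * p
          have : (j : ℝ) ≤ p := by exact_mod_cast hjp
          nlinarith
        rw [← h1, pow_add]
        calc (2 : ℝ) ^ B.card * e A * p ≤ 2 ^ B.card * e A * (j * 2 ^ (p - j)) :=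
              mul_le_mul_of_nonneg_left hnumR (by positivity)
          _ = 2 ^ B.card * 2 ^ (p - j) * (j * e A) := by ring
          _ ≤ 2 ^ B.card * 2 ^ (p - j) * (Q * p) := mul_le_mul_of_nonneg_left hQ2 (by positivity)
          _ = _ := by ring
      · have h1 : B.card + (p - j) + 1 ≤ A.card := by
          have := Finset.card_lt_card hss
          omega
        have hQ2 : j * e A ≤ 2 * (Q * p) := by
          rw [hQ1, add_mul, mul_assoc, h0]
          have h2 : 0 ≤ ∑ i ∈ B.filter (mn · ≠ A), c A i * t i := Finset.sum_nonneg fun i hi =>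
            mul_nonneg (hw.pos A hA𝓑 i (hBA (Finset.mem_filter.1 hi).1)).le (hpos i).le
          have h3 := mul_nonneg h2 hp0.le
          have : (0 : ℝ) ≤ j := Nat.cast_nonneg j
          nlinarith
        have hQp : 0 ≤ Q * p := by
          have : 0 ≤ j * e A := mul_nonneg (Nat.cast_nonneg j) heA.le
          linarith
        have h4 : (2 : ℝ) ^ (B.card + (p - j) + 1) ≤ 2 ^ A.card :=
          pow_le_pow_right₀ one_le_two h1
        calc (2 : ℝ) ^ B.card * e A * p ≤ 2 ^ B.card * e A * (j * 2 ^ (p - j)) :=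
              mul_le_mul_of_nonneg_left hnumR (by positivity)
          _ = 2 ^ B.card * 2 ^ (p - j) * (j * e A) := by ring
          _ ≤ 2 ^ B.card * 2 ^ (p - j) * (2 * (Q * p)) :=
              mul_le_mul_of_nonneg_left hQ2 (by positivity)
          _ = 2 ^ (B.card + (p - j) + 1) * (Q * p) := by ring
          _ ≤ 2 ^ A.card * (Q * p) := mul_le_mul_of_nonneg_right h4 hQp
          _ = _ := by ring
    have hlt : 2 ^ A.card * Q * e B < 2 ^ B.card * e A * wsum c t B := by
      rw [hQ, wsum, Finset.mul_sum, Finset.mul_sum, Finset.sum_mul]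
      refine Finset.sum_lt_sum_of_nonempty (h𝓑.nonempty B hB) fun i hi => ?_
      have := mul_lt_mul_of_pos_right (hw.growth A hA𝓑 B hB hBA' i hi) (hpos i)
      linarith
    have hwpos : 0 ≤ wsum c t B := Finset.sum_nonneg fun i hi =>
      mul_nonneg (hw.pos B hB i hi).le (hpos i).le
    have hAQ : 0 < 2 ^ A.card * Q := lt_of_lt_of_le (by positivity) hkey
    exact lt_of_mul_lt_mul_left (hlt.trans_le (mul_le_mul_of_nonneg_right hkey hwpos)) hAQ.le
  refine ⟨t, ⟨htight _ htop, fun B hB => ?_⟩, ?_⟩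
  · by_cases hBS : B ∈ S
    · exact (htight B hBS).ge
    · exact (hstrict B hB hBS).le
  · ext B
    refine ⟨fun h => ?_, fun h => ⟨hS.subset h, htight B h⟩⟩
    by_contra hBS
    exact (hstrict B h.1 hBS).ne' h.2

end IsWeight

end Existence

end Permutonestohedron

namespace Permutonestohedron

set_option linter.unusedSectionVars false

/-! ### Restriction and contraction of building sets -/

section Contraction

variable {ι κ : Type*} [Fintype ι] [DecidableEq ι] [Fintype κ]

/-- The elements of the building set included in `X`. -/
def restr (𝓑 : Set (Finset ι)) (X : Finset ι) : Set (Finset ι) := {B ∈ 𝓑 | B ⊆ X}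

/-- The nonempty sets `B \ D`, for `B` in the building set. -/
def contr (𝓑 : Set (Finset ι)) (D : Finset ι) : Set (Finset ι) :=
  {Q | Q.Nonempty ∧ ∃ B ∈ 𝓑, B \ D = Q}

open scoped Classical in
/-- The largest element `B` of the building set with `B \ D = Q`. -/
noncomputable def lift (𝓑 : Set (Finset ι)) (D Q : Finset ι) : Finset ι :=
  (Finset.univ.filter fun B => B ∈ 𝓑 ∧ B \ D = Q).sup id

/-- The union of a family of sets. -/
def total (A : κ → Finset ι) : Finset ι := Finset.univ.biUnion A

/-- A disjoint family in the building set which is the family of components of its union. -/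
structure IsCut (𝓑 : Set (Finset ι)) (A : κ → Finset ι) : Prop where
  mem : ∀ i, A i ∈ 𝓑
  disjoint : ∀ i j, i ≠ j → Disjoint (A i) (A j)
  subset : ∀ K ∈ 𝓑, K ⊆ total A → ∃ i, K ⊆ A i

theorem mem_total {A : κ → Finset ι} {x : ι} : x ∈ total A ↔ ∃ i, x ∈ A i := by
  simp [total]

theorem subset_total (A : κ → Finset ι) (i : κ) : A i ⊆ total A :=
  fun _ hx => mem_total.2 ⟨i, hx⟩

variable {𝓑 : Set (Finset ι)} {A : κ → Finset ι}

/-- The union of the `A i` met by `K` contains `K` and hence belongs to the building set; nestedness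
leaves room for only one of them. -/
theorem IsCut.of_cnested [DecidableEq κ] (h𝓑 : IsBuilding 𝓑) (hA : CNested 𝓑 (Set.range A))
    (hmin : ∀ i j, A i ⊆ A j → i = j) : IsCut 𝓑 A where
  mem i := hA.subset ⟨i, rfl⟩
  disjoint i j hij := by
    rcases hA.comparable _ ⟨i, rfl⟩ _ ⟨j, rfl⟩ with h | h | h
    · exact absurd (hmin i j h) hij
    · exact absurd (hmin j i h).symm hij
    · exact h
  subset K hK hKD := by
    have hdis : ∀ i j, i ≠ j → Disjoint (A i) (A j) := fun i j hij => by
      rcases hA.comparable _ ⟨i, rfl⟩ _ ⟨j, rfl⟩ with h | h | h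
      · exact absurd (hmin i j h) hij
      · exact absurd (hmin j i h).symm hij
      · exact h
    set I := Finset.univ.filter fun i => ¬ Disjoint K (A i) with hI
    have hcov : K ⊆ (I.image A).sup id := fun x hx => by
      obtain ⟨i, hi⟩ := mem_total.1 (hKD hx)
      exact Finset.mem_sup.2 ⟨A i, Finset.mem_image_of_mem _ (Finset.mem_filter.2
        ⟨Finset.mem_univ _, Finset.not_disjoint_iff.2 ⟨x, hx, hi⟩⟩), hi⟩
    have hmem : (I.image A).sup id ∈ 𝓑 := by
      have := h𝓑.union_sup_mem hK (T := I.image A) fun C hC => by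
        obtain ⟨i, hi, rfl⟩ := Finset.mem_image.1 hC
        exact ⟨hA.subset ⟨i, rfl⟩, (Finset.mem_filter.1 hi).2⟩
      rwa [Finset.union_eq_right.2 hcov] at this
    by_cases hnt : ((I.image A : Finset (Finset ι)) : Set (Finset ι)).Nontrivial
    · refine absurd hmem (hA.sup_notMem _ (fun C hC => ?_) hnt fun C hC C' hC' hne => ?_)
      · obtain ⟨i, -, rfl⟩ := Finset.mem_image.1 hC
        exact ⟨i, rfl⟩
      · obtain ⟨i, -, rfl⟩ := Finset.mem_image.1 hC
        obtain ⟨j, -, rfl⟩ := Finset.mem_image.1 hC'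
        exact hdis i j fun h => hne (h ▸ rfl)
    · rcases Set.not_nontrivial_iff.1 hnt |>.eq_empty_or_singleton with h | ⟨C, h⟩
      · rw [Finset.coe_eq_empty.1 h, Finset.sup_empty] at hmem
        exact absurd rfl (h𝓑.nonempty _ hmem).ne_empty
      · rw [Finset.coe_eq_singleton.1 h, Finset.sup_singleton] at hcov
        have : C ∈ I.image A := by rw [Finset.coe_eq_singleton.1 h]; simp
        obtain ⟨i, -, rfl⟩ := Finset.mem_image.1 this
        exact ⟨i, hcov⟩

/-! ### Largest representatives in a contraction. -/

section Lift

variable (h𝓑 : IsBuilding 𝓑) {D Q Q' : Finset ι}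

include h𝓑

/-- All candidates contain the nonempty set `Q`, so they meet and their union is again a candidate.
-/
theorem lift_mem_and_sdiff (hQ : Q ∈ contr 𝓑 D) : lift 𝓑 D Q ∈ 𝓑 ∧ lift 𝓑 D Q \ D = Q := by
  classical
  obtain ⟨⟨x, hx⟩, B, hB, hBQ⟩ := hQ
  set T := Finset.univ.filter fun B => B ∈ 𝓑 ∧ B \ D = Q with hT
  have hlift : lift 𝓑 D Q = T.sup id := by
    rw [lift]
  have hmem : ∀ {C}, C ∈ T ↔ C ∈ 𝓑 ∧ C \ D = Q := by simp [hT]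
  have hxC : ∀ C ∈ T, x ∈ C := fun C hC =>
    (Finset.mem_sdiff.1 ((hmem.1 hC).2.symm ▸ hx)).1
  have hBT : B ∈ T := hmem.2 ⟨hB, hBQ⟩
  constructor
  · have := h𝓑.union_sup_mem hB (T := T) fun C hC => ⟨(hmem.1 hC).1,
      Finset.not_disjoint_iff.2 ⟨x, hxC B hBT, hxC C hC⟩⟩
    rw [hlift]
    rwa [Finset.union_eq_right.2 (show B ⊆ T.sup id from Finset.le_sup (f := id) hBT)] at this
  · rw [hlift]
    apply Finset.Subset.antisymm
    · intro y hy
      obtain ⟨hy, hyD⟩ := Finset.mem_sdiff.1 hy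
      obtain ⟨C, hC, hyC⟩ := Finset.mem_sup.1 hy
      exact (hmem.1 hC).2 ▸ Finset.mem_sdiff.2 ⟨hyC, hyD⟩
    · conv_lhs => rw [← hBQ]
      exact Finset.sdiff_subset_sdiff (Finset.le_sup (f := id) hBT) Finset.Subset.rfl

theorem lift_mem (hQ : Q ∈ contr 𝓑 D) : lift 𝓑 D Q ∈ 𝓑 := (lift_mem_and_sdiff h𝓑 hQ).1

theorem lift_sdiff (hQ : Q ∈ contr 𝓑 D) : lift 𝓑 D Q \ D = Q := (lift_mem_and_sdiff h𝓑 hQ).2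

theorem subset_lift (hQ : Q ∈ contr 𝓑 D) : Q ⊆ lift 𝓑 D Q := by
  conv_lhs => rw [← lift_sdiff h𝓑 hQ]
  exact Finset.sdiff_subset

theorem lift_not_subset (hQ : Q ∈ contr 𝓑 D) : ¬ lift 𝓑 D Q ⊆ D := fun h => by
  have := lift_sdiff h𝓑 hQ
  rw [Finset.sdiff_eq_empty_iff_subset.2 h] at this
  exact hQ.1.ne_empty this.symm

theorem subset_lift_of_not_disjoint (hQ : Q ∈ contr 𝓑 D) {B : Finset ι} (hB : B ∈ 𝓑)
    (h : ¬ Disjoint B (lift 𝓑 D Q)) (hBQ : B \ D ⊆ Q) : B ⊆ lift 𝓑 D Q := by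
  classical
  have h1 := h𝓑.union _ hB _ (lift_mem h𝓑 hQ) h
  refine Finset.subset_union_left.trans (?_ : B ∪ lift 𝓑 D Q ⊆ _)
  conv_rhs => rw [lift]
  refine Finset.le_sup (f := id) (Finset.mem_filter.2 ⟨Finset.mem_univ _, h1, ?_⟩)
  rw [Finset.union_sdiff_distrib, lift_sdiff h𝓑 hQ]
  exact Finset.union_eq_right.2 hBQ

theorem lift_subset_lift (hQ : Q ∈ contr 𝓑 D) (hQ' : Q' ∈ contr 𝓑 D) :
    lift 𝓑 D Q ⊆ lift 𝓑 D Q' ↔ Q ⊆ Q' := by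
  constructor
  · intro h
    rw [← lift_sdiff h𝓑 hQ, ← lift_sdiff h𝓑 hQ']
    exact Finset.sdiff_subset_sdiff h Finset.Subset.rfl
  · intro h
    refine subset_lift_of_not_disjoint h𝓑 hQ' (lift_mem h𝓑 hQ) ?_ ((lift_sdiff h𝓑 hQ).le.trans h)
    obtain ⟨x, hx⟩ := hQ.1
    exact Finset.not_disjoint_iff.2 ⟨x, subset_lift h𝓑 hQ hx, subset_lift h𝓑 hQ' (h hx)⟩

theorem lift_injOn : Set.InjOn (lift 𝓑 D) (contr 𝓑 D) := fun Q hQ Q' hQ' h => by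
  rw [← lift_sdiff h𝓑 hQ, ← lift_sdiff h𝓑 hQ', h]

end Lift

/-! ### Nested sets containing a cut. -/

section Cut

variable (h𝓑 : IsBuilding 𝓑) (hA : IsCut 𝓑 A) {S : Set (Finset ι)}

include h𝓑 hA

theorem IsCut.subset_lift {Q : Finset ι} (hQ : Q ∈ contr 𝓑 (total A)) {i : κ}
    (h : ¬ Disjoint (A i) (lift 𝓑 (total A) Q)) : A i ⊆ lift 𝓑 (total A) Q :=
  subset_lift_of_not_disjoint h𝓑 hQ (hA.mem i) h (by
    rw [Finset.sdiff_eq_empty_iff_subset.2 (subset_total A i)]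
    exact Finset.empty_subset _)

theorem IsCut.sdiff_mem_contr {B : Finset ι} (hB : B ∈ 𝓑) (hBD : ¬ B ⊆ total A) :
    B \ total A ∈ contr 𝓑 (total A) :=
  ⟨Finset.sdiff_nonempty.2 hBD, B, hB, rfl⟩

/-- The union of some members of a nested set and of the members of the cut it avoids cannot be a
larger element of the building set. -/
theorem IsCut.sup_eq_lift [DecidableEq κ] (hS : CNested 𝓑 S) (hAS : ∀ i, A i ∈ S)
    {T : Finset (Finset ι)} (hTS : ∀ B ∈ T, B ∈ S) (hTne : T.Nonempty)
    (hTD : ∀ B ∈ T, ¬ B ⊆ total A)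
    (hd : (T : Set (Finset ι)).PairwiseDisjoint id) (hsup : T.sup id \ total A ∈ contr 𝓑 (total A))
    (hsub : T.sup id ⊆ lift 𝓑 (total A) (T.sup id \ total A)) :
    ∃ B ∈ T, T = {B} ∧ lift 𝓑 (total A) (B \ total A) = B := by
  set L := lift 𝓑 (total A) (T.sup id \ total A) with hL
  -- Adjoining the `A i` inside `L` that avoid `T` gives a disjoint family of members of `S` whose
  -- union is `L`. As `L` is in the building set, nestedness reduces the family to one set.
  set I := Finset.univ.filter fun i => A i ⊆ L ∧ ∀ B ∈ T, Disjoint (A i) B with hI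
  have hIL : ∀ i ∈ I, A i ⊆ L ∧ ∀ B ∈ T, Disjoint (A i) B := fun i hi => (Finset.mem_filter.1 hi).2
  have hLeq : (T ∪ I.image A).sup id = L := by
    apply Finset.Subset.antisymm
    · refine Finset.sup_le fun C hC => ?_
      rcases Finset.mem_union.1 hC with hC | hC
      · exact (Finset.le_sup (f := id) hC).trans hsub
      · obtain ⟨i, hi, rfl⟩ := Finset.mem_image.1 hC
        exact (hIL i hi).1
    · intro x hx
      rw [Finset.mem_sup]
      by_cases hxD : x ∈ total A
      · obtain ⟨i, hi⟩ := mem_total.1 hxD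
        by_cases hiT : ∀ B ∈ T, Disjoint (A i) B
        · refine ⟨A i, Finset.mem_union_right _ (Finset.mem_image_of_mem _ (Finset.mem_filter.2
            ⟨Finset.mem_univ _, ?_, hiT⟩)), hi⟩
          exact hA.subset_lift h𝓑 hsup (Finset.not_disjoint_iff.2 ⟨x, hi, hx⟩)
        · push Not at hiT
          obtain ⟨B, hB, hBA⟩ := hiT
          refine ⟨B, Finset.mem_union_left _ hB, ?_⟩
          rcases hS.comparable _ (hAS i) B (hTS B hB) with h | h | h
          · exact h hi
          · exact absurd (h.trans (subset_total A i)) (hTD B hB)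
          · exact absurd h hBA
      · have : x ∈ T.sup id := by
          have h1 : x ∈ L \ total A := Finset.mem_sdiff.2 ⟨hx, hxD⟩
          rw [hL, lift_sdiff h𝓑 hsup] at h1
          exact (Finset.mem_sdiff.1 h1).1
        obtain ⟨B, hB, hxB⟩ := Finset.mem_sup.1 this
        exact ⟨B, Finset.mem_union_left _ hB, hxB⟩
  have hL𝓑 : (T ∪ I.image A).sup id ∈ 𝓑 := hLeq ▸ lift_mem h𝓑 hsup
  have hnt : ¬ ((T ∪ I.image A : Finset (Finset ι)) : Set (Finset ι)).Nontrivial := fun hnt => by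
    refine hS.sup_notMem _ (fun C hC => ?_) hnt ?_ hL𝓑
    · rcases Finset.mem_union.1 hC with hC | hC
      · exact hTS C hC
      · obtain ⟨i, -, rfl⟩ := Finset.mem_image.1 hC
        exact hAS i
    · rw [Finset.coe_union, Set.pairwiseDisjoint_union]
      refine ⟨hd, fun C hC C' hC' hne => ?_, fun C hC C' hC' _ => ?_⟩
      · obtain ⟨i, -, rfl⟩ := Finset.mem_image.1 hC
        obtain ⟨j, -, rfl⟩ := Finset.mem_image.1 hC'
        exact hA.disjoint i j fun h => hne (h ▸ rfl)
      · obtain ⟨i, hi, rfl⟩ := Finset.mem_image.1 hC'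
        exact ((hIL i hi).2 C hC).symm
  obtain ⟨B, hB⟩ := hTne
  have h1 : T ∪ I.image A = {B} := by
    rw [← Finset.coe_eq_singleton]
    exact (Set.not_nontrivial_iff.1 hnt).eq_singleton_of_mem (by simp [hB])
  have h2 : T = {B} := Finset.Subset.antisymm (h1 ▸ Finset.subset_union_left) (by simpa using hB)
  refine ⟨B, hB, h2, ?_⟩
  rw [h1] at hLeq
  simp only [h2, Finset.sup_singleton, id] at hL hLeq
  rw [← hL, hLeq]

/-- In a nested set containing the cut, a member not inside `D` is already the largest
representative of its difference with `D`, so passing to the contraction loses nothing. -/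
theorem IsCut.lift_sdiff_eq [DecidableEq κ] (hS : CNested 𝓑 S) (hAS : ∀ i, A i ∈ S) {B : Finset ι}
    (hB : B ∈ S) (hBD : ¬ B ⊆ total A) : lift 𝓑 (total A) (B \ total A) = B := by
  have hc := hA.sdiff_mem_contr h𝓑 (hS.subset hB) hBD
  obtain ⟨C, hC, -, h⟩ := hA.sup_eq_lift h𝓑 hS hAS (T := {B}) (by simpa using hB) (by simp)
    (by simpa using hBD) (by simp) (by simpa using hc) (by
      simp only [Finset.sup_singleton, id]
      refine subset_lift_of_not_disjoint h𝓑 hc (hS.subset hB) ?_ Finset.Subset.rfl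
      obtain ⟨x, hx⟩ := hc.1
      exact Finset.not_disjoint_iff.2 ⟨x, Finset.sdiff_subset hx,
        Permutonestohedron.subset_lift h𝓑 hc hx⟩)
  rw [Finset.mem_singleton.1 hC] at h
  exact h

/-- A nested set containing the cut induces a nested set of the contraction. -/
theorem IsCut.cnested_contr [DecidableEq κ] (hS : CNested 𝓑 S) (hAS : ∀ i, A i ∈ S) :
    CNested (contr 𝓑 (total A)) {Q ∈ contr 𝓑 (total A) | lift 𝓑 (total A) Q ∈ S} where
  subset _ h := h.1
  comparable Q hQ Q' hQ' := by
    rcases hS.comparable _ hQ.2 _ hQ'.2 with h | h | h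
    · exact Or.inl ((lift_subset_lift h𝓑 hQ.1 hQ'.1).1 h)
    · exact Or.inr (Or.inl ((lift_subset_lift h𝓑 hQ'.1 hQ.1).1 h))
    · exact Or.inr (Or.inr (h.mono (Permutonestohedron.subset_lift h𝓑 hQ.1)
        (Permutonestohedron.subset_lift h𝓑 hQ'.1)))
  sup_notMem T hT hnt hd hsup := by
    have hTc : ∀ Q ∈ T, Q ∈ contr 𝓑 (total A) := fun Q hQ => (hT hQ).1
    have heq : (T.image (lift 𝓑 (total A))).sup id \ total A = T.sup id := by
      ext x
      simp only [Finset.mem_sdiff, Finset.mem_sup, Finset.mem_image, id]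
      constructor
      · rintro ⟨⟨_, ⟨Q, hQ, rfl⟩, hx⟩, hxD⟩
        refine ⟨Q, hQ, ?_⟩
        rw [← lift_sdiff h𝓑 (hTc Q hQ)]
        exact Finset.mem_sdiff.2 ⟨hx, hxD⟩
      · rintro ⟨Q, hQ, hx⟩
        rw [← lift_sdiff h𝓑 (hTc Q hQ)] at hx
        obtain ⟨h1, h2⟩ := Finset.mem_sdiff.1 hx
        exact ⟨⟨_, ⟨Q, hQ, rfl⟩, h1⟩, h2⟩
    have hnt' := hnt
    obtain ⟨Q₁, hQ₁, Q₂, hQ₂, hne⟩ := hnt'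
    obtain ⟨B, -, hTB, -⟩ := hA.sup_eq_lift h𝓑 hS hAS (T := T.image (lift 𝓑 (total A)))
      (fun B hB => by
        obtain ⟨Q, hQ, rfl⟩ := Finset.mem_image.1 hB
        exact (hT hQ).2)
      (by simpa using ⟨Q₁, hQ₁⟩)
      (fun B hB => by
        obtain ⟨Q, hQ, rfl⟩ := Finset.mem_image.1 hB
        exact lift_not_subset h𝓑 (hTc Q hQ))
      (fun _ hB _ hC hBC => by
        obtain ⟨Q, hQ, rfl⟩ := Finset.mem_image.1 hB
        obtain ⟨Q', hQ', rfl⟩ := Finset.mem_image.1 hC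
        have hQQ' : Q ≠ Q' := fun h => hBC (h ▸ rfl)
        have hdQ : Disjoint Q Q' := hd hQ hQ' hQQ'
        rcases hS.comparable _ (hT hQ).2 _ (hT hQ').2 with h | h | h
        · have h1 := (lift_subset_lift h𝓑 (hTc Q hQ) (hTc Q' hQ')).1 h
          exact absurd (Finset.disjoint_self_iff_empty _ |>.1 (hdQ.mono_right h1))
            (hTc Q hQ).1.ne_empty
        · have h1 := (lift_subset_lift h𝓑 (hTc Q' hQ') (hTc Q hQ)).1 h
          exact absurd (Finset.disjoint_self_iff_empty _ |>.1 (hdQ.mono_left h1))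
            (hTc Q' hQ').1.ne_empty
        · exact h)
      (by rw [heq]; exact hsup)
      (by
        rw [heq]
        refine Finset.sup_le fun B hB => ?_
        obtain ⟨Q, hQ, rfl⟩ := Finset.mem_image.1 hB
        exact (lift_subset_lift h𝓑 (hTc Q hQ) hsup).2 (Finset.le_sup (f := id) hQ))
    have h1 := Finset.mem_image_of_mem (lift 𝓑 (total A)) hQ₁
    have h2 := Finset.mem_image_of_mem (lift 𝓑 (total A)) hQ₂
    rw [hTB, Finset.mem_singleton] at h1 h2
    exact hne (lift_injOn h𝓑 (hTc _ hQ₁) (hTc _ hQ₂) (h1.trans h2.symm))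

omit h𝓑 hA in
theorem cnested_restr (hS : CNested 𝓑 S) (X : Finset ι) :
    CNested (restr 𝓑 X) {B ∈ S | B ⊆ X} where
  subset _ h := ⟨hS.subset h.1, h.2⟩
  comparable B hB C hC := hS.comparable B hB.1 C hC.1
  sup_notMem T hT hnt hd h := hS.sup_notMem T (fun _ hB => (hT hB).1) hnt hd h.1

/-- Nested sets of the contraction and of the members of the cut together give a nested set. -/
theorem IsCut.cnested_glue {S₀ : Set (Finset ι)} (hS₀ : CNested (contr 𝓑 (total A)) S₀)
    {Sᵢ : κ → Set (Finset ι)} (hSᵢ : ∀ i, CNested (restr 𝓑 (A i)) (Sᵢ i)) :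
    CNested 𝓑 (lift 𝓑 (total A) '' S₀ ∪ ⋃ i, Sᵢ i) where
  subset := by
    rintro B (⟨Q, hQ, rfl⟩ | hB)
    · exact lift_mem h𝓑 (hS₀.subset hQ)
    · obtain ⟨i, hi⟩ := Set.mem_iUnion.1 hB
      exact ((hSᵢ i).subset hi).1
  comparable := by
    have key : ∀ Q ∈ S₀, ∀ i, ∀ B ∈ Sᵢ i, B ⊆ lift 𝓑 (total A) Q ∨
        Disjoint (lift 𝓑 (total A) Q) B := by
      intro Q hQ i B hB
      by_cases h : Disjoint (A i) (lift 𝓑 (total A) Q)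
      · exact Or.inr (h.mono_left ((hSᵢ i).subset hB).2).symm
      · exact Or.inl (((hSᵢ i).subset hB).2.trans (hA.subset_lift h𝓑 (hS₀.subset hQ) h))
    rintro B (⟨Q, hQ, rfl⟩ | hB) C (⟨Q', hQ', rfl⟩ | hC)
    · have hQc := hS₀.subset hQ
      have hQc' := hS₀.subset hQ'
      rcases hS₀.comparable Q hQ Q' hQ' with h | h | h
      · exact Or.inl ((lift_subset_lift h𝓑 hQc hQc').2 h)
      · exact Or.inr (Or.inl ((lift_subset_lift h𝓑 hQc' hQc).2 h))
      -- If the lifts of disjoint `Q` and `Q'` met, their union would be a member, and `Q ∪ Q'`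
      -- would belong to the contraction, against nestedness there.
      · refine Or.inr (Or.inr ?_)
        by_contra hnd
        have hQQ' : Q ≠ Q' := fun heq => by
          subst heq
          exact hQc.1.ne_empty (Finset.disjoint_self_iff_empty _ |>.1 h)
        refine hS₀.sup_notMem {Q, Q'} ?_ ?_ ?_ ?_
        · intro X hX
          rcases Finset.mem_insert.1 hX with rfl | hX
          · exact hQ
          · exact (Finset.mem_singleton.1 hX) ▸ hQ'
        · rw [Finset.coe_pair]
          exact Set.nontrivial_pair hQQ'
        · rw [Finset.coe_pair]
          rintro X (rfl | rfl) Y (rfl | rfl) hne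
          exacts [absurd rfl hne, h, h.symm, absurd rfl hne]
        · refine ⟨?_, _, h𝓑.union _ (lift_mem h𝓑 hQc) _ (lift_mem h𝓑 hQc') hnd, ?_⟩
          · simpa using Or.inl hQc.1
          · rw [Finset.union_sdiff_distrib, lift_sdiff h𝓑 hQc, lift_sdiff h𝓑 hQc']
            simp
    · obtain ⟨i, hi⟩ := Set.mem_iUnion.1 hC
      exact Or.inr (key Q hQ i C hi)
    · obtain ⟨i, hi⟩ := Set.mem_iUnion.1 hB
      rcases key Q' hQ' i B hi with h | h
      · exact Or.inl h
      · exact Or.inr (Or.inr h.symm)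
    · obtain ⟨i, hi⟩ := Set.mem_iUnion.1 hB
      obtain ⟨j, hj⟩ := Set.mem_iUnion.1 hC
      by_cases hij : i = j
      · subst hij
        exact (hSᵢ i).comparable B hi C hj
      · exact Or.inr (Or.inr ((hA.disjoint i j hij).mono ((hSᵢ i).subset hi).2
          ((hSᵢ j).subset hj).2))
  sup_notMem T hT hnt hd hU := by
    classical
    set D := total A with hD
    have hsubD : ∀ i, ∀ B ∈ Sᵢ i, B ⊆ D := fun i B hB =>
      ((hSᵢ i).subset hB).2.trans (subset_total A i)
    set T₀ := Finset.univ.filter fun Q => Q ∈ S₀ ∧ lift 𝓑 D Q ∈ T with hT₀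
    have hT₀m : ∀ Q ∈ T₀, Q ∈ S₀ ∧ lift 𝓑 D Q ∈ T := fun Q hQ => (Finset.mem_filter.1 hQ).2
    have hTcase : ∀ B ∈ T, (∃ Q ∈ T₀, lift 𝓑 D Q = B) ∨ ∃ i, B ∈ Sᵢ i := by
      intro B hB
      rcases hT hB with ⟨Q, hQ, rfl⟩ | h
      · exact Or.inl ⟨Q, Finset.mem_filter.2 ⟨Finset.mem_univ _, hQ, hB⟩, rfl⟩
      · exact Or.inr (Set.mem_iUnion.1 h)
    have hUD : T.sup id \ D = T₀.sup id := by
      ext x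
      simp only [Finset.mem_sdiff, Finset.mem_sup, id]
      constructor
      · rintro ⟨⟨B, hB, hx⟩, hxD⟩
        rcases hTcase B hB with ⟨Q, hQ, rfl⟩ | ⟨i, hi⟩
        · refine ⟨Q, hQ, ?_⟩
          rw [← lift_sdiff h𝓑 (hS₀.subset (hT₀m Q hQ).1)]
          exact Finset.mem_sdiff.2 ⟨hx, hxD⟩
        · exact absurd (hsubD i B hi hx) hxD
      · rintro ⟨Q, hQ, hx⟩
        rw [← lift_sdiff h𝓑 (hS₀.subset (hT₀m Q hQ).1)] at hx
        obtain ⟨h1, h2⟩ := Finset.mem_sdiff.1 hx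
        exact ⟨⟨_, (hT₀m Q hQ).2, h1⟩, h2⟩
    -- Without lifted members the union lies in `D`, hence in one `A i`, and the family is nested
    -- there. With lifted members, nestedness in the contraction leaves only one; its lift then
    -- contains the whole union, so another disjoint member would be empty.
    rcases T₀.eq_empty_or_nonempty with he | ⟨Q, hQ⟩
    · rw [he, Finset.sup_empty] at hUD
      obtain ⟨i, hi⟩ := hA.subset _ hU (Finset.sdiff_eq_empty_iff_subset.1 hUD)
      refine (hSᵢ i).sup_notMem T (fun B hB => ?_) hnt hd ⟨hU, hi⟩
      rcases hTcase B hB with ⟨Q, hQ, -⟩ | ⟨j, hj⟩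
      · simp [he] at hQ
      · have hBi : B ⊆ A i := (Finset.le_sup (f := id) hB).trans hi
        have hBj := ((hSᵢ j).subset hj)
        by_cases hij : j = i
        · exact hij ▸ hj
        · exact absurd (Finset.disjoint_self_iff_empty _ |>.1
            ((hA.disjoint j i hij).mono hBj.2 hBi)) (h𝓑.nonempty B hBj.1).ne_empty
    · have hQ' := hT₀m Q hQ
      have hQc := hS₀.subset hQ'.1
      have hT₀d : (T₀ : Set (Finset ι)).PairwiseDisjoint id := fun X hX Y hY hXY => by
        have hX' := hT₀m X hX
        have hY' := hT₀m Y hY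
        exact Disjoint.mono (Permutonestohedron.subset_lift h𝓑 (hS₀.subset hX'.1))
          (Permutonestohedron.subset_lift h𝓑 (hS₀.subset hY'.1))
          (hd hX'.2 hY'.2 fun h => hXY (lift_injOn h𝓑 (hS₀.subset hX'.1) (hS₀.subset hY'.1) h))
      have hc : T₀.sup id ∈ contr 𝓑 D := by
        refine ⟨?_, _, hU, hUD⟩
        exact hQc.1.mono (Finset.le_sup (f := id) hQ)
      by_cases hnt₀ : (T₀ : Set (Finset ι)).Nontrivial
      · exact hS₀.sup_notMem T₀ (fun X hX => (hT₀m X hX).1) hnt₀ hT₀d hc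
      · have hT₀Q : T₀ = {Q} := by
          rw [← Finset.coe_eq_singleton]
          exact (Set.not_nontrivial_iff.1 hnt₀).eq_singleton_of_mem (by simpa using hQ)
        rw [hT₀Q, Finset.sup_singleton, id] at hUD
        have hUL : T.sup id ⊆ lift 𝓑 D Q := by
          refine subset_lift_of_not_disjoint h𝓑 hQc hU ?_ hUD.le
          obtain ⟨x, hx⟩ := hQc.1
          exact Finset.not_disjoint_iff.2 ⟨x, Finset.sdiff_subset (hUD.symm ▸ hx),
            Permutonestohedron.subset_lift h𝓑 hQc hx⟩
        obtain ⟨B, hB, hBne⟩ := hnt.exists_ne (lift 𝓑 D Q)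
        have hB𝓑 : B.Nonempty := by
          rcases hTcase B hB with ⟨X, hX, rfl⟩ | ⟨j, hj⟩
          · exact h𝓑.nonempty _ (lift_mem h𝓑 (hS₀.subset (hT₀m X hX).1))
          · exact h𝓑.nonempty _ ((hSᵢ j).subset hj).1
        have h1 : B ⊆ lift 𝓑 D Q := (Finset.le_sup (f := id) hB).trans hUL
        exact hB𝓑.ne_empty (Finset.disjoint_self_iff_empty _ |>.1
          ((hd hB hQ'.2 hBne).mono_right h1))

theorem IsCut.mem_glue_lift {S₀ : Set (Finset ι)} (hS₀ : S₀ ⊆ contr 𝓑 (total A))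
    {Sᵢ : κ → Set (Finset ι)} (hSᵢ : ∀ i, Sᵢ i ⊆ restr 𝓑 (A i)) {Q : Finset ι}
    (hQ : Q ∈ contr 𝓑 (total A)) :
    lift 𝓑 (total A) Q ∈ lift 𝓑 (total A) '' S₀ ∪ ⋃ i, Sᵢ i ↔ Q ∈ S₀ := by
  constructor
  · rintro (⟨Q', hQ', h⟩ | h)
    · exact lift_injOn h𝓑 (hS₀ hQ') hQ h ▸ hQ'
    · obtain ⟨i, hi⟩ := Set.mem_iUnion.1 h
      exact absurd ((hSᵢ i hi).2.trans (subset_total A i)) (lift_not_subset h𝓑 hQ)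
  · exact fun h => Or.inl ⟨Q, h, rfl⟩

theorem IsCut.mem_glue_restr {S₀ : Set (Finset ι)} (hS₀ : S₀ ⊆ contr 𝓑 (total A))
    {Sᵢ : κ → Set (Finset ι)} (hSᵢ : ∀ i, Sᵢ i ⊆ restr 𝓑 (A i)) {i : κ} {B : Finset ι}
    (hB : B ⊆ A i) :
    B ∈ lift 𝓑 (total A) '' S₀ ∪ ⋃ i, Sᵢ i ↔ B ∈ Sᵢ i := by
  constructor
  · rintro (⟨Q, hQ, rfl⟩ | h)
    · exact absurd (hB.trans (subset_total A i)) (lift_not_subset h𝓑 (hS₀ hQ))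
    · obtain ⟨j, hj⟩ := Set.mem_iUnion.1 h
      by_cases hij : j = i
      · exact hij ▸ hj
      · exact absurd (Finset.disjoint_self_iff_empty _ |>.1
            ((hA.disjoint j i hij).mono (hSᵢ j hj).2 hB)) (h𝓑.nonempty B (hSᵢ j hj).1).ne_empty
  · exact fun h => Or.inr (Set.mem_iUnion.2 ⟨i, h⟩)

/-! #### Components and the cut -/

/-- The condition that `B` imposes on a cell splits into one on the contraction and one for each `A
i`. Components inside `D` lie in a single `A i`, and if `A i ⊆ B` that component is `A i` itself,
which imposes nothing. The nested set `S` containing the components ensures that those not inside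
`D` are recovered from the contraction. -/
theorem IsCut.comps_subset_iff [DecidableEq κ] {S' : Set (Finset ι)} (hS : CNested 𝓑 S)
    (hAS : ∀ i, A i ∈ S)
    (hAS' : ∀ i, A i ∈ S') {B : Finset ι} (hB : ∀ K ∈ comps 𝓑 B, K ∈ S) :
    (∀ K ∈ comps 𝓑 B, K ∈ S') ↔
      (∀ K ∈ comps 𝓑 B, ¬ K ⊆ total A → lift 𝓑 (total A) (K \ total A) ∈ S') ∧
        ∀ i, ¬ A i ⊆ B → ∀ K ∈ comps 𝓑 (B ∩ A i), K ∈ S' := by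
  constructor
  · intro h
    refine ⟨fun K hK hKD => ?_, fun i hi K hK => h K ?_⟩
    · rw [hA.lift_sdiff_eq h𝓑 hS hAS (hB K hK) hKD]
      exact h K hK
    · obtain ⟨K', hK', hKK'⟩ := exists_mem_comps_superset (mem_of_mem_comps hK)
        ((subset_of_mem_comps hK).trans Finset.inter_subset_left)
      rcases hS.comparable K' (hB K' hK') _ (hAS i) with h1 | h1 | h1
      · have : K = K' := (mem_comps.1 hK).eq_of_le ⟨mem_of_mem_comps hK',
          Finset.subset_inter (subset_of_mem_comps hK') h1⟩ hKK'
        exact this ▸ hK'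
      · exact absurd (h1.trans (subset_of_mem_comps hK')) hi
      · obtain ⟨x, hx⟩ := h𝓑.nonempty K (mem_of_mem_comps hK)
        exact absurd (Finset.mem_inter.1 (subset_of_mem_comps hK hx)).2
          (Finset.disjoint_left.1 h1 (hKK' hx))
  · rintro ⟨h1, h2⟩ K hK
    by_cases hKD : K ⊆ total A
    · obtain ⟨i, hi⟩ := hA.subset K (mem_of_mem_comps hK) hKD
      by_cases hiB : A i ⊆ B
      · have : K = A i := (mem_comps.1 hK).eq_of_le ⟨hA.mem i, hiB⟩ hi
        exact this ▸ hAS' i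
      · refine h2 i hiB K (mem_comps.2 ⟨⟨mem_of_mem_comps hK,
          Finset.subset_inter (subset_of_mem_comps hK) hi⟩, fun X hX hKX => ?_⟩)
        exact (mem_comps.1 hK).le_of_ge ⟨hX.1, hX.2.trans Finset.inter_subset_left⟩ hKX
    · have := h1 K hK hKD
      rwa [hA.lift_sdiff_eq h𝓑 hS hAS (hB K hK) hKD] at this

/-- Filling up with the other `A j` only adds these as components, and they always belong to `S`. A
condition inside `A i` thereby becomes one on the face. -/
theorem IsCut.comps_union_erase [DecidableEq κ] (hAS : ∀ i, A i ∈ S) {i : κ} {B : Finset ι}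
    (hB : B ⊆ A i) :
    (∀ K ∈ comps 𝓑 (B ∪ (Finset.univ.erase i).biUnion A), K ∈ S) ↔ ∀ K ∈ comps 𝓑 B, K ∈ S := by
  have hsub : ∀ K ∈ 𝓑, K ⊆ B ∪ (Finset.univ.erase i).biUnion A → K ⊆ B ∨ ∃ j ≠ i, K ⊆ A j := by
    intro K hK hKB
    obtain ⟨j, hj⟩ := hA.subset K hK (hKB.trans (Finset.union_subset
      (hB.trans (subset_total A i)) (Finset.biUnion_subset.2 fun j _ => subset_total A j)))
    by_cases hij : j = i
    · subst hij
      refine Or.inl fun x hx => (Finset.mem_union.1 (hKB hx)).resolve_right fun h => ?_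
      obtain ⟨l, hl, hxl⟩ := Finset.mem_biUnion.1 h
      exact Finset.disjoint_left.1 (hA.disjoint l j (Finset.ne_of_mem_erase hl)) hxl (hj hx)
    · exact Or.inr ⟨j, hij, hj⟩
  constructor
  · intro h K hK
    refine h K (mem_comps.2 ⟨⟨mem_of_mem_comps hK, (subset_of_mem_comps hK).trans
      Finset.subset_union_left⟩, fun X hX hKX => ?_⟩)
    rcases hsub X hX.1 hX.2 with h1 | ⟨j, hj, h1⟩
    · exact (mem_comps.1 hK).le_of_ge ⟨hX.1, h1⟩ hKX
    · obtain ⟨x, hx⟩ := h𝓑.nonempty K (mem_of_mem_comps hK)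
      exact absurd (hB (subset_of_mem_comps hK hx))
        (Finset.disjoint_left.1 (hA.disjoint j i hj) (h1 (hKX hx)))
  · intro h K hK
    rcases hsub K (mem_of_mem_comps hK) (subset_of_mem_comps hK) with h1 | ⟨j, hj, h1⟩
    · refine h K (mem_comps.2 ⟨⟨mem_of_mem_comps hK, h1⟩, fun X hX hKX => ?_⟩)
      exact (mem_comps.1 hK).le_of_ge ⟨hX.1, hX.2.trans Finset.subset_union_left⟩ hKX
    · have : K = A j := (mem_comps.1 hK).eq_of_le ⟨hA.mem j, fun x hx => Finset.mem_union_right _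
        (Finset.mem_biUnion.2 ⟨j, by simpa using hj, hx⟩)⟩ h1
      exact this ▸ hAS j

/-- One component is the lift of `Q`; any other component is disjoint from it, hence inside `D` and
equal to one of the `A i`. -/
theorem IsCut.comps_union_total (hAS : ∀ i, A i ∈ S) {Q : Finset ι}
    (hQ : Q ∈ contr 𝓑 (total A)) :
    (∀ K ∈ comps 𝓑 (Q ∪ total A), K ∈ S) ↔ lift 𝓑 (total A) Q ∈ S := by
  have hlift : lift 𝓑 (total A) Q ⊆ Q ∪ total A := fun x hx => by
    by_cases hxD : x ∈ total A
    · exact Finset.mem_union_right _ hxD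
    · exact Finset.mem_union_left _ (lift_sdiff h𝓑 hQ ▸ Finset.mem_sdiff.2 ⟨hx, hxD⟩)
  have hsd : ∀ K ⊆ Q ∪ total A, K \ total A ⊆ Q := fun K hK x hx => by
    obtain ⟨h1, h2⟩ := Finset.mem_sdiff.1 hx
    exact (Finset.mem_union.1 (hK h1)).resolve_right h2
  constructor
  · intro h
    refine h _ (mem_comps.2 ⟨⟨lift_mem h𝓑 hQ, hlift⟩, fun X hX hKX => ?_⟩)
    refine subset_lift_of_not_disjoint h𝓑 hQ hX.1 ?_ (hsd X hX.2)
    obtain ⟨x, hx⟩ := hQ.1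
    exact Finset.not_disjoint_iff.2 ⟨x, hKX (Permutonestohedron.subset_lift h𝓑 hQ hx),
      Permutonestohedron.subset_lift h𝓑 hQ hx⟩
  · intro h K hK
    by_cases hd : Disjoint K (lift 𝓑 (total A) Q)
    · have hKD : K ⊆ total A := fun x hx => (Finset.mem_union.1
        (subset_of_mem_comps hK hx)).resolve_left fun hxQ =>
          Finset.disjoint_left.1 hd hx (Permutonestohedron.subset_lift h𝓑 hQ hxQ)
      obtain ⟨i, hi⟩ := hA.subset K (mem_of_mem_comps hK) hKD
      have : K = A i := (mem_comps.1 hK).eq_of_le ⟨hA.mem i,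
        (subset_total A i).trans Finset.subset_union_right⟩ hi
      exact this ▸ hAS i
    · have h1 := subset_lift_of_not_disjoint h𝓑 hQ (mem_of_mem_comps hK) hd
        (hsd K (subset_of_mem_comps hK))
      have : K = lift 𝓑 (total A) Q := (mem_comps.1 hK).eq_of_le ⟨lift_mem h𝓑 hQ, hlift⟩ h1
      exact this ▸ h

theorem IsCut.comps_total : (∀ K ∈ comps 𝓑 (total A), K ∈ Set.range A) ∧
    ∀ i, A i ∈ comps 𝓑 (total A) := by
  have h2 : ∀ i, A i ∈ comps 𝓑 (total A) := fun i => mem_comps.2 ⟨⟨hA.mem i, subset_total A i⟩,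
    fun X hX hiX => by
      obtain ⟨j, hj⟩ := hA.subset X hX.1 hX.2
      by_cases hij : i = j
      · exact hij ▸ hj
      · exact absurd (Finset.disjoint_self_iff_empty _ |>.1
          ((hA.disjoint i j hij).mono_right (hiX.trans hj))) (h𝓑.nonempty _ (hA.mem i)).ne_empty⟩
  refine ⟨fun K hK => ?_, h2⟩
  obtain ⟨j, hj⟩ := hA.subset K (mem_of_mem_comps hK) (subset_of_mem_comps hK)
  exact ⟨j, ((mem_comps.1 hK).eq_of_le ⟨hA.mem j, subset_total A j⟩ hj).symm⟩

end Cut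

end Contraction

/-! ### Transport of nested sets along an injection -/

section Transport

variable {ι ι' : Type*} [Fintype ι] [DecidableEq ι] [Fintype ι'] [DecidableEq ι'] (f : ι' ↪ ι)

theorem sup_map_mapEmbedding (T : Finset (Finset ι')) :
    (T.map (Finset.mapEmbedding f).toEmbedding).sup id = (T.sup id).map f := by
  ext x
  simp only [Finset.mem_sup, Finset.mem_map, id, RelEmbedding.coe_toEmbedding,
    Finset.mapEmbedding_apply]
  constructor
  · rintro ⟨_, ⟨B, hB, rfl⟩, hx⟩
    obtain ⟨y, hy, rfl⟩ := Finset.mem_map.1 hx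
    exact ⟨y, ⟨B, hB, hy⟩, rfl⟩
  · rintro ⟨y, ⟨B, hB, hy⟩, rfl⟩
    exact ⟨_, ⟨B, hB, rfl⟩, Finset.mem_map_of_mem f hy⟩

theorem cnested_preimage_map {𝓑 S : Set (Finset ι)} (h : CNested 𝓑 S) :
    CNested {B : Finset ι' | B.map f ∈ 𝓑} {B | B.map f ∈ S} where
  subset _ hB := h.subset hB
  comparable B hB C hC := by
    simpa [Finset.map_subset_map] using h.comparable _ hB _ hC
  sup_notMem T hT hnt hd hU := by
    refine h.sup_notMem (T.map (Finset.mapEmbedding f).toEmbedding) ?_ ?_ ?_ ?_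
    · intro B hB
      obtain ⟨C, hC, rfl⟩ := Finset.mem_map.1 hB
      exact hT hC
    · rw [Finset.coe_map]
      exact hnt.image (Finset.mapEmbedding f).injective
    · rw [Finset.coe_map]
      rintro _ ⟨B, hB, rfl⟩ _ ⟨C, hC, rfl⟩ hne
      exact (Finset.disjoint_map f).2 (hd hB hC fun h => hne (h ▸ rfl))
    · rw [sup_map_mapEmbedding]
      exact hU

theorem cnested_image_map {𝓑 : Set (Finset ι)} {S : Set (Finset ι')}
    (h : CNested {B : Finset ι' | B.map f ∈ 𝓑} S) : CNested 𝓑 (Finset.map f '' S) where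
  subset := by
    rintro _ ⟨B, hB, rfl⟩
    exact h.subset hB
  comparable := by
    rintro _ ⟨B, hB, rfl⟩ _ ⟨C, hC, rfl⟩
    simpa [Finset.map_subset_map] using h.comparable _ hB _ hC
  sup_notMem T hT hnt hd hU := by
    obtain ⟨T, rfl⟩ : ∃ T' : Finset (Finset ι'), T = T'.map (Finset.mapEmbedding f).toEmbedding := by
      refine ⟨Finset.univ.filter (fun B => B.map f ∈ T), ?_⟩
      ext B
      simp only [Finset.mem_map, Finset.mem_filter, Finset.mem_univ, true_and,
        RelEmbedding.coe_toEmbedding, Finset.mapEmbedding_apply]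
      constructor
      · intro hB
        obtain ⟨C, -, rfl⟩ := hT hB
        exact ⟨C, hB, rfl⟩
      · rintro ⟨C, hC, rfl⟩
        exact hC
    rw [sup_map_mapEmbedding] at hU
    rw [Finset.coe_map] at hnt hd hT
    refine h.sup_notMem T (fun B hB => ?_) ?_ (fun B hB C hC hne => ?_) hU
    · obtain ⟨C, hC, hCB⟩ := hT ⟨B, hB, rfl⟩
      exact Finset.map_injective f hCB ▸ hC
    · exact Set.nontrivial_of_image _ _ hnt
    · exact (Finset.disjoint_map f).1
        (hd ⟨B, hB, rfl⟩ ⟨C, hC, rfl⟩ fun h => hne (Finset.map_injective f h))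

theorem mem_comps_map {𝓑 : Set (Finset ι)} {B K : Finset ι'} :
    K.map f ∈ comps 𝓑 (B.map f) ↔ K ∈ comps {B : Finset ι' | B.map f ∈ 𝓑} B := by
  rw [mem_comps, mem_comps]
  constructor
  · intro h
    refine ⟨⟨h.prop.1, Finset.map_subset_map.1 h.prop.2⟩, fun X hX hKX => ?_⟩
    exact Finset.map_subset_map.1 (h.le_of_ge ⟨hX.1, Finset.map_subset_map.2 hX.2⟩
      (Finset.map_subset_map.2 hKX))
  · intro h
    refine ⟨⟨h.prop.1, Finset.map_subset_map.2 h.prop.2⟩, fun X hX hKX => ?_⟩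
    obtain ⟨Y, hY, rfl⟩ := Finset.subset_map_iff.1 hX.2
    exact Finset.map_subset_map.2 (h.le_of_ge ⟨hX.1, hY⟩ (Finset.map_subset_map.1 hKX))

theorem forall_mem_comps_map {𝓑 : Set (Finset ι)} {B : Finset ι'} {p : Finset ι → Prop} :
    (∀ K ∈ comps 𝓑 (B.map f), p K) ↔ ∀ K ∈ comps {B : Finset ι' | B.map f ∈ 𝓑} B, p (K.map f) := by
  constructor
  · exact fun h K hK => h _ ((mem_comps_map f).2 hK)
  · intro h K hK
    obtain ⟨K, -, rfl⟩ := Finset.subset_map_iff.1 (subset_of_mem_comps hK)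
    exact h K ((mem_comps_map f).1 hK)

end Transport

end Permutonestohedron

namespace Permutonestohedron

set_option linter.unusedSectionVars false

open scoped InnerProductSpace NNReal
open Module (Basis)

/-! ### Root systems and their reflection groups -/

section RootTheory

variable {V : Type*} [NormedAddCommGroup V] [InnerProductSpace ℝ V]
  {ι : Type*} [Fintype ι] [DecidableEq ι]

theorem refl_apply (α x : V) :
    (ℝ ∙ α)ᗮ.reflection x = x - (2 * ⟪α, x⟫_ℝ / ⟪α, α⟫_ℝ) • α := by
  rw [Submodule.reflection_orthogonal_apply, Submodule.reflection_singleton_apply,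
    real_inner_self_eq_norm_sq]
  simp only [RCLike.ofReal_real_eq_id, id]
  module

theorem refl_map (u : V ≃ₗᵢ[ℝ] V) (α : V) :
    (ℝ ∙ u α)ᗮ.reflection = u * (ℝ ∙ α)ᗮ.reflection * u⁻¹ := by
  ext x
  have h : ⟪u α, x⟫_ℝ = ⟪α, u⁻¹ x⟫_ℝ := by
    rw [← u.inner_map_map α (u⁻¹ x)]
    congr 1
    exact (u.apply_symm_apply x).symm
  change _ = u ((ℝ ∙ α)ᗮ.reflection (u⁻¹ x))
  rw [refl_apply, refl_apply, map_sub, map_smul, h, u.inner_map_map]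
  congr 1
  exact (u.apply_symm_apply x).symm

theorem refl_neg (α : V) : (ℝ ∙ (-α))ᗮ.reflection = (ℝ ∙ α)ᗮ.reflection := by
  ext x
  rw [refl_apply, refl_apply, inner_neg_left, inner_neg_neg, mul_neg, neg_div, neg_smul_neg]

theorem refl_self (α : V) : (ℝ ∙ α)ᗮ.reflection α = -α :=
  Submodule.reflection_orthogonalComplement_singleton_eq_neg α

theorem refl_mul_self (α : V) :
    ((ℝ ∙ α)ᗮ.reflection : V ≃ₗᵢ[ℝ] V) * (ℝ ∙ α)ᗮ.reflection = 1 := by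
  ext x
  change (ℝ ∙ α)ᗮ.reflection ((ℝ ∙ α)ᗮ.reflection x) = x
  exact Submodule.reflection_reflection _ x

/-- `b` is a base of the root system `Φ`: it consists of simple roots. -/
structure IsBase (Φ : Set V) (b : Basis ι ℝ V) : Prop where
  root : IsRootSystem Φ
  mem : ∀ i, b i ∈ Φ
  sign : ∀ α ∈ Φ, (∀ i, 0 ≤ b.repr α i) ∨ (∀ i, b.repr α i ≤ 0)

theorem mem_span_nnreal_range_iff (b : Basis ι ℝ V) (x : V) :
    x ∈ Submodule.span ℝ≥0 (Set.range b) ↔ ∀ i, 0 ≤ b.repr x i := by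
  rw [Submodule.mem_span_range_iff_exists_fun]
  constructor
  · rintro ⟨c, rfl⟩ i
    have : ∑ i, c i • b i = ∑ i, (c i : ℝ) • b i := rfl
    rw [this, b.repr_sum_self]
    exact (c i).2
  · intro h
    refine ⟨fun i => ⟨b.repr x i, h i⟩, ?_⟩
    conv_rhs => rw [← b.sum_repr x]
    rfl

theorem repr_eq_of_refl (b : Basis ι ℝ V) (i j : ι) (x : V) (hij : j ≠ i) :
    b.repr ((ℝ ∙ b i)ᗮ.reflection x) j = b.repr x j := by
  rw [refl_apply]
  simp [hij.symm]

theorem inner_eq_sum_repr (b : Basis ι ℝ V) (x y : V) :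
    ⟪x, y⟫_ℝ = ∑ i, b.repr y i * ⟪b i, x⟫_ℝ := by
  conv_lhs => rw [← b.sum_repr y]
  rw [inner_sum]
  exact Finset.sum_congr rfl fun i _ => by rw [inner_smul_right, real_inner_comm]

/-- The element of the reflection group given by a word in the simple reflections. -/
noncomputable def wordProd (b : Basis ι ℝ V) (l : List ι) : V ≃ₗᵢ[ℝ] V :=
  (l.map fun i => (ℝ ∙ b i)ᗮ.reflection).prod

namespace IsBase

variable {Φ : Set V} {b : Basis ι ℝ V} (hb : IsBase Φ b)

include hb

theorem ne_zero {α : V} (hα : α ∈ Φ) : α ≠ 0 := fun h => hb.root.zero_notMem (h ▸ hα)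

theorem neg_mem {α : V} (hα : α ∈ Φ) : -α ∈ Φ := by
  have := hb.root.reflection_mem α hα α hα
  rwa [refl_self] at this

theorem inner_self_pos (i : ι) : 0 < ⟪b i, b i⟫_ℝ :=
  real_inner_self_pos.2 (hb.ne_zero (hb.mem i))

/-- The reflection of `b j` in `b i` is a root with coefficient `1` at `b j`, so its coefficient at
`b i` cannot be negative. -/
theorem inner_nonpos {i j : ι} (hij : i ≠ j) : ⟪b i, b j⟫_ℝ ≤ 0 := by
  have h1 := hb.root.reflection_mem _ (hb.mem i) _ (hb.mem j)
  have h2 : b.repr ((ℝ ∙ b i)ᗮ.reflection (b j)) j = 1 := by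
    rw [repr_eq_of_refl b i j _ hij.symm]
    simp
  have h3 : b.repr ((ℝ ∙ b i)ᗮ.reflection (b j)) i = -(2 * ⟪b i, b j⟫_ℝ / ⟪b i, b i⟫_ℝ) := by
    rw [refl_apply]
    simp [hij.symm]
  rcases hb.sign _ h1 with h | h
  · have h4 := h i
    rw [h3, neg_nonneg] at h4
    by_contra! h5
    exact absurd h4 (not_le.2 (div_pos (by linarith) (hb.inner_self_pos i)))
  · have := h j
    rw [h2] at this
    linarith

/-- A simple reflection permutes the positive roots other than the simple root. -/
theorem refl_pos {i : ι} {α : V} (hα : α ∈ Φ) (hpos : ∀ j, 0 ≤ b.repr α j) (hne : α ≠ b i) (j : ι) :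
    0 ≤ b.repr ((ℝ ∙ b i)ᗮ.reflection α) j := by
  have hex : ∃ k, k ≠ i ∧ 0 < b.repr α k := by
    by_contra! h
    have h0 : ∀ k, k ≠ i → b.repr α k = 0 := fun k hk => le_antisymm (h k hk) (hpos k)
    have hαi : α = b.repr α i • b i := by
      conv_lhs => rw [← b.sum_repr α]
      exact Finset.sum_eq_single i (fun k _ hk => by rw [h0 k hk, zero_smul]) (by simp)
    rcases hb.root.reduced _ (hb.mem i) (b.repr α i) (hαi ▸ hα) with h1 | h1
    · rw [h1, one_smul] at hαi
      exact hne hαi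
    · have := hpos i
      rw [h1] at this
      linarith
  obtain ⟨k, hk, hkpos⟩ := hex
  rcases hb.sign _ (hb.root.reflection_mem _ (hb.mem i) _ hα) with h | h
  · exact h j
  · have := h k
    rw [repr_eq_of_refl b i k _ hk] at this
    exact absurd this (not_le.2 hkpos)

theorem mem_positiveRoots {α : V} :
    α ∈ positiveRoots Φ (Set.range b) ↔ α ∈ Φ ∧ ∀ i, 0 ≤ b.repr α i :=
  and_congr_right fun _ => mem_span_nnreal_range_iff b α

/-- The scalar product of `δ` with a simple root. -/
theorem inner_delta (i : ι) : ⟪b i, delta Φ (Set.range b)⟫_ℝ = ⟪b i, b i⟫_ℝ / 2 := by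
  classical
  have hfin : (positiveRoots Φ (Set.range b)).Finite := hb.root.finite.subset fun _ h => h.1
  set P := hfin.toFinset with hP
  have hmem : ∀ {α}, α ∈ P ↔ α ∈ Φ ∧ ∀ i, 0 ≤ b.repr α i := by
    intro α
    rw [hP, Set.Finite.mem_toFinset, hb.mem_positiveRoots]
  have hδ : delta Φ (Set.range b) = (1 / 2 : ℝ) • ∑ α ∈ P, α := by
    rw [delta, finsum_mem_eq_finite_toFinset_sum _ hfin]
  have hbi : b i ∈ P := hmem.2 ⟨hb.mem i, fun j => by
    rw [b.repr_self, Finsupp.single_apply]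
    split_ifs <;> norm_num⟩
  have hmaps : ∀ α ∈ P.erase (b i), (ℝ ∙ b i)ᗮ.reflection α ∈ P.erase (b i) := by
    intro α hα
    obtain ⟨hne, hα⟩ := Finset.mem_erase.1 hα
    obtain ⟨h1, h2⟩ := hmem.1 hα
    refine Finset.mem_erase.2 ⟨fun h => ?_, hmem.2 ⟨hb.root.reflection_mem _ (hb.mem i) _ h1,
      hb.refl_pos h1 h2 hne⟩⟩
    have h3 : α = -b i := by
      have h4 := congrArg (ℝ ∙ b i)ᗮ.reflection h
      rwa [Submodule.reflection_reflection, refl_self] at h4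
    have := h2 i
    rw [h3] at this
    simp at this
    linarith
  -- The simple reflection permutes the other positive roots, so their sum is orthogonal to `b i`
  -- and only half of `b i` contributes to the product.
  have hR : (ℝ ∙ b i)ᗮ.reflection (∑ α ∈ P.erase (b i), α) = ∑ α ∈ P.erase (b i), α := by
    rw [map_sum]
    exact Finset.sum_nbij' (fun α => (ℝ ∙ b i)ᗮ.reflection α) (fun α => (ℝ ∙ b i)ᗮ.reflection α)
      hmaps hmaps (fun α _ => Submodule.reflection_reflection _ _)
      (fun α _ => Submodule.reflection_reflection _ _) (fun α _ => rfl)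
  have h0 : ⟪b i, ∑ α ∈ P.erase (b i), α⟫_ℝ = 0 := by
    have h1 : ⟪(ℝ ∙ b i)ᗮ.reflection (b i), (ℝ ∙ b i)ᗮ.reflection (∑ α ∈ P.erase (b i), α)⟫_ℝ =
      ⟪b i, ∑ α ∈ P.erase (b i), α⟫_ℝ := LinearIsometryEquiv.inner_map_map _ _ _
    rw [hR, refl_self, inner_neg_left] at h1
    linarith
  rw [hδ, ← Finset.add_sum_erase _ _ hbi, inner_smul_right, inner_add_right, h0]
  ring

theorem inner_delta_pos (i : ι) : 0 < ⟪b i, delta Φ (Set.range b)⟫_ℝ := by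
  rw [hb.inner_delta i]
  exact half_pos (hb.inner_self_pos i)

theorem inner_delta_pos_of_pos {α : V} (hα : α ∈ Φ) (hpos : ∀ j, 0 ≤ b.repr α j) :
    0 < ⟪α, delta Φ (Set.range b)⟫_ℝ := by
  rw [real_inner_comm, inner_eq_sum_repr b]
  obtain ⟨j, hj⟩ : ∃ j, b.repr α j ≠ 0 := by
    by_contra! h
    exact hb.ne_zero hα (b.repr.map_eq_zero_iff.1 (Finsupp.ext h))
  exact Finset.sum_pos' (fun i _ => mul_nonneg (hpos i) (hb.inner_delta_pos i).le)
    ⟨j, Finset.mem_univ _, mul_pos (lt_of_le_of_ne (hpos j) hj.symm) (hb.inner_delta_pos j)⟩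

/-- A combination of some simple roots having positive products with them has positive
coefficients. -/
theorem repr_pos {B : Finset ι} {x : V} (hx : ∀ i, i ∉ B → b.repr x i = 0)
    (hpos : ∀ i ∈ B, 0 < ⟪b i, x⟫_ℝ) : ∀ i ∈ B, 0 < b.repr x i := by
  have hsum : ∀ y, (∑ i, b.repr y i • b i) = y := b.sum_repr
  -- `m` is the negative part of `x`. It has nonnegative product with `x`, but nonpositive product
  -- with the positive part `x + m`, because the supports are disjoint and distinct simple roots
  -- have nonpositive products. Hence `m = 0`.
  set m : V := ∑ i, max (-b.repr x i) 0 • b i with hm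
  have hmr : ∀ i, b.repr m i = max (-b.repr x i) 0 := fun i => by rw [hm, b.repr_sum_self]
  have hxm : 0 ≤ ⟪x, m⟫_ℝ := by
    rw [inner_eq_sum_repr b]
    refine Finset.sum_nonneg fun i _ => ?_
    by_cases hi : i ∈ B
    · exact mul_nonneg (hmr i ▸ le_max_right _ _) (hpos i hi).le
    · rw [hmr, hx i hi]
      simp
  have hp : ⟪x + m, m⟫_ℝ ≤ 0 := by
    rw [inner_eq_sum_repr b]
    refine Finset.sum_nonpos fun i _ => ?_
    rw [inner_eq_sum_repr b (b i), hmr, Finset.mul_sum]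
    refine Finset.sum_nonpos fun j _ => ?_
    rw [map_add, Finsupp.add_apply, hmr]
    have hpj : 0 ≤ b.repr x j + max (-b.repr x j) 0 := by
      rcases le_total 0 (b.repr x j) with h | h
      · rw [max_eq_right (by linarith)]
        linarith
      · rw [max_eq_left (by linarith)]
        linarith
    by_cases hij : j = i
    · subst hij
      have : max (-b.repr x j) 0 * (b.repr x j + max (-b.repr x j) 0) = 0 := by
        rcases le_total 0 (b.repr x j) with h | h
        · rw [max_eq_right (by linarith), zero_mul]
        · rw [max_eq_left (by linarith)]
          ring
      rw [← mul_assoc, this, zero_mul]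
    · exact mul_nonpos_of_nonneg_of_nonpos (le_max_right _ _)
        (mul_nonpos_of_nonneg_of_nonpos hpj (hb.inner_nonpos hij))
  have hm0 : m = 0 := by
    rw [inner_add_left] at hp
    exact real_inner_self_nonpos.1 (by linarith)
  have hnn : ∀ i, 0 ≤ b.repr x i := fun i => by
    have := hmr i
    rw [hm0, map_zero, Finsupp.zero_apply] at this
    have h2 := le_max_left (-b.repr x i) 0
    linarith
  intro i hi
  refine lt_of_le_of_ne (hnn i) fun h => ?_
  have h1 := hpos i hi
  rw [inner_eq_sum_repr b] at h1
  refine absurd h1 (not_lt.2 (Finset.sum_nonpos fun j _ => ?_))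
  by_cases hij : j = i
  · rw [hij, ← h, zero_mul]
  · exact mul_nonpos_of_nonneg_of_nonpos (hnn j) (hb.inner_nonpos hij)

/-! #### Words in the simple reflections -/

theorem weylGroup_map_mem {w : V ≃ₗᵢ[ℝ] V} (hw : w ∈ weylGroup Φ) : ∀ α ∈ Φ, w α ∈ Φ := by
  induction hw using Subgroup.closure_induction with
  | mem x hx =>
    obtain ⟨β, hβ, rfl⟩ := hx
    exact fun α hα => hb.root.reflection_mem β hβ α hα
  | one => exact fun α hα => hα
  | mul x y _ _ hx hy => exact fun α hα => hx _ (hy α hα)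
  | inv x _ hx =>
    intro α hα
    have himage : x '' Φ = Φ := Set.eq_of_subset_of_ncard_le (Set.image_subset_iff.2 hx)
      (Set.ncard_image_of_injective Φ x.injective).ge hb.root.finite
    rw [← himage] at hα
    obtain ⟨β, hβ, rfl⟩ := hα
    have : x⁻¹ (x β) = β := x.symm_apply_apply β
    rwa [this]

theorem finite_weylGroup : (weylGroup Φ : Set (V ≃ₗᵢ[ℝ] V)).Finite := by
  have := hb.root.finite.to_subtype
  have : Finite (weylGroup Φ) := by
    refine Finite.of_injective (β := ι → Φ)
      (fun w i => ⟨w.1 (b i), hb.weylGroup_map_mem w.2 _ (hb.mem i)⟩) fun w w' h => ?_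
    refine Subtype.ext (LinearIsometryEquiv.toLinearEquiv_injective (b.ext' fun i => ?_))
    exact congrArg Subtype.val (congrFun h i)
  exact Set.toFinite _

theorem exists_inner_pos {α : V} (hα : α ∈ Φ) (hpos : ∀ i, 0 ≤ b.repr α i) :
    ∃ i, 0 < ⟪b i, α⟫_ℝ := by
  by_contra! h
  have h1 : 0 < ⟪α, α⟫_ℝ := real_inner_self_pos.2 (hb.ne_zero hα)
  rw [inner_eq_sum_repr b] at h1
  exact absurd h1 (not_lt.2 (Finset.sum_nonpos fun i _ =>
    mul_nonpos_of_nonneg_of_nonpos (hpos i) (h i)))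

/-- Every positive root is the image of a simple root by a product of simple reflections. -/
theorem exists_word_apply_eq {α : V} (hα : α ∈ Φ) (hpos : ∀ i, 0 ≤ b.repr α i) :
    ∃ l i, wordProd b l (b i) = α := by
  set δ := delta Φ (Set.range b) with hδ
  -- The product with `δ` plays the role of the height, which makes sense without integrality; the
  -- induction is on the number of lower roots.
  induction h : {γ ∈ Φ | ⟪γ, δ⟫_ℝ < ⟪α, δ⟫_ℝ}.ncard using Nat.strong_induction_on
    generalizing α with
  | _ n ih =>
    obtain ⟨i, hi⟩ := hb.exists_inner_pos hα hpos
    by_cases hαi : α = b i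
    · exact ⟨[], i, hαi.symm⟩
    · have hlt : ⟪(ℝ ∙ b i)ᗮ.reflection α, δ⟫_ℝ < ⟪α, δ⟫_ℝ := by
        rw [refl_apply, inner_sub_left, inner_smul_left]
        have h1 := div_pos (mul_pos two_pos hi) (hb.inner_self_pos i)
        have h2 := mul_pos h1 (hb.inner_delta_pos i)
        simp only [conj_trivial]
        linarith
      have hmem := hb.root.reflection_mem _ (hb.mem i) _ hα
      obtain ⟨l, j, hl⟩ := ih _ (by
        rw [← h]
        refine Set.ncard_lt_ncard ?_ (hb.root.finite.subset fun _ h => h.1)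
        refine ⟨fun γ hγ => ⟨hγ.1, hγ.2.trans hlt⟩, fun hsub => ?_⟩
        exact lt_irrefl _ (hsub ⟨hmem, hlt⟩).2) hmem (hb.refl_pos hα hpos hαi) rfl
      refine ⟨i :: l, j, ?_⟩
      change (ℝ ∙ b i)ᗮ.reflection (wordProd b l (b j)) = α
      rw [hl, Submodule.reflection_reflection]

omit hb in
theorem wordProd_append (l l' : List ι) :
    wordProd b (l ++ l') = wordProd b l * wordProd b l' := by
  simp [wordProd]

omit hb in
theorem wordProd_reverse (l : List ι) : wordProd b l.reverse = (wordProd b l)⁻¹ := by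
  induction l with
  | nil => simp [wordProd]
  | cons i l ih =>
    have hcons : wordProd b (i :: l) = wordProd b [i] * wordProd b l := by simp [wordProd]
    rw [List.reverse_cons, wordProd_append, ih, hcons, mul_inv_rev]
    congr 1

/-- A reflection in a root is conjugate, by a word in the simple reflections, to a simple
reflection. -/
theorem exists_word {w : V ≃ₗᵢ[ℝ] V} (hw : w ∈ weylGroup Φ) : ∃ l, w = wordProd b l := by
  induction hw using Subgroup.closure_induction with
  | mem x hx =>
    obtain ⟨β, hβ, rfl⟩ := hx
    have key : ∀ α ∈ Φ, (∀ i, 0 ≤ b.repr α i) → ∃ l, (ℝ ∙ α)ᗮ.reflection = wordProd b l := by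
      intro α hα hpos
      obtain ⟨l, i, rfl⟩ := hb.exists_word_apply_eq hα hpos
      refine ⟨l ++ [i] ++ l.reverse, ?_⟩
      rw [refl_map, wordProd_append, wordProd_append, wordProd_reverse]
      simp [wordProd]
    rcases hb.sign β hβ with h | h
    · exact key β hβ h
    · rw [← refl_neg]
      exact key _ (hb.neg_mem hβ) fun i => by simpa using h i
  | one => exact ⟨[], rfl⟩
  | mul x y _ _ hx hy =>
    obtain ⟨l, rfl⟩ := hx
    obtain ⟨l', rfl⟩ := hy
    exact ⟨l ++ l', (wordProd_append l l').symm⟩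
  | inv x _ hx =>
    obtain ⟨l, rfl⟩ := hx
    exact ⟨l.reverse, (wordProd_reverse l).symm⟩

theorem wordProd_mem (l : List ι) : wordProd b l ∈ weylGroup Φ := by
  refine Subgroup.list_prod_mem _ fun x hx => ?_
  obtain ⟨i, -, rfl⟩ := List.mem_map.1 hx
  exact Subgroup.subset_closure ⟨b i, hb.mem i, rfl⟩

/-- The deletion property. -/
theorem exists_word_mul_refl (l : List ι) {α : V} (hα : α ∈ Φ) (hpos : ∀ i, 0 ≤ b.repr α i)
    (hneg : ¬ ∀ i, 0 ≤ b.repr (wordProd b l α) i) :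
    ∃ l', l'.length + 1 = l.length ∧ wordProd b l' = wordProd b l * (ℝ ∙ α)ᗮ.reflection := by
  induction l with
  | nil => exact absurd hpos hneg
  | cons i l ih =>
    have hcons : ∀ m, wordProd b (i :: m) = (ℝ ∙ b i)ᗮ.reflection * wordProd b m := fun m => by
      simp [wordProd]
    by_cases h : ∀ i, 0 ≤ b.repr (wordProd b l α) i
    · have hmem := hb.weylGroup_map_mem (hb.wordProd_mem l) α hα
      -- A simple reflection makes only one positive root negative, its own. The corresponding
      -- letter can therefore be omitted at the cost of a factor on the right.
      have heq : wordProd b l α = b i := by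
        by_contra hne
        exact hneg (hb.refl_pos hmem h hne)
      refine ⟨l, rfl, ?_⟩
      rw [hcons, ← heq, refl_map]
      simp only [mul_assoc, inv_mul_cancel_left, refl_mul_self, mul_one]
    · obtain ⟨l', h1, h2⟩ := ih h
      exact ⟨i :: l', by simp [h1], by rw [hcons, hcons, h2, mul_assoc]⟩

/-- An element of the reflection group subtracts from a vector positive roots weighted by the
products of the vector with simple roots. -/
theorem exists_list_sum {w : V ≃ₗᵢ[ℝ] V} (hw : w ∈ weylGroup Φ) :
    ∃ L : List (ι × V), (∀ p ∈ L, p.2 ∈ Φ ∧ ∀ j, 0 ≤ b.repr p.2 j) ∧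
      ∀ x, w x = x - (L.map fun p => (2 * ⟪b p.1, x⟫_ℝ / ⟪b p.1, b p.1⟫_ℝ) • p.2).sum := by
  obtain ⟨l, rfl⟩ := hb.exists_word hw
  clear hw
  induction h : l.length using Nat.strong_induction_on generalizing l with
  | _ n ih =>
    rcases List.eq_nil_or_concat l with rfl | ⟨l, i, rfl⟩
    · exact ⟨[], by simp, by simp [wordProd]⟩
    · rw [List.concat_eq_append] at h ⊢
      have hl : wordProd b (l ++ [i]) = wordProd b l * (ℝ ∙ b i)ᗮ.reflection := by
        simp [wordProd]
      have hbpos : ∀ j, 0 ≤ b.repr (b i) j := fun j => by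
        rw [b.repr_self, Finsupp.single_apply]
        split_ifs <;> norm_num
      -- The last letter contributes a multiple of the image of `b i` under the rest of the word. If
      -- that root is positive it is added to the list; otherwise the deletion property gives a
      -- shorter word.
      by_cases hpos : ∀ j, 0 ≤ b.repr (wordProd b l (b i)) j
      · obtain ⟨L, h1, h2⟩ := ih l.length (by simp at h; omega) l rfl
        refine ⟨(i, wordProd b l (b i)) :: L, ?_, fun x => ?_⟩
        · intro p hp
          rcases List.mem_cons.1 hp with rfl | hp
          · exact ⟨hb.weylGroup_map_mem (hb.wordProd_mem l) _ (hb.mem i), hpos⟩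
          · exact h1 p hp
        · rw [hl]
          change wordProd b l ((ℝ ∙ b i)ᗮ.reflection x) = _
          rw [refl_apply, map_sub, map_smul, h2 x, List.map_cons, List.sum_cons]
          abel
      · obtain ⟨l', h1, h2⟩ := hb.exists_word_mul_refl l (hb.mem i) hbpos hpos
        rw [hl, ← h2]
        exact ih l'.length (by simp at h; omega) l' rfl

/-- For a dominant `x` all the weights in `exists_list_sum` are nonnegative. -/
theorem repr_sub_nonneg {w : V ≃ₗᵢ[ℝ] V} (hw : w ∈ weylGroup Φ) {x : V}
    (hx : ∀ i, 0 ≤ ⟪b i, x⟫_ℝ) (j : ι) : 0 ≤ b.repr (x - w x) j := by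
  obtain ⟨L, h1, h2⟩ := hb.exists_list_sum hw
  rw [h2, sub_sub_cancel]
  clear h2
  induction L with
  | nil => simp
  | cons p L ih =>
    rw [List.map_cons, List.sum_cons, map_add, map_smul, Finsupp.add_apply, Finsupp.smul_apply,
      smul_eq_mul]
    refine add_nonneg (mul_nonneg (div_nonneg (mul_nonneg zero_le_two (hx _))
      (hb.inner_self_pos _).le) ((h1 p (by simp)).2 j)) (ih fun q hq => h1 q (by simp [hq]))

/-- The stabilizer of a dominant vector is determined by the simple roots orthogonal to it. -/
theorem map_eq_self_of_map_eq_self {w : V ≃ₗᵢ[ℝ] V} (hw : w ∈ weylGroup Φ) {x y : V}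
    (hx : ∀ i, 0 ≤ ⟪b i, x⟫_ℝ) (hwx : w x = x) (hxy : ∀ i, ⟪b i, x⟫_ℝ = 0 → ⟪b i, y⟫_ℝ = 0) :
    w y = y := by
  obtain ⟨L, h1, h2⟩ := hb.exists_list_sum hw
  have h3 := h2 x
  rw [hwx, eq_comm, sub_eq_self] at h3
  rw [h2 y, sub_eq_self]
  have h4 : ∀ M : List (ι × V), (∀ p ∈ M, p.2 ∈ Φ ∧ ∀ j, 0 ≤ b.repr p.2 j) →
      0 ≤ ⟪(M.map fun p => (2 * ⟪b p.1, x⟫_ℝ / ⟪b p.1, b p.1⟫_ℝ) • p.2).sum,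
        delta Φ (Set.range b)⟫_ℝ := by
    intro M hM
    induction M with
    | nil => simp
    | cons p M ih =>
      rw [List.map_cons, List.sum_cons, inner_add_left, inner_smul_left, conj_trivial]
      have := hM p (by simp)
      exact add_nonneg (mul_nonneg (div_nonneg (mul_nonneg zero_le_two (hx _))
        (hb.inner_self_pos _).le) (hb.inner_delta_pos_of_pos this.1 this.2).le)
        (ih fun q hq => hM q (by simp [hq]))
  -- Pairing with `δ` makes every term nonnegative, with positive product for each root, so a
  -- vanishing sum forces every weight to vanish.
  have h5 : ⟪(L.map fun p => (2 * ⟪b p.1, x⟫_ℝ / ⟪b p.1, b p.1⟫_ℝ) • p.2).sum,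
        delta Φ (Set.range b)⟫_ℝ = 0 := by rw [h3, inner_zero_left]
  clear h2 h3
  induction L with
  | nil => simp
  | cons p L ih =>
    rw [List.map_cons, List.sum_cons, inner_add_left, inner_smul_left, conj_trivial] at h5
    have hp := h1 p (by simp)
    have h6 := h4 L fun q hq => h1 q (by simp [hq])
    have h7 := hb.inner_delta_pos_of_pos hp.1 hp.2
    have h8 : 0 ≤ 2 * ⟪b p.1, x⟫_ℝ / ⟪b p.1, b p.1⟫_ℝ :=
      div_nonneg (mul_nonneg zero_le_two (hx _)) (hb.inner_self_pos _).le
    have h9 := mul_nonneg h8 h7.le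
    have h10 : 2 * ⟪b p.1, x⟫_ℝ / ⟪b p.1, b p.1⟫_ℝ = 0 :=
      (mul_eq_zero.1 (by linarith)).resolve_right h7.ne'
    have h11 : ⟪b p.1, x⟫_ℝ = 0 := by
      rcases div_eq_zero_iff.1 h10 with h | h
      · linarith
      · exact absurd h (hb.inner_self_pos _).ne'
    rw [List.map_cons, List.sum_cons, hxy _ h11, mul_zero, zero_div, zero_smul, zero_add]
    exact ih (fun q hq => h1 q (by simp [hq])) (by linarith)

/-- Two dominant vectors are closest among their images. -/
theorem inner_map_le {w : V ≃ₗᵢ[ℝ] V} (hw : w ∈ weylGroup Φ) {x y : V}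
    (hx : ∀ i, 0 ≤ ⟪b i, x⟫_ℝ) (hy : ∀ i, 0 ≤ ⟪b i, y⟫_ℝ) : ⟪x, w y⟫_ℝ ≤ ⟪x, y⟫_ℝ := by
  rw [← sub_nonneg, ← inner_sub_right, inner_eq_sum_repr b]
  exact Finset.sum_nonneg fun i _ => mul_nonneg (hb.repr_sub_nonneg hw hy i) (hx i)

/-- Equality kills the coefficients of `y - w y` at the simple roots not orthogonal to `y`, so `y -
w y` is orthogonal to `y`; as `w` preserves norms, `w y = y`. -/
theorem map_eq_of_inner_eq {w : V ≃ₗᵢ[ℝ] V} (hw : w ∈ weylGroup Φ) {x y : V}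
    (hx : ∀ i, 0 ≤ ⟪b i, x⟫_ℝ) (hy : ∀ i, 0 ≤ ⟪b i, y⟫_ℝ)
    (hxy : ∀ i, ⟪b i, y⟫_ℝ ≠ 0 → 0 < ⟪b i, x⟫_ℝ) (h : ⟪x, w y⟫_ℝ = ⟪x, y⟫_ℝ) : w y = y := by
  rw [eq_comm, ← sub_eq_zero, ← inner_sub_right, inner_eq_sum_repr b,
    Finset.sum_eq_zero_iff_of_nonneg fun i _ => mul_nonneg (hb.repr_sub_nonneg hw hy i) (hx i)] at h
  have h1 : ⟪y, y - w y⟫_ℝ = 0 := by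
    rw [inner_eq_sum_repr b]
    refine Finset.sum_eq_zero fun i hi => ?_
    by_cases hyi : ⟪b i, y⟫_ℝ = 0
    · rw [hyi, mul_zero]
    · rw [(mul_eq_zero.1 (h i hi)).resolve_right (hxy i hyi).ne', zero_mul]
  have h2 : ⟪y - w y, y - w y⟫_ℝ = 0 := by
    have h3 : ⟪w y, w y⟫_ℝ = ⟪y, y⟫_ℝ := w.inner_map_map y y
    rw [inner_sub_right, sub_eq_zero] at h1
    rw [inner_sub_left, inner_sub_right, inner_sub_right, h3, real_inner_comm (w y) y |>.symm] at *
    linarith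
  exact (sub_eq_zero.1 (inner_self_eq_zero.1 h2)).symm

/-- A subgroup moves every vector into the chamber of the simple reflections it contains. -/
theorem exists_map_inner_nonneg {H : Subgroup (V ≃ₗᵢ[ℝ] V)} (hH : H ≤ weylGroup Φ) (x : V) :
    ∃ h ∈ H, ∀ i, (ℝ ∙ b i)ᗮ.reflection ∈ H → 0 ≤ ⟪b i, h x⟫_ℝ := by
  -- Choose `h` maximizing the product of `h x` with `δ`: a simple reflection of `H` in a root
  -- having negative product with `h x` would increase it.
  obtain ⟨h, hh, hmax⟩ := (hb.finite_weylGroup.subset hH).exists_maximalFor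
    (fun h : V ≃ₗᵢ[ℝ] V => ⟪h x, delta Φ (Set.range b)⟫_ℝ) _ ⟨1, H.one_mem⟩
  refine ⟨h, hh, fun i hi => ?_⟩
  by_contra! hneg
  have h1 : ⟪h x, delta Φ (Set.range b)⟫_ℝ <
      ⟪((ℝ ∙ b i)ᗮ.reflection * h) x, delta Φ (Set.range b)⟫_ℝ := by
    change _ < ⟪(ℝ ∙ b i)ᗮ.reflection (h x), _⟫_ℝ
    rw [refl_apply, inner_sub_left, inner_smul_left, conj_trivial]
    have h2 : 2 * ⟪b i, h x⟫_ℝ / ⟪b i, b i⟫_ℝ < 0 :=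
      div_neg_of_neg_of_pos (by linarith) (hb.inner_self_pos i)
    have := mul_neg_of_neg_of_pos h2 (hb.inner_delta_pos i)
    linarith
  exact absurd h1 (not_lt.2 (hmax (H.mul_mem hi hh) h1.le))

end IsBase

end RootTheory

end Permutonestohedron

namespace Permutonestohedron

set_option linter.unusedSectionVars false

open scoped InnerProductSpace NNReal
open Module (Basis)

/-! ### Subspaces spanned by basis vectors -/

section BasisSpan

variable {M : Type*} [AddCommGroup M] [Module ℝ M] {ι : Type*} [Fintype ι] [DecidableEq ι]
  (b : Basis ι ℝ M)

/-- The subspace spanned by some vectors of a basis. -/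
def basisSpan (B : Finset ι) : Submodule ℝ M := Submodule.span ℝ (b '' B)

theorem mem_basisSpan {B : Finset ι} {x : M} : x ∈ basisSpan b B ↔ ∀ i, i ∉ B → b.repr x i = 0 := by
  rw [basisSpan, Basis.mem_span_image]
  constructor
  · intro h i hi
    by_contra h'
    exact hi (h (Finsupp.mem_support_iff.2 h'))
  · intro h i hi
    by_contra h'
    exact Finsupp.mem_support_iff.1 hi (h i h')

theorem basis_mem_basisSpan {B : Finset ι} {i : ι} : b i ∈ basisSpan b B ↔ i ∈ B := by
  rw [mem_basisSpan]
  constructor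
  · intro h
    by_contra hi
    simpa using h i hi
  · intro hi j hj
    rw [b.repr_self, Finsupp.single_apply, if_neg]
    rintro rfl
    exact hj hi

theorem basisSpan_le {B C : Finset ι} : basisSpan b B ≤ basisSpan b C ↔ B ⊆ C := by
  constructor
  · intro h i hi
    exact (basis_mem_basisSpan b).1 (h ((basis_mem_basisSpan b).2 hi))
  · intro h
    exact Submodule.span_mono (Set.image_mono (by exact_mod_cast h))

theorem basisSpan_injective : Function.Injective (basisSpan b) := fun _ _ h =>
  ((basisSpan_le b).1 h.le).antisymm ((basisSpan_le b).1 h.ge)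

theorem basisSpan_empty : basisSpan b ∅ = ⊥ := by
  simp [basisSpan]

theorem basisSpan_univ : basisSpan b Finset.univ = ⊤ := by
  simp [basisSpan]

theorem basisSpan_union (B C : Finset ι) :
    basisSpan b (B ∪ C) = basisSpan b B ⊔ basisSpan b C := by
  rw [basisSpan, Finset.coe_union, Set.image_union, Submodule.span_union]
  rfl

theorem basisSpan_singleton (i : ι) : basisSpan b {i} = Submodule.span ℝ {b i} := by
  simp [basisSpan]

theorem basisSpan_sup (T : Finset (Finset ι)) :
    basisSpan b (T.sup id) = sSup (basisSpan b '' T) := by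
  induction T using Finset.induction_on with
  | empty => simp [basisSpan_empty]
  | insert C T _ ih =>
    rw [Finset.sup_insert, Finset.sup_eq_union, basisSpan_union, ih, Finset.coe_insert,
      Set.image_insert_eq, sSup_insert]
    rfl

theorem finrank_basisSpan (B : Finset ι) : Module.finrank ℝ (basisSpan b B) = B.card := by
  classical
  rw [basisSpan, ← Finset.coe_image, finrank_span_finset_eq_card,
    Finset.card_image_of_injective _ b.injective]
  have := b.linearIndependent.linearIndepOn_id
  exact this.mono (by simp)

theorem disjoint_basisSpan {B C : Finset ι} (h : Disjoint B C) :
    Disjoint (basisSpan b B) (basisSpan b C) :=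
  b.linearIndependent.disjoint_span_image (by exact_mod_cast h)

theorem sSupIndep_basisSpan {T : Set (Finset ι)} (hT : T.PairwiseDisjoint id) :
    sSupIndep (basisSpan b '' T) := by
  classical
  rintro _ ⟨B, hB, rfl⟩
  have hfin : (T \ {B}).Finite := Set.toFinite _
  have h1 : basisSpan b '' T \ {basisSpan b B} = basisSpan b '' (hfin.toFinset : Set (Finset ι)) := by
    rw [Set.Finite.coe_toFinset, Set.image_sdiff (basisSpan_injective b), Set.image_singleton]
  rw [h1, ← basisSpan_sup]
  refine disjoint_basisSpan b ?_
  rw [Finset.disjoint_sup_right]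
  intro C hC
  rw [Set.Finite.mem_toFinset] at hC
  exact hT hB hC.1 fun h => hC.2 h.symm

theorem pairwiseDisjoint_of_sSupIndep {T : Set (Finset ι)} (hT : sSupIndep (basisSpan b '' T)) :
    T.PairwiseDisjoint id := by
  intro B hB C hC hne
  have h1 := hT.pairwiseDisjoint ⟨B, hB, rfl⟩ ⟨C, hC, rfl⟩ fun h => hne (basisSpan_injective b h)
  refine Finset.disjoint_left.2 fun i hi hi' => ?_
  have := (Submodule.disjoint_def.1 h1) (b i) ((basis_mem_basisSpan b).2 hi)
    ((basis_mem_basisSpan b).2 hi')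
  exact b.ne_zero i this

/-- Nested sets of subspaces spanned by basis vectors correspond to nested sets of subsets. -/
theorem isNested_image_iff {𝓑 S : Set (Finset ι)} (hne : ∀ B ∈ 𝓑, B.Nonempty) :
    IsNested (basisSpan b '' 𝓑) (basisSpan b '' S) ↔ CNested 𝓑 S := by
  classical
  have hinj := basisSpan_injective b
  constructor
  · rintro ⟨h1, h2⟩
    have hS : S ⊆ 𝓑 := (Set.image_subset_image_iff hinj).1 h1
    refine ⟨hS, fun B hB C hC => ?_, fun T hT hnt hd hU => ?_⟩
    · by_contra! h
      obtain ⟨hBC, hCB, hdis⟩ := h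
      have hne' : B ≠ C := fun h => hBC h.subset
      have hanti : IsAntichain (· ≤ ·) (basisSpan b '' {B, C}) := by
        rintro _ ⟨X, hX, rfl⟩ _ ⟨Y, hY, rfl⟩ hXY hle
        rw [basisSpan_le] at hle
        rcases hX with rfl | rfl <;> rcases hY with rfl | rfl
        exacts [hXY rfl, hBC hle, hCB hle, hXY rfl]
      have h3 := (h2 _ (Set.image_mono (s := {B, C}) (by simp [Set.insert_subset_iff, hB, hC]))
        ((Set.nontrivial_pair hne').image hinj) hanti).1
      exact hdis (pairwiseDisjoint_of_sSupIndep b h3 (by simp) (by simp) hne')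
    · refine (h2 (basisSpan b '' T) (Set.image_mono hT) (hnt.image hinj) ?_).2 ?_
      · rintro _ ⟨X, hX, rfl⟩ _ ⟨Y, hY, rfl⟩ hXY hle
        have hXY' : X ≠ Y := fun h => hXY (h ▸ rfl)
        have h3 : Disjoint X Y := hd hX hY hXY'
        exact (hne X (hS (hT hX))).ne_empty
          (Finset.disjoint_self_iff_empty _ |>.1 (h3.mono_right ((basisSpan_le b).1 hle)))
      · rw [← basisSpan_sup]
        exact ⟨_, hU, rfl⟩
  · intro h
    refine ⟨Set.image_mono h.subset, fun T hT hnt hanti => ?_⟩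
    obtain ⟨T, hTS, rfl⟩ := Set.subset_image_iff.1 hT
    have hd : T.PairwiseDisjoint id := fun B hB C hC hne => by
      have h1 : basisSpan b B ≠ basisSpan b C := fun h => hne (hinj h)
      rcases h.comparable B (hTS hB) C (hTS hC) with h2 | h2 | h2
      · exact absurd ((basisSpan_le b).2 h2) (hanti ⟨B, hB, rfl⟩ ⟨C, hC, rfl⟩ h1)
      · exact absurd ((basisSpan_le b).2 h2) (hanti ⟨C, hC, rfl⟩ ⟨B, hB, rfl⟩ h1.symm)
      · exact h2
    refine ⟨sSupIndep_basisSpan b hd, ?_⟩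
    rintro ⟨U, hU, hUT⟩
    have hfin : T.Finite := Set.toFinite _
    have hcoe : (hfin.toFinset : Set (Finset ι)) = T := hfin.coe_toFinset
    rw [← hcoe, ← basisSpan_sup] at hUT
    refine h.sup_notMem hfin.toFinset (by rwa [hcoe]) ?_ (by rwa [hcoe]) (hinj hUT ▸ hU)
    rw [hcoe]
    exact Set.nontrivial_of_image _ _ hnt

/-- The nested set complex in terms of subsets of the basis. -/
theorem nonempty_nestedComplex_orderIso {𝓑 : Set (Finset ι)} (hne : ∀ B ∈ 𝓑, B.Nonempty) :
    Nonempty ({S : Set (Finset ι) // CNested 𝓑 S ∧ Finset.univ ∈ S} ≃o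
      NestedComplex (basisSpan b '' 𝓑)) := by
  let F : {S : Set (Finset ι) // CNested 𝓑 S ∧ Finset.univ ∈ S} →
      NestedComplex (basisSpan b '' 𝓑) := fun S =>
    ⟨basisSpan b '' S.1, (isNested_image_iff b hne).2 S.2.1, ⟨_, S.2.2, basisSpan_univ b⟩⟩
  have hF : ∀ S S', F S ≤ F S' ↔ S ≤ S' := fun S S' =>
    Set.image_subset_image_iff (basisSpan_injective b)
  refine ⟨RelIso.ofSurjective (OrderEmbedding.ofMapLEIff F hF) ?_⟩
  rintro ⟨S, hS, htop⟩
  obtain ⟨S, -, rfl⟩ := Set.subset_image_iff.1 hS.1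
  refine ⟨⟨S, (isNested_image_iff b hne).1 hS, ?_⟩, rfl⟩
  obtain ⟨B, hB, h⟩ := htop
  rw [← basisSpan_univ b] at h
  exact basisSpan_injective b h ▸ hB

/-- The subsets whose span belongs to `G`. -/
def fundSet (G : Set (Submodule ℝ M)) : Set (Finset ι) := {B | basisSpan b B ∈ G}

theorem fund_range (G : Set (Submodule ℝ M)) : fund (Set.range b) G = basisSpan b '' fundSet b G := by
  classical
  ext A
  constructor
  · rintro ⟨hA, T, hT, rfl⟩
    obtain ⟨T, rfl⟩ := Set.subset_range_iff_exists_image_eq.1 hT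
    have h : basisSpan b T.toFinite.toFinset = Submodule.span ℝ (b '' T) := by simp [basisSpan]
    refine ⟨_, ?_, h⟩
    change basisSpan b _ ∈ G
    rw [h]
    exact hA
  · rintro ⟨B, hB, rfl⟩
    exact ⟨hB, b '' B, Set.image_subset_range _ _, rfl⟩

end BasisSpan

/-! ### The projections of `δ` in coordinates -/

section Projections

variable {V : Type*} [NormedAddCommGroup V] [InnerProductSpace ℝ V] [FiniteDimensional ℝ V]
  {ι : Type*} [Fintype ι] [DecidableEq ι]

/-- The vector `π_A` for `A` spanned by the simple roots in `B`. -/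
noncomputable def projDelta (Φ : Set V) (b : Basis ι ℝ V) (B : Finset ι) : V :=
  piVec Φ (Set.range b) (basisSpan b B)

/-- The coefficients of `π_A`. -/
noncomputable def projCoeff (Φ : Set V) (b : Basis ι ℝ V) (B : Finset ι) (i : ι) : ℝ :=
  b.repr (projDelta Φ b B) i

/-- A building set on the simple roots which contains the connected sets of simple roots. -/
structure IsRootBuilding (b : Basis ι ℝ V) (𝓑 : Set (Finset ι)) : Prop extends IsBuilding 𝓑 where
  univ_mem : Finset.univ ∈ 𝓑
  pair_mem : ∀ i j, ⟪b i, b j⟫_ℝ ≠ 0 → {i, j} ∈ 𝓑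

/-- The vector `δ - ∑ π_K`, the sum being over the components of `B`. -/
noncomputable def normalVec (Φ : Set V) (b : Basis ι ℝ V) (𝓑 : Set (Finset ι)) (B : Finset ι) : V :=
  delta Φ (Set.range b) - ∑ K ∈ comps 𝓑 B, projDelta Φ b K

theorem projDelta_mem (Φ : Set V) (b : Basis ι ℝ V) (B : Finset ι) :
    projDelta Φ b B ∈ basisSpan b B := Submodule.starProjection_apply_mem _ _

theorem inner_projDelta_of_mem (Φ : Set V) (b : Basis ι ℝ V) {B : Finset ι} {i : ι} (hi : i ∈ B) :
    ⟪b i, projDelta Φ b B⟫_ℝ = ⟪b i, delta Φ (Set.range b)⟫_ℝ := by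
  rw [projDelta, piVec, ← Submodule.inner_starProjection_left_eq_right,
    Submodule.starProjection_eq_self_iff.2 ((basis_mem_basisSpan b).2 hi)]

theorem projCoeff_of_notMem (Φ : Set V) (b : Basis ι ℝ V) {B : Finset ι} {i : ι} (hi : i ∉ B) :
    projCoeff Φ b B i = 0 :=
  (mem_basisSpan b).1 (projDelta_mem Φ b B) i hi

theorem inner_projDelta (Φ : Set V) (b : Basis ι ℝ V) (B : Finset ι) (x : V) :
    ⟪x, projDelta Φ b B⟫_ℝ = wsum (projCoeff Φ b) (fun i => ⟪b i, x⟫_ℝ) B := by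
  rw [inner_eq_sum_repr b, wsum]
  refine (Finset.sum_subset (Finset.subset_univ B) fun i _ hi => ?_).symm
  rw [show b.repr (projDelta Φ b B) i = 0 from projCoeff_of_notMem Φ b hi, zero_mul]

theorem projDelta_univ (Φ : Set V) (b : Basis ι ℝ V) :
    projDelta Φ b Finset.univ = delta Φ (Set.range b) := by
  rw [projDelta, piVec, Submodule.starProjection_eq_self_iff, basisSpan_univ]
  exact Submodule.mem_top

/-- The part of `π_A` supported on `B` has the same products with the simple roots in `B` as `π_B`,
hence equals it. This covers the case in `isWeight` where `B` cannot be enlarged inside `A` by a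
non-orthogonal simple root. -/
theorem projCoeff_eq_of_orthogonal (Φ : Set V) (b : Basis ι ℝ V) {A B : Finset ι} (hBA : B ⊆ A)
    (h : ∀ i ∈ B, ∀ j ∈ A, j ∉ B → ⟪b i, b j⟫_ℝ = 0) {i : ι} (hi : i ∈ B) :
    projCoeff Φ b A i = projCoeff Φ b B i := by
  set y : V := ∑ i ∈ B, projCoeff Φ b A i • b i with hy
  have hyr : ∀ j ∈ B, b.repr y j = projCoeff Φ b A j := fun j hj => by
    rw [hy, map_sum, Finsupp.finsetSum_apply, Finset.sum_eq_single j]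
    · simp
    · intro k _ hkj
      simp [hkj]
    · exact fun h => absurd hj h
  have hyB : y ∈ basisSpan b B := Submodule.sum_mem _ fun j hj =>
    Submodule.smul_mem _ _ ((basis_mem_basisSpan b).2 hj)
  have hinner : ∀ j ∈ B, ⟪b j, y⟫_ℝ = ⟪b j, projDelta Φ b B⟫_ℝ := by
    intro j hj
    rw [inner_projDelta_of_mem Φ b hj, ← inner_projDelta_of_mem Φ b (hBA hj), inner_projDelta, hy,
      inner_sum, wsum, ← Finset.sum_subset hBA fun k hk hkB => by
        rw [real_inner_comm, h j hj k hk hkB, mul_zero]]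
    exact Finset.sum_congr rfl fun k _ => by rw [inner_smul_right, real_inner_comm]
  have hz : y - projDelta Φ b B = 0 := by
    have hmem : y - projDelta Φ b B ∈ basisSpan b B :=
      Submodule.sub_mem _ hyB (projDelta_mem Φ b B)
    rw [← inner_self_eq_zero (𝕜 := ℝ), inner_eq_sum_repr b]
    refine Finset.sum_eq_zero fun j _ => ?_
    by_cases hj : j ∈ B
    · rw [inner_sub_right, hinner j hj, sub_self, mul_zero]
    · rw [(mem_basisSpan b).1 hmem j hj, zero_mul]
  rw [← hyr i hi, sub_eq_zero.1 hz]
  rfl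

namespace IsBase

variable {Φ : Set V} {b : Basis ι ℝ V} (hb : IsBase Φ b)

include hb

/-- On the simple roots of `B`, the vector `π_B` has the same products as `δ`, which are positive;
`repr_pos` converts this into positive coefficients. -/
theorem projCoeff_pos {B : Finset ι} {i : ι} (hi : i ∈ B) : 0 < projCoeff Φ b B i :=
  hb.repr_pos (fun _ hj => projCoeff_of_notMem Φ b hj) (fun j hj => by
    rw [inner_projDelta_of_mem Φ b hj]
    exact hb.inner_delta_pos j) i hi

theorem inner_projDelta_nonpos {B : Finset ι} {i : ι} (hi : i ∉ B) :
    ⟪b i, projDelta Φ b B⟫_ℝ ≤ 0 := by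
  rw [inner_projDelta]
  refine Finset.sum_nonpos fun j hj => mul_nonpos_of_nonneg_of_nonpos (hb.projCoeff_pos hj).le
    (hb.inner_nonpos ?_)
  rintro rfl
  exact hi hj

/-- Simple roots in different components are orthogonal, because a non-orthogonal pair belongs to
the building set and would join the two components. -/
theorem inner_projDelta_eq_zero {𝓑 : Set (Finset ι)} (h𝓑 : IsRootBuilding b 𝓑) {B K K' : Finset ι}
    (hK : K ∈ comps 𝓑 B) (hK' : K' ∈ comps 𝓑 B) (hne : K ≠ K') {i : ι} (hi : i ∈ K) :
    ⟪b i, projDelta Φ b K'⟫_ℝ = 0 := by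
  rw [inner_projDelta]
  refine Finset.sum_eq_zero fun j hj => ?_
  have : ⟪b j, b i⟫_ℝ = 0 := by
    by_contra h
    have hmem := h𝓑.pair_mem j i h
    have hsub : ({j, i} : Finset ι) ⊆ B := by
      simp [Finset.insert_subset_iff, subset_of_mem_comps hK hi, subset_of_mem_comps hK' hj]
    have h1 := h𝓑.subset_of_not_disjoint hK hmem hsub
      (Finset.not_disjoint_iff.2 ⟨i, hi, by simp⟩)
    exact hne (h𝓑.eq_of_not_disjoint hK hK'
      (Finset.not_disjoint_iff.2 ⟨j, h1 (by simp), hj⟩))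
  change _ * ⟪b j, b i⟫_ℝ = 0
  rw [this, mul_zero]

/-- The component containing `i` contributes the same product as `δ`, and the others contribute
nothing. Together with the positivity outside `B`, this makes the normal vector dominant with zero
set exactly `B`. -/
theorem inner_normalVec_of_mem {𝓑 : Set (Finset ι)} (h𝓑 : IsRootBuilding b 𝓑) {B : Finset ι}
    {i : ι} (hi : i ∈ B) : ⟪b i, normalVec Φ b 𝓑 B⟫_ℝ = 0 := by
  obtain ⟨K, hK, hiK⟩ := h𝓑.exists_mem_comps hi
  rw [normalVec, inner_sub_right, inner_sum, Finset.sum_eq_single K, inner_projDelta_of_mem Φ b hiK,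
    sub_self]
  · exact fun K' hK' hne => hb.inner_projDelta_eq_zero h𝓑 hK hK' hne.symm hiK
  · exact fun h => absurd hK h

theorem inner_normalVec_of_notMem {𝓑 : Set (Finset ι)} {B : Finset ι}
    {i : ι} (hi : i ∉ B) : 0 < ⟪b i, normalVec Φ b 𝓑 B⟫_ℝ := by
  rw [normalVec, inner_sub_right, inner_sum]
  have h1 := hb.inner_delta_pos i
  have h2 : ∑ K ∈ comps 𝓑 B, ⟪b i, projDelta Φ b K⟫_ℝ ≤ 0 := Finset.sum_nonpos fun K hK =>
    hb.inner_projDelta_nonpos fun h => hi (subset_of_mem_comps hK h)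
  linarith

theorem inner_normalVec_nonneg {𝓑 : Set (Finset ι)} (h𝓑 : IsRootBuilding b 𝓑) (B : Finset ι)
    (i : ι) : 0 ≤ ⟪b i, normalVec Φ b 𝓑 B⟫_ℝ := by
  by_cases hi : i ∈ B
  · exact (hb.inner_normalVec_of_mem h𝓑 hi).ge
  · exact (hb.inner_normalVec_of_notMem hi).le

theorem inner_normalVec_eq_zero {𝓑 : Set (Finset ι)} (h𝓑 : IsRootBuilding b 𝓑) {B : Finset ι}
    {i : ι} : ⟪b i, normalVec Φ b 𝓑 B⟫_ℝ = 0 ↔ i ∈ B := by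
  refine ⟨fun h => ?_, hb.inner_normalVec_of_mem h𝓑⟩
  by_contra hi
  exact (hb.inner_normalVec_of_notMem hi).ne' h

/-! #### Suitable lists give weights -/

theorem simpleCoeffs_eq (B : Finset ι) :
    simpleCoeffs (Set.range b) (basisSpan b B) (piVec Φ (Set.range b) (basisSpan b B)) =
      projCoeff Φ b B '' B := by
  classical
  have hsum : ∀ c ∈ Finsupp.supported ℝ ℝ (Set.range b), ∀ i,
      b.repr (Finsupp.linearCombination ℝ id c) i = c (b i) := by
    intro c hc i
    rw [Finsupp.linearCombination_apply, Finsupp.sum, map_sum, Finsupp.finsetSum_apply]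
    by_cases hi : b i ∈ c.support
    · rw [Finset.sum_eq_single (b i)]
      · simp
      · intro x hx hne
        obtain ⟨j, rfl⟩ := hc hx
        have : j ≠ i := fun h => hne (h ▸ rfl)
        simp [this]
      · exact fun h => absurd hi h
    · rw [Finsupp.notMem_support_iff.1 hi]
      refine Finset.sum_eq_zero fun x hx => ?_
      obtain ⟨j, rfl⟩ := hc hx
      have : j ≠ i := by
        rintro rfl
        exact hi hx
      simp [this]
  ext r
  constructor
  · rintro ⟨c, hc, hcx, _, ⟨i, rfl⟩, hi, rfl⟩
    refine ⟨i, (basis_mem_basisSpan b).1 hi, ?_⟩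
    rw [← hsum c hc i, hcx]
    rfl
  · rintro ⟨i, hi, rfl⟩
    have hsupp : Finsupp.mapDomain b (b.repr (projDelta Φ b B)) ∈
        Finsupp.supported ℝ ℝ (Set.range b) := by
      intro x hx
      obtain ⟨i, -, rfl⟩ := Finset.mem_image.1 (Finsupp.mapDomain_support hx)
      exact ⟨i, rfl⟩
    refine ⟨_, hsupp, ?_, b i, ⟨i, rfl⟩, (basis_mem_basisSpan b).2 hi, ?_⟩
    · rw [Finsupp.linearCombination_mapDomain]
      exact b.linearCombination_repr _
    · rw [Finsupp.mapDomain_apply b.injective]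
      rfl

end IsBase

end Projections

end Permutonestohedron

namespace Permutonestohedron

set_option linter.unusedSectionVars false

open scoped InnerProductSpace NNReal
open Module (Basis)

/-! ### Suitable lists give weights -/

section Suitable

variable {V : Type*} [NormedAddCommGroup V] [InnerProductSpace ℝ V] [FiniteDimensional ℝ V]
  {ι : Type*} [Fintype ι] [DecidableEq ι] {Φ : Set V} {b : Basis ι ℝ V} {G : Set (Submodule ℝ V)}

theorem bddAbove_ratio (Φ : Set V) (b : Basis ι ℝ V) (G : Set (Submodule ℝ V)) (i j : ℕ) :
    BddAbove (insert 1 {r | ∃ A ∈ fund (Set.range b) G, ∃ B ∈ fund (Set.range b) G, B < A ∧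
      Module.finrank ℝ A = i ∧ Module.finrank ℝ B = j ∧ r = ratio Φ (Set.range b) A B}) := by
  refine Set.Finite.bddAbove (Set.Finite.insert _ ?_)
  refine (Set.finite_range fun p : Finset ι × Finset ι =>
    ratio Φ (Set.range b) (basisSpan b p.1) (basisSpan b p.2)).subset ?_
  rintro r ⟨A, hA, B, hB, -, -, -, rfl⟩
  rw [fund_range] at hA hB
  obtain ⟨A, -, rfl⟩ := hA
  obtain ⟨B, -, rfl⟩ := hB
  exact ⟨(A, B), rfl⟩

theorem one_le_maxRatio (Φ : Set V) (b : Basis ι ℝ V) (G : Set (Submodule ℝ V)) (i j : ℕ) :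
    1 ≤ maxRatio Φ (Set.range b) G i j :=
  le_csSup (bddAbove_ratio Φ b G i j) (Set.mem_insert _ _)

theorem IsBase.projCoeff_le (hb : IsBase Φ b) {A B : Finset ι} (hA : A ∈ fundSet b G)
    (hB : B ∈ fundSet b G) (hBA : B ⊂ A) {i : ι} (hi : i ∈ B) :
    projCoeff Φ b A i ≤ maxRatio Φ (Set.range b) G A.card B.card * projCoeff Φ b B i := by
  have h1 : ratio Φ (Set.range b) (basisSpan b A) (basisSpan b B) ≤
      maxRatio Φ (Set.range b) G A.card B.card := by
    refine le_csSup (bddAbove_ratio Φ b G _ _) (Set.mem_insert_of_mem _ ?_)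
    refine ⟨_, (fund_range b G).symm ▸ ⟨A, hA, rfl⟩, _, (fund_range b G).symm ▸ ⟨B, hB, rfl⟩, ?_,
      finrank_basisSpan b A, finrank_basisSpan b B, rfl⟩
    exact lt_of_le_not_ge ((basisSpan_le b).2 hBA.subset) fun h =>
      hBA.2 ((basisSpan_le b).1 h)
  rw [ratio, hb.simpleCoeffs_eq, hb.simpleCoeffs_eq] at h1
  have hfA : (projCoeff Φ b A '' (A : Set ι)).Finite := (Finset.finite_toSet A).image _
  have hfB : (projCoeff Φ b B '' (B : Set ι)).Finite := (Finset.finite_toSet B).image _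
  have h2 : projCoeff Φ b A i ≤ sSup (projCoeff Φ b A '' A) :=
    le_csSup hfA.bddAbove ⟨i, hBA.subset hi, rfl⟩
  have h3 : sInf (projCoeff Φ b B '' B) ≤ projCoeff Φ b B i :=
    csInf_le hfB.bddBelow ⟨i, hi, rfl⟩
  have h4 : 0 < sInf (projCoeff Φ b B '' B) := by
    obtain ⟨j, hj, h⟩ := Set.Nonempty.csInf_mem (s := projCoeff Φ b B '' (B : Set ι))
      ⟨_, i, hi, rfl⟩ hfB
    rw [← h]
    exact hb.projCoeff_pos hj
  have h5 : 0 < sSup (projCoeff Φ b A '' A) := (hb.projCoeff_pos (hBA.subset hi)).trans_le h2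
  calc projCoeff Φ b A i ≤ sSup (projCoeff Φ b A '' A) := h2
    _ = sSup (projCoeff Φ b A '' A) / sInf (projCoeff Φ b B '' B) *
        sInf (projCoeff Φ b B '' B) := (div_mul_cancel₀ _ h4.ne').symm
    _ ≤ sSup (projCoeff Φ b A '' A) / sInf (projCoeff Φ b B '' B) * projCoeff Φ b B i :=
        mul_le_mul_of_nonneg_left h3 (div_pos h5 h4).le
    _ ≤ _ := mul_le_mul_of_nonneg_right h1 (hb.projCoeff_pos hi).le

/-- Each ratio bound is at least `1`, so consecutive terms more than double; the estimate is
obtained by iteration. -/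
theorem IsSuitableList.two_pow_mul_lt {ε : ℕ → ℝ} (hε : IsSuitableList Φ (Set.range b) G ε) {k : ℕ}
    (hk : 1 ≤ k) (m : ℕ) (hkm : k < m) (hm : m ≤ Module.finrank ℝ V) :
    2 ^ m * ε k < 2 ^ k * ε m := by
  have hstep : ∀ i, 1 ≤ i → i + 1 ≤ Module.finrank ℝ V → 2 * ε i < ε (i + 1) := fun i h1 h2 => by
    refine lt_of_le_of_lt ?_ (hε.suitable i h1 h2)
    have := one_le_maxRatio Φ b G (i + 1) i
    have := mul_le_mul_of_nonneg_right this (hε.pos i h1 (by omega)).le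
    linarith
  induction m, hkm using Nat.le_induction with
  | base =>
    have := hstep k hk hm
    rw [pow_succ, mul_assoc]
    exact mul_lt_mul_of_pos_left this (by positivity)
  | succ m hkm ih =>
    have h1 := ih (by omega)
    have h2 := mul_lt_mul_of_pos_left (hstep m (by omega) hm) (show (0 : ℝ) < 2 ^ k by positivity)
    rw [pow_succ]
    linarith

/-- A suitable list controls coefficient ratios only between consecutive dimensions, so `B` is
enlarged towards `A` one simple root at a time. A root of `A` not orthogonal to `B` can be added
without leaving the building set. If there is none, `π_A` and `π_B` agree on `B` and the growth of
`ε` suffices. -/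
theorem IsBase.isWeight (hb : IsBase Φ b) (h𝓑 : IsRootBuilding b (fundSet b G)) {ε : ℕ → ℝ}
    (hε : IsSuitableList Φ (Set.range b) G ε) :
    IsWeight (fundSet b G) (projCoeff Φ b) fun B => ε B.card := by
  have hcard : ∀ B : Finset ι, B.card ≤ Module.finrank ℝ V := fun B => by
    rw [Module.finrank_eq_card_basis b]
    exact Finset.card_le_univ B
  have hone : ∀ B ∈ fundSet b G, 1 ≤ B.card := fun B hB => (h𝓑.nonempty B hB).card_pos
  have hpos : ∀ B ∈ fundSet b G, 0 < ε B.card := fun B hB => hε.pos _ (hone B hB) (hcard B)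
  have hgrowth : ∀ A ∈ fundSet b G, ∀ B ∈ fundSet b G, B ⊂ A →
      2 ^ A.card * ε B.card < 2 ^ B.card * ε A.card := fun A _ B hB hBA =>
    hε.two_pow_mul_lt (hone B hB) _ (Finset.card_lt_card hBA) (hcard A)
  refine ⟨fun B _ i hi => hb.projCoeff_pos hi, hpos, ?_, hgrowth⟩
  intro A hA
  suffices H : ∀ n, ∀ B ∈ fundSet b G, B ⊂ A → A.card - B.card = n → ∀ i ∈ B,
      2 ^ A.card * (projCoeff Φ b A i * ε B.card) < 2 ^ B.card * (projCoeff Φ b B i * ε A.card) from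
    fun B hB hBA => H _ B hB hBA rfl
  intro n
  induction n with
  | zero =>
    intro B hB hBA h
    have := Finset.card_lt_card hBA
    omega
  | succ n ih =>
    intro B hB hBA hn i hi
    by_cases horth : ∀ i ∈ B, ∀ j ∈ A, j ∉ B → ⟪b i, b j⟫_ℝ = 0
    · rw [projCoeff_eq_of_orthogonal Φ b hBA.subset horth hi]
      have := mul_lt_mul_of_pos_left (hgrowth A hA B hB hBA) (hb.projCoeff_pos (Φ := Φ) hi)
      linarith
    push Not at horth
    obtain ⟨k, hk, j, hjA, hjB, hkj⟩ := horth
    have hB' : insert j B ∈ fundSet b G := by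
      have h1 := h𝓑.union _ (h𝓑.pair_mem k j hkj) B hB
        (Finset.not_disjoint_iff.2 ⟨k, by simp, hk⟩)
      convert h1 using 1
      ext l
      simp only [Finset.mem_insert, Finset.mem_union, Finset.mem_singleton]
      constructor
      · tauto
      · rintro ((rfl | rfl) | h)
        exacts [Or.inr hk, Or.inl rfl, Or.inr h]
    have hc : (insert j B).card = B.card + 1 := Finset.card_insert_of_notMem hjB
    have hss : B ⊂ insert j B := Finset.ssubset_insert hjB
    have h1 := hb.projCoeff_le hB' hB hss hi
    have h2 := hε.suitable B.card (hone B hB) (hc ▸ hcard _)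
    rw [hc] at h1
    have hstep : 2 * (projCoeff Φ b (insert j B) i * ε B.card) <
        projCoeff Φ b B i * ε (B.card + 1) := by
      have h3 := mul_le_mul_of_nonneg_right h1 (hpos B hB).le
      have h4 := mul_lt_mul_of_pos_left h2 (hb.projCoeff_pos (Φ := Φ) hi)
      linarith
    have hsub : insert j B ⊆ A := Finset.insert_subset hjA hBA.subset
    rcases hsub.eq_or_ssubset with heq | hss'
    · have := mul_lt_mul_of_pos_left hstep (show (0 : ℝ) < 2 ^ B.card by positivity)
      rw [← heq, hc, pow_succ]
      linarith
    · have h3 := ih _ hB' hss' (by omega) i (Finset.mem_insert_of_mem hi)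
      rw [hc, pow_succ] at h3
      have hp := hpos _ hB'
      rw [hc] at hp
      have hA0 := hpos A hA
      have h4 := mul_lt_mul_of_pos_right h3 (hpos B hB)
      have h5 := mul_lt_mul_of_pos_left hstep
        (show (0 : ℝ) < 2 ^ B.card * ε A.card by positivity)
      refine lt_of_mul_lt_mul_right (a := ε (B.card + 1)) ?_ hp.le
      linarith

end Suitable

end Permutonestohedron

namespace Permutonestohedron

set_option linter.unusedSectionVars false

open scoped InnerProductSpace NNReal
open Module (Basis)

/-! ### Building sets of subspaces -/

section BuildingSets

variable {M : Type*} [AddCommGroup M] [Module ℝ M] {ι : Type*} [Fintype ι] [DecidableEq ι]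

theorem exists_mem_decomposition [FiniteDimensional ℝ M] {G : Set (Submodule ℝ M)}
    {X C : Submodule ℝ M} (hX : X ∈ G) (hXC : X ≤ C) : ∃ A ∈ decomposition G C, X ≤ A := by
  obtain ⟨A, ⟨hA, hXA⟩, hmax⟩ := wellFounded_gt.has_min
    {A : Submodule ℝ M | (A ∈ G ∧ A ≤ C) ∧ X ≤ A} ⟨X, ⟨hX, hXC⟩, le_rfl⟩
  refine ⟨A, ⟨hA, fun B hB hAB => ?_⟩, hXA⟩
  by_contra h
  exact hmax B ⟨hB, hXA.trans hAB⟩ (lt_of_le_not_ge hAB h)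

theorem le_of_mem_decomposition {G : Set (Submodule ℝ M)} {A C : Submodule ℝ M}
    (h : A ∈ decomposition G C) : A ≤ C := h.1.2

theorem mem_of_mem_decomposition {G : Set (Submodule ℝ M)} {A C : Submodule ℝ M}
    (h : A ∈ decomposition G C) : A ∈ G := h.1.1

theorem decomposition_basisSpan (b : Basis ι ℝ M) (𝓑 : Set (Finset ι)) (B : Finset ι) :
    decomposition (basisSpan b '' 𝓑) (basisSpan b B) = basisSpan b '' comps 𝓑 B := by
  ext A
  constructor
  · rintro ⟨⟨⟨K, hK, rfl⟩, hKB⟩, hmax⟩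
    refine ⟨K, mem_comps.2 ⟨⟨hK, (basisSpan_le b).1 hKB⟩, fun L hL hKL => ?_⟩, rfl⟩
    exact (basisSpan_le b).1 (hmax ⟨⟨L, hL.1, rfl⟩, (basisSpan_le b).2 hL.2⟩
      ((basisSpan_le b).2 hKL))
  · rintro ⟨K, hK, rfl⟩
    refine ⟨⟨⟨K, mem_of_mem_comps hK, rfl⟩, (basisSpan_le b).2 (subset_of_mem_comps hK)⟩, ?_⟩
    rintro _ ⟨⟨L, hL, rfl⟩, hLB⟩ hKL
    exact (basisSpan_le b).2 ((mem_comps.1 hK).le_of_ge ⟨hL, (basisSpan_le b).1 hLB⟩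
      ((basisSpan_le b).1 hKL))

end BuildingSets

/-! ### Simple systems as bases, and the building set on the simple roots. -/

section RootBuilding

variable {V : Type*} [NormedAddCommGroup V] [InnerProductSpace ℝ V] [FiniteDimensional ℝ V]
  {ι : Type*} [Fintype ι] [DecidableEq ι] {Φ : Set V} {b : Basis ι ℝ V} {G : Set (Submodule ℝ V)}

theorem IsSimpleSystem.exists_basis {Δ : Set V} (hΦ : IsRootSystem Φ) (hΔ : IsSimpleSystem Φ Δ) :
    ∃ (n : ℕ) (b : Basis (Fin n) ℝ V), Set.range b = Δ ∧ IsBase Φ b := by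
  have hspan : Submodule.span ℝ Δ = ⊤ := by
    rw [eq_top_iff, ← hΦ.span_eq_top, Submodule.span_le]
    have h0 : ∀ x ∈ Submodule.span ℝ≥0 Δ, x ∈ Submodule.span ℝ Δ := fun x hx => by
      induction hx using Submodule.span_induction with
      | mem x hx => exact Submodule.subset_span hx
      | zero => exact Submodule.zero_mem _
      | add x y _ _ h1 h2 => exact Submodule.add_mem _ h1 h2
      | smul c x _ h => exact Submodule.smul_mem _ (c : ℝ) h
    intro α hα
    rcases hΔ.mem_or_neg_mem α hα with h | h
    · exact h0 α h
    · exact neg_neg α ▸ Submodule.neg_mem _ (h0 _ h)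
  have hfin : Finite Δ := hΦ.finite.subset hΔ.subset
  let b₀ : Basis Δ ℝ V := Basis.mk (v := ((↑) : Δ → V)) hΔ.linearIndepOn (by
    rw [Subtype.range_coe, hspan])
  obtain ⟨n, ⟨f⟩⟩ := Finite.exists_equiv_fin Δ
  have hr : Set.range (b₀.reindex f) = Δ := by
    rw [Basis.range_reindex, show ⇑b₀ = ((↑) : Δ → V) from Basis.coe_mk _ _, Subtype.range_coe]
  refine ⟨n, b₀.reindex f, hr, hΦ, fun i => hΔ.subset (hr.subset ⟨i, rfl⟩), fun α hα => ?_⟩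
  rcases hΔ.mem_or_neg_mem α hα with h | h
  · rw [← hr, mem_span_nnreal_range_iff] at h
    exact Or.inl h
  · rw [← hr, mem_span_nnreal_range_iff] at h
    exact Or.inr fun i => by simpa using h i

theorem IsBase.basisSpan_mem_spans (hb : IsBase Φ b) {B : Finset ι} (hB : B.Nonempty) :
    basisSpan b B ∈ spans Φ := by
  refine ⟨fun h => ?_, b '' B, ?_, rfl⟩
  · rw [← basisSpan_empty b] at h
    exact hB.ne_empty (basisSpan_injective b h)
  · rintro _ ⟨i, -, rfl⟩
    exact hb.mem i

/-- Directness of the decomposition does the work: members with a common nonzero vector lie in the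
same summand. For non-orthogonal simple roots, a root of their span involving both forces their
lines into one summand. -/
theorem IsBuildingSet.isRootBuilding (hb : IsBase Φ b) (hG : IsBuildingSet Φ G) (hGV : ⊤ ∈ G) :
    IsRootBuilding b (fundSet b G) := by
  have hne : ∀ B ∈ fundSet b G, B.Nonempty := fun B hB => by
    by_contra h
    rw [Finset.not_nonempty_iff_eq_empty] at h
    exact (hG.subset hB).1 (h ▸ basisSpan_empty b)
  have hline : ∀ i, {i} ∈ fundSet b G := fun i => by
    change basisSpan b {i} ∈ G
    rw [basisSpan_singleton]
    exact hG.line_mem _ (hb.mem i)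
  have huniq : ∀ C ∈ spans Φ, ∀ X ∈ decomposition G C, ∀ Y ∈ decomposition G C, ∀ v, v ≠ 0 →
      v ∈ X → v ∈ Y → X = Y := by
    intro C hC X hX Y hY v hv hvX hvY
    by_contra h
    exact hv (Submodule.disjoint_def.1 ((hG.indep C hC).pairwiseDisjoint hX hY h) v hvX hvY)
  refine ⟨⟨hne, hline, ?_⟩, ?_, ?_⟩
  · intro B hB C hC hBC
    obtain ⟨i, hiB, hiC⟩ := Finset.not_disjoint_iff.1 hBC
    have hspan := hb.basisSpan_mem_spans (B := B ∪ C) ⟨i, Finset.mem_union_left _ hiB⟩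
    obtain ⟨X, hX, hBX⟩ := exists_mem_decomposition hB
      ((basisSpan_le b).2 (Finset.subset_union_left (s₂ := C)))
    obtain ⟨Y, hY, hCY⟩ := exists_mem_decomposition hC
      ((basisSpan_le b).2 (Finset.subset_union_right (s₁ := B)))
    obtain rfl := huniq _ hspan X hX Y hY (b i) (b.ne_zero i)
      (hBX ((basis_mem_basisSpan b).2 hiB)) (hCY ((basis_mem_basisSpan b).2 hiC))
    have : X = basisSpan b (B ∪ C) :=
      le_antisymm (le_of_mem_decomposition hX) (by rw [basisSpan_union]; exact sup_le hBX hCY)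
    change basisSpan b _ ∈ G
    exact this ▸ mem_of_mem_decomposition hX
  · change basisSpan b _ ∈ G
    rwa [basisSpan_univ]
  · intro i j hij
    by_cases hne' : i = j
    · subst hne'
      rw [Finset.pair_eq_singleton]
      exact hline i
    have hspan := hb.basisSpan_mem_spans (B := {i, j}) ⟨i, by simp⟩
    have hle : ∀ k ∈ ({i, j} : Finset ι), ℝ ∙ b k ≤ basisSpan b {i, j} := fun k hk => by
      rw [Submodule.span_singleton_le_iff_mem]
      exact (basis_mem_basisSpan b).2 hk
    obtain ⟨X, hX, hiX⟩ := exists_mem_decomposition (hG.line_mem _ (hb.mem i)) (hle i (by simp))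
    obtain ⟨Y, hY, hjY⟩ := exists_mem_decomposition (hG.line_mem _ (hb.mem j)) (hle j (by simp))
    rw [Submodule.span_singleton_le_iff_mem] at hiX hjY
    -- The reflection coefficient, chosen so that `b j - c • b i` is a root; it is nonzero by
    -- non-orthogonality.
    set c : ℝ := 2 * ⟪b i, b j⟫_ℝ / ⟪b i, b i⟫_ℝ with hc
    have hc0 : c ≠ 0 := div_ne_zero (mul_ne_zero two_ne_zero hij) (hb.inner_self_pos i).ne'
    have hα : b j - c • b i ∈ Φ := refl_apply (b i) (b j) ▸
      hb.root.reflection_mem _ (hb.mem i) _ (hb.mem j)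
    obtain ⟨Z, hZ, hαZ⟩ := exists_mem_decomposition (C := basisSpan b {i, j})
      (hG.line_mem _ hα) (by
        rw [Submodule.span_singleton_le_iff_mem]
        exact Submodule.sub_mem _ ((basis_mem_basisSpan b).2 (by simp))
          (Submodule.smul_mem _ _ ((basis_mem_basisSpan b).2 (by simp))))
    rw [Submodule.span_singleton_le_iff_mem] at hαZ
    have hfin : X = Y → {i, j} ∈ fundSet b G := by
      rintro rfl
      have : X = basisSpan b {i, j} := by
        refine le_antisymm (le_of_mem_decomposition hX) (Submodule.span_le.2 ?_)
        rintro _ ⟨k, hk, rfl⟩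
        rcases Finset.mem_insert.1 hk with rfl | hk
        · exact hiX
        · exact Finset.mem_singleton.1 hk ▸ hjY
      change basisSpan b _ ∈ G
      exact this ▸ mem_of_mem_decomposition hX
    by_cases hZX : Z = X
    · subst hZX
      refine hfin (huniq _ hspan Z hX Y hY (b j) (b.ne_zero j) ?_ hjY)
      simpa using Submodule.add_mem _ hαZ (Submodule.smul_mem _ c hiX)
    by_cases hZY : Z = Y
    · subst hZY
      refine hfin (huniq _ hspan X hX Z hY (b i) (b.ne_zero i) hiX ?_)
      have := Submodule.smul_mem _ c⁻¹ (Submodule.sub_mem _ hjY hαZ)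
      rwa [sub_sub_cancel, smul_smul, inv_mul_cancel₀ hc0, one_smul] at this
    -- A third summand `Z` is impossible: the root would lie both in `Z` and in the sum of the other
    -- summands.
    have hdis := (hG.indep _ hspan) hZ
    have hX' : X ≤ sSup (decomposition G (basisSpan b {i, j}) \ {Z}) :=
      le_sSup ⟨hX, fun h => hZX h.symm⟩
    have hY' : Y ≤ sSup (decomposition G (basisSpan b {i, j}) \ {Z}) :=
      le_sSup ⟨hY, fun h => hZY h.symm⟩
    exact absurd (Submodule.disjoint_def.1 hdis _ hαZ
      (Submodule.sub_mem _ (hY' hjY) (Submodule.smul_mem _ c (hX' hiX)))) (hb.ne_zero hα)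

end RootBuilding

/-! ### The permutonestohedron in coordinates -/

section Description

variable {V : Type*} [NormedAddCommGroup V] [InnerProductSpace ℝ V] [FiniteDimensional ℝ V]
  {ι : Type*} [Fintype ι] [DecidableEq ι]

/-- The coordinates of a vector dual to a basis. -/
noncomputable def coords (b : Basis ι ℝ V) (x : V) (i : ι) : ℝ := ⟪b i, x⟫_ℝ

/-- The right-hand side of the inequality attached to `B`. -/
noncomputable def lev (𝓑 : Set (Finset ι)) (e : Finset ι → ℝ) (B : Finset ι) : ℝ :=
  e Finset.univ - ∑ K ∈ comps 𝓑 B, e K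

/-- The polytope cut out by the images under the reflection group of the half-spaces attached to
the proper sets of simple roots. -/
def rootPolytope (Φ : Set V) (b : Basis ι ℝ V) (𝓑 : Set (Finset ι)) (e : Finset ι → ℝ) : Set V :=
  {x | ∀ w ∈ weylGroup Φ, ∀ B, B ≠ Finset.univ → ⟪x, w (normalVec Φ b 𝓑 B)⟫_ℝ ≤ lev 𝓑 e B}

variable {Φ : Set V} {b : Basis ι ℝ V} {G : Set (Submodule ℝ V)}

theorem finrank_eq_card_univ (b : Basis ι ℝ V) :
    Module.finrank ℝ V = (Finset.univ : Finset ι).card := by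
  rw [Module.finrank_eq_card_basis b, Finset.card_univ]

/-- This converts the inequalities for the identity of `W` into the statement that the whole set has
minimal excess, and tightness into equality of excesses. -/
theorem inner_normalVec_sub_lev {𝓑 : Set (Finset ι)} (h𝓑 : IsRootBuilding b 𝓑) (e : Finset ι → ℝ)
    (x : V) (B : Finset ι) :
    ⟪x, normalVec Φ b 𝓑 B⟫_ℝ - lev 𝓑 e B =
      excess 𝓑 (projCoeff Φ b) e (coords b x) Finset.univ -
        excess 𝓑 (projCoeff Φ b) e (coords b x) B := by
  rw [excess, excess, h𝓑.comps_of_mem h𝓑.univ_mem, Finset.sum_singleton, Finset.sum_sub_distrib,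
    normalVec, inner_sub_right, inner_sum, lev, ← projDelta_univ, inner_projDelta,
    Finset.sum_congr rfl fun K _ => inner_projDelta Φ b K x]
  change wsum _ (coords b x) _ - ∑ K ∈ _, wsum _ (coords b x) K - _ = _
  ring

theorem inner_normalVec_of_mem_building {𝓑 : Set (Finset ι)} (h𝓑 : IsBuilding 𝓑) {B : Finset ι}
    (hB : B ∈ 𝓑) :
    normalVec Φ b 𝓑 B = delta Φ (Set.range b) - piVec Φ (Set.range b) (basisSpan b B) := by
  rw [normalVec, h𝓑.comps_of_mem hB, Finset.sum_singleton]
  rfl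

theorem basisSpan_eq_top_iff {B : Finset ι} : basisSpan b B = ⊤ ↔ B = Finset.univ := by
  rw [← basisSpan_univ b, (basisSpan_injective b).eq_iff]

theorem mem_image_isometry_iff {σ : V ≃ₗᵢ[ℝ] V} {x u : V} {r : ℝ} :
    x ∈ σ '' {y | ⟪y, u⟫_ℝ ≤ r} ↔ ⟪x, σ u⟫_ℝ ≤ r := by
  constructor
  · rintro ⟨y, hy, rfl⟩
    rw [σ.inner_map_map]
    exact hy
  · intro h
    refine ⟨σ.symm x, ?_, σ.apply_symm_apply x⟩
    change ⟪σ.symm x, u⟫_ℝ ≤ r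
    rwa [← σ.inner_map_map, σ.apply_symm_apply]

theorem halfSpace_basisSpan (h𝓑 : IsRootBuilding b (fundSet b G)) (ε : ℕ → ℝ) {B : Finset ι}
    (hB : B ∈ fundSet b G) (hBu : B ≠ Finset.univ) :
    halfSpace Φ (Set.range b) ε (basisSpan b B) =
      {x | ⟪x, normalVec Φ b (fundSet b G) B⟫_ℝ ≤ lev (fundSet b G) (fun B => ε B.card) B} := by
  rw [halfSpace, deltaVec, level, if_neg (basisSpan_eq_top_iff.not.2 hBu),
    if_neg (basisSpan_eq_top_iff.not.2 hBu), finrank_eq_card_univ b, finrank_basisSpan,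
    inner_normalVec_of_mem_building h𝓑.toIsBuilding hB, lev, h𝓑.comps_of_mem hB,
    Finset.sum_singleton]

/-- The half-space of `V` is the member of the uniform family attached to the empty set, which has
no components. -/
theorem halfSpace_top (h𝓑 : IsRootBuilding b (fundSet b G)) (ε : ℕ → ℝ) :
    halfSpace Φ (Set.range b) ε ⊤ =
      {x | ⟪x, normalVec Φ b (fundSet b G) ∅⟫_ℝ ≤ lev (fundSet b G) (fun B => ε B.card) ∅} := by
  rw [halfSpace, deltaVec, level, if_pos rfl, if_pos rfl, finrank_eq_card_univ b, normalVec, lev,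
    h𝓑.comps_empty, Finset.sum_empty, Finset.sum_empty, sub_zero, sub_zero]

theorem halfSpaceBar_basisSpan (ε : ℕ → ℝ) (B : Finset ι) :
    halfSpaceBar Φ (Set.range b) G ε (basisSpan b B) =
      {x | ⟪x, normalVec Φ b (fundSet b G) B⟫_ℝ ≤ lev (fundSet b G) (fun B => ε B.card) B} := by
  have hinj : Set.InjOn (basisSpan b) (comps (fundSet b G) B : Set (Finset ι)) :=
    (basisSpan_injective b).injOn
  rw [halfSpaceBar, fund_range, decomposition_basisSpan, finsum_mem_image hinj,
    finsum_mem_image hinj, finsum_mem_coe_finset, finsum_mem_coe_finset, finrank_eq_card_univ b,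
    normalVec, lev]
  simp only [finrank_basisSpan]
  rfl

theorem permutonestohedron_eq (hb : IsBase Φ b) (h𝓑 : IsRootBuilding b (fundSet b G)) (ε : ℕ → ℝ) :
    permutonestohedron Φ (Set.range b) G ε =
      rootPolytope Φ b (fundSet b G) fun B => ε B.card := by
  ext x
  refine forall₂_congr fun w _ => ⟨?_, fun h => ⟨?_, ?_⟩⟩
  · rintro ⟨h1, h2⟩ B hBu
    rw [← mem_image_isometry_iff]
    rcases B.eq_empty_or_nonempty with rfl | hne
    · rw [← halfSpace_top h𝓑]
      refine h1 _ ?_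
      rw [fund_range]
      exact ⟨_, h𝓑.univ_mem, basisSpan_univ b⟩
    by_cases hB : B ∈ fundSet b G
    · rw [← halfSpace_basisSpan h𝓑 ε hB hBu]
      refine h1 _ ?_
      rw [fund_range]
      exact ⟨_, hB, rfl⟩
    · rw [← halfSpaceBar_basisSpan ε]
      refine h2 _ ⟨?_, ?_⟩
      · rw [fund_range]
        exact ⟨B, hb.basisSpan_mem_spans hne, rfl⟩
      · rw [fund_range]
        rintro ⟨C, hC, h⟩
        exact hB (basisSpan_injective b h ▸ hC)
  · intro A hA
    rw [fund_range] at hA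
    obtain ⟨B, hB, rfl⟩ := hA
    by_cases hBu : B = Finset.univ
    · rw [hBu, basisSpan_univ, halfSpace_top h𝓑, mem_image_isometry_iff]
      exact h ∅ fun h => (h𝓑.nonempty B hB).ne_empty (hBu.trans h.symm)
    · rw [halfSpace_basisSpan h𝓑 ε hB hBu, mem_image_isometry_iff]
      exact h B hBu
  · rintro A ⟨hA, hA'⟩
    rw [fund_range] at hA hA'
    obtain ⟨B, hB, rfl⟩ := hA
    rw [halfSpaceBar_basisSpan ε, mem_image_isometry_iff]
    exact h B fun hBu => hA' ⟨B, hBu ▸ h𝓑.univ_mem, rfl⟩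

theorem inner_delta_eq_wsum (x : V) :
    ⟪x, delta Φ (Set.range b)⟫_ℝ = wsum (projCoeff Φ b) (coords b x) Finset.univ := by
  rw [← projDelta_univ, inner_projDelta]
  rfl

theorem mem_hyperplane_iff (ε : ℕ → ℝ) {x : V}
    (hx : wsum (projCoeff Φ b) (coords b x) Finset.univ = ε (Finset.univ : Finset ι).card)
    {B : Finset ι} (hB : B ∈ fundSet b G) :
    x ∈ hyperplane Φ (Set.range b) ε (basisSpan b B) ↔
      wsum (projCoeff Φ b) (coords b x) B = ε B.card := by
  by_cases hBu : B = Finset.univ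
  · subst hBu
    rw [basisSpan_univ]
    change ⟪_, deltaVec _ _ _⟫_ℝ = level _ _ ↔ _
    rw [deltaVec, level, if_pos rfl, if_pos rfl, finrank_eq_card_univ b, inner_delta_eq_wsum]
  · change ⟪_, deltaVec _ _ _⟫_ℝ = level _ _ ↔ _
    rw [deltaVec, level, if_neg (basisSpan_eq_top_iff.not.2 hBu),
      if_neg (basisSpan_eq_top_iff.not.2 hBu), finrank_eq_card_univ b, finrank_basisSpan,
      inner_sub_right, inner_delta_eq_wsum]
    have : ⟪x, piVec Φ (Set.range b) (basisSpan b B)⟫_ℝ =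
      wsum (projCoeff Φ b) (coords b x) B := inner_projDelta Φ b B x
    rw [this, hx]
    constructor <;> intro h <;> linarith

/-- On `H_V` the product with `δ` is constant, so an upper bound for `δ - π_A` is a lower bound for
`π_A`. -/
theorem mem_fundNestohedron_iff (ε : ℕ → ℝ) {x : V} :
    x ∈ fundNestohedron Φ (Set.range b) G ε ↔
      IsNestPoint (fundSet b G) (projCoeff Φ b) (fun B => ε B.card) (coords b x) := by
  have htop : x ∈ hyperplane Φ (Set.range b) ε ⊤ ↔
      wsum (projCoeff Φ b) (coords b x) Finset.univ = ε (Finset.univ : Finset ι).card := by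
    change ⟪_, deltaVec _ _ _⟫_ℝ = level _ _ ↔ _
    rw [deltaVec, level, if_pos rfl, if_pos rfl, finrank_eq_card_univ b, inner_delta_eq_wsum]
  have hle : wsum (projCoeff Φ b) (coords b x) Finset.univ = ε (Finset.univ : Finset ι).card →
      ∀ B ∈ fundSet b G, (x ∈ halfSpace Φ (Set.range b) ε (basisSpan b B) ↔
        ε B.card ≤ wsum (projCoeff Φ b) (coords b x) B) := by
    intro hx B hB
    by_cases hBu : B = Finset.univ
    · subst hBu
      rw [basisSpan_univ]
      refine iff_of_true ?_ hx.ge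
      exact le_of_eq (htop.2 hx)
    · rw [halfSpace, deltaVec, level, if_neg (basisSpan_eq_top_iff.not.2 hBu),
        if_neg (basisSpan_eq_top_iff.not.2 hBu), finrank_eq_card_univ b, finrank_basisSpan]
      change ⟪_, _⟫_ℝ ≤ _ ↔ _
      rw [inner_sub_right, inner_delta_eq_wsum]
      have : ⟪x, piVec Φ (Set.range b) (basisSpan b B)⟫_ℝ =
        wsum (projCoeff Φ b) (coords b x) B := inner_projDelta Φ b B x
      rw [this, hx]
      constructor <;> intro h <;> linarith
  constructor
  · rintro ⟨h1, h2⟩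
    refine ⟨htop.1 h1, fun B hB => (hle (htop.1 h1) B hB).1 (h2 _ ?_)⟩
    rw [fund_range]
    exact ⟨B, hB, rfl⟩
  · rintro ⟨h1, h2⟩
    refine ⟨htop.2 h1, fun A hA => ?_⟩
    rw [fund_range] at hA
    obtain ⟨B, hB, rfl⟩ := hA
    exact (hle h1 B hB).2 (h2 B hB)

theorem mem_nestedFace_iff (ε : ℕ → ℝ) {x : V}
    {S : Set (Finset ι)} (hS : S ⊆ fundSet b G) :
    x ∈ nestedFace Φ (Set.range b) G ε (basisSpan b '' S) ↔
      IsNestPoint (fundSet b G) (projCoeff Φ b) (fun B => ε B.card) (coords b x) ∧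
        S ⊆ tightSet (fundSet b G) (projCoeff Φ b) (fun B => ε B.card) (coords b x) := by
  change _ ∧ _ ↔ _
  rw [mem_fundNestohedron_iff]
  refine and_congr_right fun hx => ?_
  constructor
  · exact fun h B hB => ⟨hS hB, (mem_hyperplane_iff ε hx.eq (hS hB)).1 (h _ ⟨B, hB, rfl⟩)⟩
  · rintro h _ ⟨B, hB, rfl⟩
    exact (mem_hyperplane_iff ε hx.eq (hS hB)).2 (h hB).2

end Description

end Permutonestohedron

namespace Permutonestohedron

set_option linter.unusedSectionVars false

open scoped InnerProductSpace NNReal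
open Module (Basis)

/-! ### The polytope of a root building set -/

section RootPolytope

variable {V : Type*} [NormedAddCommGroup V] [InnerProductSpace ℝ V] [FiniteDimensional ℝ V]
  {ι : Type*} [Fintype ι] [DecidableEq ι]

theorem exists_coords_eq (b : Basis ι ℝ V) (t : ι → ℝ) : ∃ x, coords b x = t := by
  let L : V →ₗ[ℝ] ι → ℝ := LinearMap.pi fun i => (innerSL ℝ (b i)).toLinearMap
  have hL : Function.Injective L := by
    rw [← LinearMap.ker_eq_bot, LinearMap.ker_eq_bot']
    intro x hx
    rw [← inner_self_eq_zero (𝕜 := ℝ), inner_eq_sum_repr b]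
    refine Finset.sum_eq_zero fun i _ => ?_
    have : ⟪b i, x⟫_ℝ = 0 := congrFun hx i
    rw [this, mul_zero]
  have hs := (LinearMap.injective_iff_surjective_of_finrank_eq_finrank (f := L)
    (by rw [Module.finrank_eq_card_basis b, Module.finrank_fintype_fun_eq_card])).1 hL
  exact hs t

theorem ext_coords (b : Basis ι ℝ V) {x y : V} (h : ∀ i, ⟪b i, x⟫_ℝ = ⟪b i, y⟫_ℝ) : x = y := by
  rw [← sub_eq_zero, ← inner_self_eq_zero (𝕜 := ℝ), inner_eq_sum_repr b]
  refine Finset.sum_eq_zero fun i _ => ?_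
  rw [inner_sub_right, h, sub_self, mul_zero]

/-- The functionals of the inequalities that define the polytope. -/
noncomputable def facetForm (Φ : Set V) (b : Basis ι ℝ V) (𝓑 : Set (Finset ι))
    (j : weylGroup Φ × {B : Finset ι // B ≠ Finset.univ}) : StrongDual ℝ V :=
  innerSL ℝ ((j.1 : V ≃ₗᵢ[ℝ] V) (normalVec Φ b 𝓑 j.2))

theorem facetForm_apply (Φ : Set V) (b : Basis ι ℝ V) (𝓑 : Set (Finset ι))
    (j : weylGroup Φ × {B : Finset ι // B ≠ Finset.univ}) (x : V) :
    facetForm Φ b 𝓑 j x = ⟪x, (j.1 : V ≃ₗᵢ[ℝ] V) (normalVec Φ b 𝓑 j.2)⟫_ℝ :=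
  real_inner_comm _ _

variable {Φ : Set V} {b : Basis ι ℝ V} {𝓑 : Set (Finset ι)} {e : Finset ι → ℝ}

theorem inner_map_eq (w : V ≃ₗᵢ[ℝ] V) (x y : V) : ⟪w x, y⟫_ℝ = ⟪x, w⁻¹ y⟫_ℝ := by
  rw [← w.inner_map_map x (w⁻¹ y)]
  congr 1
  exact (w.apply_symm_apply y).symm

theorem isPolyhedron_rootPolytope : IsPolyhedron (rootPolytope Φ b 𝓑 e) (facetForm Φ b 𝓑)
    (fun j => lev 𝓑 e j.2) ∅ := by
  intro x
  simp only [facetForm_apply, Set.mem_empty_iff_false, false_imp_iff, implies_true, and_true]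
  exact ⟨fun h j => h j.1 j.1.2 j.2 j.2.2, fun h w hw B hB => h (⟨w, hw⟩, ⟨B, hB⟩)⟩

theorem map_mem_rootPolytope {w : V ≃ₗᵢ[ℝ] V} (hw : w ∈ weylGroup Φ) {x : V}
    (hx : x ∈ rootPolytope Φ b 𝓑 e) : w x ∈ rootPolytope Φ b 𝓑 e := by
  intro u hu B hB
  rw [inner_map_eq]
  exact hx (w⁻¹ * u) (mul_mem (inv_mem hw) hu) B hB

namespace IsBase

variable (hb : IsBase Φ b)

include hb

theorem refl_mem_weylGroup (i : ι) : (ℝ ∙ b i)ᗮ.reflection ∈ weylGroup Φ :=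
  Subgroup.subset_closure ⟨b i, hb.mem i, rfl⟩

theorem finite_index : Finite (weylGroup Φ × {B : Finset ι // B ≠ Finset.univ}) :=
  have : Finite (weylGroup Φ) := hb.finite_weylGroup
  inferInstance

theorem exists_dominant (x : V) : ∃ w ∈ weylGroup Φ, ∀ i, 0 ≤ ⟪b i, w x⟫_ℝ := by
  obtain ⟨w, hw, h⟩ := hb.exists_map_inner_nonneg le_rfl x
  exact ⟨w, hw, fun i => h i (hb.refl_mem_weylGroup i)⟩

/-- By `inner_map_le` applied to `w y` and `y`, the product of `w y` with `y` is at least their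
common squared norm, so the two vectors coincide. -/
theorem eq_of_dominant {w : V ≃ₗᵢ[ℝ] V} (hw : w ∈ weylGroup Φ) {y : V}
    (hy : ∀ i, 0 ≤ ⟪b i, y⟫_ℝ) (hwy : ∀ i, 0 ≤ ⟪b i, w y⟫_ℝ) : w y = y := by
  have h1 := hb.inner_map_le hw hwy hy
  have h2 : ⟪w y, w y⟫_ℝ = ⟪y, y⟫_ℝ := w.inner_map_map y y
  have h3 : ⟪w y - y, w y - y⟫_ℝ ≤ 0 := by
    rw [inner_sub_left, inner_sub_right, inner_sub_right, real_inner_comm (w y) y]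
    linarith
  exact sub_eq_zero.1 (inner_self_eq_zero.1 (le_antisymm h3 real_inner_self_nonneg))

theorem excess_le_of_mem (h𝓑 : IsRootBuilding b 𝓑) {x : V} (hx : x ∈ rootPolytope Φ b 𝓑 e)
    (B : Finset ι) : excess 𝓑 (projCoeff Φ b) e (coords b x) Finset.univ ≤
      excess 𝓑 (projCoeff Φ b) e (coords b x) B := by
  by_cases hB : B = Finset.univ
  · rw [hB]
  · have h1 : ⟪x, normalVec Φ b 𝓑 B⟫_ℝ ≤ lev 𝓑 e B := hx 1 (one_mem _) B hB
    have h2 := inner_normalVec_sub_lev (Φ := Φ) h𝓑 e x B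
    linarith

/-- The inequalities that are tight at a dominant point of the polytope. -/
theorem map_normalVec_eq_of_tight (h𝓑 : IsRootBuilding b 𝓑)
    (hw : IsWeight 𝓑 (projCoeff Φ b) e) {x : V}
    (hx : x ∈ rootPolytope Φ b 𝓑 e) (hdom : ∀ i, 0 ≤ ⟪b i, x⟫_ℝ) {w : V ≃ₗᵢ[ℝ] V}
    (hwW : w ∈ weylGroup Φ) {B : Finset ι} (hB : B ≠ Finset.univ)
    (h : ⟪x, w (normalVec Φ b 𝓑 B)⟫_ℝ = lev 𝓑 e B) :
    w (normalVec Φ b 𝓑 B) = normalVec Φ b 𝓑 B ∧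
      excess 𝓑 (projCoeff Φ b) e (coords b x) B =
        excess 𝓑 (projCoeff Φ b) e (coords b x) Finset.univ := by
  have h1 := hb.inner_map_le hwW hdom (hb.inner_normalVec_nonneg h𝓑 B)
  have h2 : ⟪x, normalVec Φ b 𝓑 B⟫_ℝ ≤ lev 𝓑 e B := hx 1 (one_mem _) B hB
  have h3 := inner_normalVec_sub_lev (Φ := Φ) h𝓑 e x B
  have h4 : excess 𝓑 (projCoeff Φ b) e (coords b x) B =
      excess 𝓑 (projCoeff Φ b) e (coords b x) Finset.univ := by linarith
  refine ⟨hb.map_eq_of_inner_eq hwW hdom (hb.inner_normalVec_nonneg h𝓑 B) (fun i hi => ?_)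
    (by linarith), h4⟩
  exact hw.pos_of_excess_minimal h𝓑.toIsBuilding hdom
    (fun C => h4.le.trans (hb.excess_le_of_mem h𝓑 hx C))
    fun h => hi ((hb.inner_normalVec_eq_zero h𝓑).2 h)

/-- Let `B` be the smallest set of minimal excess. Every tight normal vector is one attached to a
set of minimal excess, which contains `B`, so it is orthogonal to `b i` for each `i` in `B`. At an
extreme point `B` is therefore empty and the minimal excess is `0`; comparison with the whole set
and with single members gives the equation and the inequalities. -/
theorem isNestPoint_of_mem_extremePoints (h𝓑 : IsRootBuilding b 𝓑)
    (hw : IsWeight 𝓑 (projCoeff Φ b) e) {x : V}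
    (hx : x ∈ (rootPolytope Φ b 𝓑 e).extremePoints ℝ) (hdom : ∀ i, 0 ≤ ⟪b i, x⟫_ℝ) :
    IsNestPoint 𝓑 (projCoeff Φ b) e (coords b x) := by
  have := hb.finite_index
  have hxP := hx.1
  have hmin := hb.excess_le_of_mem h𝓑 hxP
  obtain ⟨B, hB, hcard⟩ := Finset.exists_min_image (Finset.univ.filter fun B =>
    excess 𝓑 (projCoeff Φ b) e (coords b x) B =
      excess 𝓑 (projCoeff Φ b) e (coords b x) Finset.univ) Finset.card
    ⟨Finset.univ, by simp⟩
  simp only [Finset.mem_filter, Finset.mem_univ, true_and] at hB hcard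
  have hsub : ∀ B', excess 𝓑 (projCoeff Φ b) e (coords b x) B' =
      excess 𝓑 (projCoeff Φ b) e (coords b x) Finset.univ → B ⊆ B' := fun B' hB' =>
    hw.subset_of_excess_minimal h𝓑.toIsBuilding hdom (fun C => hB.le.trans (hmin C))
      (fun C hC => hcard C (le_antisymm (hC.trans hB.le) (hmin C))) fun C => hB'.le.trans (hmin C)
  have hempty : B = ∅ := by
    rw [Finset.eq_empty_iff_forall_notMem]
    intro i hi
    refine b.ne_zero i (isPolyhedron_rootPolytope.mem_extremePoints_eq_zero hx fun j hj => ?_)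
    rw [facetForm_apply] at hj ⊢
    obtain ⟨h1, h2⟩ := hb.map_normalVec_eq_of_tight h𝓑 hw hxP hdom j.1.2 j.2.2 hj
    rw [h1]
    exact hb.inner_normalVec_of_mem h𝓑 (hsub _ h2 hi)
  have h0 : excess 𝓑 (projCoeff Φ b) e (coords b x) Finset.univ = 0 := by
    rw [← hB, hempty, excess, h𝓑.comps_empty, Finset.sum_empty]
  refine ⟨?_, fun K hK => ?_⟩
  · rw [excess, h𝓑.comps_of_mem h𝓑.univ_mem, Finset.sum_singleton] at h0
    linarith
  · have := hmin K
    rw [h0, excess, h𝓑.comps_of_mem hK, Finset.sum_singleton] at this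
    linarith

theorem excess_univ_eq_zero (h𝓑 : IsRootBuilding b 𝓑) {t : ι → ℝ}
    (ht : IsNestPoint 𝓑 (projCoeff Φ b) e t) :
    excess 𝓑 (projCoeff Φ b) e t Finset.univ = 0 := by
  rw [excess, h𝓑.comps_of_mem h𝓑.univ_mem, Finset.sum_singleton, ht.eq, sub_self]

theorem excess_nonneg {t : ι → ℝ}
    (ht : IsNestPoint 𝓑 (projCoeff Φ b) e t) (B : Finset ι) :
    0 ≤ excess 𝓑 (projCoeff Φ b) e t B :=
  Finset.sum_nonneg fun K hK => sub_nonneg.2 (ht.le K (mem_of_mem_comps hK))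

theorem excess_eq_zero_iff {t : ι → ℝ} (ht : IsNestPoint 𝓑 (projCoeff Φ b) e t) (B : Finset ι) :
    excess 𝓑 (projCoeff Φ b) e t B = 0 ↔
      ∀ K ∈ comps 𝓑 B, K ∈ tightSet 𝓑 (projCoeff Φ b) e t := by
  rw [excess, Finset.sum_eq_zero_iff_of_nonneg fun K hK =>
    sub_nonneg.2 (ht.le K (mem_of_mem_comps hK))]
  exact forall₂_congr fun K hK => ⟨fun h => ⟨mem_of_mem_comps hK, sub_eq_zero.1 h⟩,
    fun h => sub_eq_zero.2 h.2⟩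

/-- Such a point is dominant, so among the images of a normal vector the vector itself gives the
strongest inequality. That inequality holds because the whole set has excess `0` and all other
excesses are nonnegative. -/
theorem mem_rootPolytope_of_isNestPoint (h𝓑 : IsRootBuilding b 𝓑)
    (hw : IsWeight 𝓑 (projCoeff Φ b) e) {y : V}
    (hy : IsNestPoint 𝓑 (projCoeff Φ b) e (coords b y)) : y ∈ rootPolytope Φ b 𝓑 e := by
  intro w hwW B _
  have h1 := hb.inner_map_le hwW (fun i => (hw.pos_of_isNestPoint h𝓑.toIsBuilding hy i).le)
    (hb.inner_normalVec_nonneg h𝓑 B)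
  have h2 := inner_normalVec_sub_lev (Φ := Φ) h𝓑 e y B
  rw [hb.excess_univ_eq_zero h𝓑 hy] at h2
  linarith [hb.excess_nonneg hy B]

/-- The inequalities that are tight at the image of a point of the nestohedron. -/
theorem inner_map_eq_lev_iff (h𝓑 : IsRootBuilding b 𝓑) (hw : IsWeight 𝓑 (projCoeff Φ b) e) {y : V}
    (hy : IsNestPoint 𝓑 (projCoeff Φ b) e (coords b y)) {h w : V ≃ₗᵢ[ℝ] V} (hh : h ∈ weylGroup Φ)
    (hwW : w ∈ weylGroup Φ) {B : Finset ι} (hB : B ≠ Finset.univ) :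
    ⟪h y, w (normalVec Φ b 𝓑 B)⟫_ℝ = lev 𝓑 e B ↔
      (h⁻¹ * w) (normalVec Φ b 𝓑 B) = normalVec Φ b 𝓑 B ∧
        ∀ K ∈ comps 𝓑 B, K ∈ tightSet 𝓑 (projCoeff Φ b) e (coords b y) := by
  have hpos := hw.pos_of_isNestPoint h𝓑.toIsBuilding hy
  have h2 := inner_normalVec_sub_lev (Φ := Φ) h𝓑 e y B
  have h0 := hb.excess_univ_eq_zero h𝓑 hy
  rw [inner_map_eq, ← hb.excess_eq_zero_iff hy]
  constructor
  · intro h1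
    obtain ⟨h3, h4⟩ := hb.map_normalVec_eq_of_tight h𝓑 hw
      (hb.mem_rootPolytope_of_isNestPoint h𝓑 hw hy) (fun i => (hpos i).le)
      (mul_mem (inv_mem hh) hwW) hB h1
    exact ⟨h3, h4.trans h0⟩
  · rintro ⟨h3, h4⟩
    change ⟪y, (h⁻¹ * w) _⟫_ℝ = _
    rw [h3]
    linarith

theorem projCoeff_univ_pos (i : ι) : 0 < b.repr (delta Φ (Set.range b)) i := by
  rw [← projDelta_univ]
  exact hb.projCoeff_pos (Finset.mem_univ i)

/-- Since `δ` has positive coefficients, the inequality of the empty set confines the dominant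
points to a box. Every other point is the image of a dominant one under an isometry. -/
theorem isCompact_rootPolytope (h𝓑 : IsRootBuilding b 𝓑) : IsCompact (rootPolytope Φ b 𝓑 e) := by
  refine Metric.isCompact_of_isClosed_isBounded isPolyhedron_rootPolytope.isClosed ?_
  have hne : (∅ : Finset ι) ≠ Finset.univ := fun h =>
    (h𝓑.nonempty _ h𝓑.univ_mem).ne_empty h.symm
  let L : V →ₗ[ℝ] ι → ℝ := LinearMap.pi fun i => (innerSL ℝ (b i)).toLinearMap
  have hL : Function.Injective L := fun x y h => ext_coords b fun i => congrFun h i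
  obtain ⟨C, hC, hLC⟩ := L.exists_antilipschitzWith (LinearMap.ker_eq_bot.2 hL)
  have hbdd : Bornology.IsBounded (L ⁻¹' (Set.Icc 0 fun i =>
      e Finset.univ / b.repr (delta Φ (Set.range b)) i)) :=
    hLC.isBounded_preimage (Metric.isBounded_Icc _ _)
  obtain ⟨R, hR⟩ := hbdd.subset_closedBall 0
  refine (Metric.isBounded_closedBall (x := (0 : V)) (r := R)).subset fun x hx => ?_
  obtain ⟨w, hw, hdom⟩ := hb.exists_dominant x
  have h1 : w x ∈ Metric.closedBall (0 : V) R := by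
    refine hR ⟨hdom, fun i => ?_⟩
    have h2 := map_mem_rootPolytope hw hx 1 (one_mem _) ∅ hne
    rw [normalVec, lev, h𝓑.comps_empty, Finset.sum_empty, Finset.sum_empty, sub_zero,
      sub_zero] at h2
    change ⟪w x, delta Φ (Set.range b)⟫_ℝ ≤ _ at h2
    rw [inner_eq_sum_repr b] at h2
    have h3 := Finset.single_le_sum (fun j _ => mul_nonneg (hb.projCoeff_univ_pos j).le (hdom j))
      (Finset.mem_univ i)
    change ⟪b i, w x⟫_ℝ ≤ _
    rw [le_div_iff₀ (hb.projCoeff_univ_pos i), mul_comm]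
    exact h3.trans h2
  rw [mem_closedBall_zero_iff] at h1 ⊢
  rwa [w.norm_map] at h1

/-- The images of the points of the nestohedron. -/
theorem rootPolytope_eq_convexHull (h𝓑 : IsRootBuilding b 𝓑)
    (hw : IsWeight 𝓑 (projCoeff Φ b) e) :
    rootPolytope Φ b 𝓑 e = convexHull ℝ (Set.range
      fun o : weylGroup Φ × {y : V // IsNestPoint 𝓑 (projCoeff Φ b) e (coords b y)} =>
        (o.1 : V ≃ₗᵢ[ℝ] V) o.2) := by
  have := hb.finite_index
  refine subset_antisymm ?_ (convexHull_min ?_ isPolyhedron_rootPolytope.convex)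
  · conv_lhs => rw [← isPolyhedron_rootPolytope.convexHull_extremePoints
      (hb.isCompact_rootPolytope (e := e) h𝓑)]
    refine convexHull_mono fun x hx => ?_
    obtain ⟨w, hwW, hdom⟩ := hb.exists_dominant x
    refine ⟨(⟨w⁻¹, inv_mem hwW⟩, ⟨w x, hb.isNestPoint_of_mem_extremePoints h𝓑 hw ?_ hdom⟩),
      w.symm_apply_apply x⟩
    refine ⟨map_mem_rootPolytope hwW hx.1, fun y hy z hz hyz => ?_⟩
    have h1 := hx.2 (map_mem_rootPolytope (inv_mem hwW) hy)
      (map_mem_rootPolytope (inv_mem hwW) hz) (by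
        obtain ⟨s, t, hs, ht, hst, h⟩ := hyz
        refine ⟨s, t, hs, ht, hst, ?_⟩
        rw [← map_smul, ← map_smul, ← map_add, h]
        exact w.symm_apply_apply x)
    rw [← h1]
    exact (w.apply_symm_apply y).symm
  · rintro _ ⟨o, rfl⟩
    exact map_mem_rootPolytope o.1.2 (hb.mem_rootPolytope_of_isNestPoint h𝓑 hw o.2.2)

end IsBase

/-- Nested sets containing the whole set. -/
abbrev TopNested (𝓑 : Set (Finset ι)) : Type _ :=
  {S : Set (Finset ι) // CNested 𝓑 S ∧ Finset.univ ∈ S}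

/-- Incidence of the cells of the polytope, labelled by elements of the reflection group and
nested sets, and its facets. -/
def incidence (Φ : Set V) (b : Basis ι ℝ V) (𝓑 : Set (Finset ι))
    (o : weylGroup Φ × TopNested 𝓑) (a : weylGroup Φ × {B : Finset ι // B ≠ Finset.univ}) : Prop :=
  ((o.1⁻¹ * a.1 : weylGroup Φ) : V ≃ₗᵢ[ℝ] V) (normalVec Φ b 𝓑 a.2) = normalVec Φ b 𝓑 a.2 ∧
    ∀ K ∈ comps 𝓑 a.2, K ∈ o.2.1

/-- A point of an image of the nestohedron matters only through the group element and its tight set,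
and every nested set occurs as a tight set. The resulting relation does not involve `e`. -/
theorem IsBase.nonempty_nonemptyFace_rootPolytope (hb : IsBase Φ b) (h𝓑 : IsRootBuilding b 𝓑)
    (hw : IsWeight 𝓑 (projCoeff Φ b) e) :
    Nonempty (NonemptyFace (rootPolytope Φ b 𝓑 e) ≃o Extents (incidence Φ b 𝓑)) := by
  have := hb.finite_index
  obtain ⟨f⟩ := isPolyhedron_rootPolytope.nonempty_nonemptyFace_orderIso _
    (hb.rootPolytope_eq_convexHull h𝓑 hw)
  have key : ∀ (o : weylGroup Φ × {y : V // IsNestPoint 𝓑 (projCoeff Φ b) e (coords b y)})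
      (j : weylGroup Φ × {B : Finset ι // B ≠ Finset.univ}),
      facetForm Φ b 𝓑 j ((o.1 : V ≃ₗᵢ[ℝ] V) o.2) = lev 𝓑 e j.2 ↔
        incidence Φ b 𝓑 (o.1, ⟨tightSet 𝓑 (projCoeff Φ b) e (coords b o.2),
          hw.cnested_tightSet h𝓑.toIsBuilding o.2.2, h𝓑.univ_mem, o.2.2.eq⟩) j := fun o j => by
    rw [facetForm_apply, hb.inner_map_eq_lev_iff h𝓑 hw o.2.2 o.1.2 j.1.2 j.2.2]
    rfl
  obtain ⟨g⟩ := Extents.nonempty_orderIso_of_surjective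
    (r := fun (o : weylGroup Φ × {y : V // IsNestPoint 𝓑 (projCoeff Φ b) e (coords b y)})
      (j : weylGroup Φ × {B : Finset ι // B ≠ Finset.univ}) =>
      facetForm Φ b 𝓑 j ((o.1 : V ≃ₗᵢ[ℝ] V) o.2) = lev 𝓑 e j.2)
    (r' := incidence Φ b 𝓑)
    (fun o => (o.1, ⟨tightSet 𝓑 (projCoeff Φ b) e (coords b o.2),
      hw.cnested_tightSet h𝓑.toIsBuilding o.2.2, h𝓑.univ_mem, o.2.2.eq⟩)) (by
      rintro ⟨h, S, hS, htop⟩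
      obtain ⟨t, ht, rfl⟩ := hw.exists_tightSet_eq h𝓑.toIsBuilding hS htop
      obtain ⟨y, rfl⟩ := exists_coords_eq b t
      exact ⟨(h, ⟨y, ht⟩), rfl⟩)
    (fun a => Or.inr ⟨{a}, fun o => by rw [key]; simp⟩)
    (fun a => ⟨{a}, fun o => by simp [key]⟩)
  exact ⟨f.trans g⟩

end RootPolytope

end Permutonestohedron

namespace Permutonestohedron

set_option linter.unusedSectionVars false

open scoped InnerProductSpace NNReal
open Module (Basis)

/-! ### The faces attached to disjoint families -/

section CutFace

variable {V : Type*} [NormedAddCommGroup V] [InnerProductSpace ℝ V] [FiniteDimensional ℝ V]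
  {ι : Type*} [Fintype ι] [DecidableEq ι] {κ : Type*} [Fintype κ] [DecidableEq κ]

/-- The product of the parabolic subgroups of a family of sets of simple roots. -/
def cutGroup (Φ : Set V) (b : Basis ι ℝ V) (A : κ → Finset ι) : Subgroup (V ≃ₗᵢ[ℝ] V) :=
  ⨆ i, weylGroup (Φ ∩ basisSpan b (A i))

/-- The face of the polytope on the hyperplane attached to the union of a family. -/
def cutFace (Φ : Set V) (b : Basis ι ℝ V) (𝓑 : Set (Finset ι)) (e : Finset ι → ℝ)
    (A : κ → Finset ι) (σ : V ≃ₗᵢ[ℝ] V) : Set V :=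
  {x ∈ rootPolytope Φ b 𝓑 e | ⟪x, σ (normalVec Φ b 𝓑 (total A))⟫_ℝ = lev 𝓑 e (total A)}

/-- Nested sets that contain the whole set and a given family. -/
abbrev CutNested (𝓑 : Set (Finset ι)) (A : κ → Finset ι) : Type _ :=
  {S : Set (Finset ι) // CNested 𝓑 S ∧ Finset.univ ∈ S ∧ ∀ i, A i ∈ S}

/-- Incidence of the cells of the face with the facets of the polytope. -/
def cutIncidence (Φ : Set V) (b : Basis ι ℝ V) (𝓑 : Set (Finset ι)) (A : κ → Finset ι)
    (o : cutGroup Φ b A × CutNested 𝓑 A) (a : weylGroup Φ × {B : Finset ι // B ≠ Finset.univ}) :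
    Prop :=
  ((o.1 : V ≃ₗᵢ[ℝ] V)⁻¹ * a.1) (normalVec Φ b 𝓑 a.2) = normalVec Φ b 𝓑 a.2 ∧
    ∀ K ∈ comps 𝓑 a.2, K ∈ o.2.1

variable {Φ : Set V} {b : Basis ι ℝ V} {𝓑 : Set (Finset ι)} {e : Finset ι → ℝ} {A : κ → Finset ι}

theorem IsCut.total_ne_univ (hcut : IsCut 𝓑 A) (hu : Finset.univ ∈ 𝓑)
    (hAu : ∀ i, A i ≠ Finset.univ) : total A ≠ Finset.univ := fun h => by
  obtain ⟨i, hi⟩ := hcut.subset _ hu h.ge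
  exact hAu i (Finset.univ_subset_iff.1 hi)

theorem cutGroup_le : cutGroup Φ b A ≤ weylGroup Φ :=
  iSup_le fun _ => Subgroup.closure_mono fun _ ⟨α, hα, h⟩ => ⟨α, hα.1, h⟩

theorem map_eq_self_of_mem_cutGroup {h : V ≃ₗᵢ[ℝ] V} (hh : h ∈ cutGroup Φ b A) {x : V}
    (hx : ∀ i ∈ total A, ⟪b i, x⟫_ℝ = 0) : h x = x := by
  let S : Subgroup (V ≃ₗᵢ[ℝ] V) :=
    { carrier := {h | h x = x}
      mul_mem' := fun {g h} hg hh => (congrArg g hh).trans hg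
      one_mem' := rfl
      inv_mem' := fun {g} hg => (g.symm_apply_eq).2 (Eq.symm hg) }
  suffices H : cutGroup Φ b A ≤ S from H hh
  refine iSup_le fun i => (Subgroup.closure_le _).2 ?_
  rintro _ ⟨α, hα, rfl⟩
  change (ℝ ∙ α)ᗮ.reflection x = x
  have : ⟪α, x⟫_ℝ = 0 := by
    rw [real_inner_comm, inner_eq_sum_repr b]
    refine Finset.sum_eq_zero fun j _ => ?_
    by_cases hj : j ∈ A i
    · rw [hx j (subset_total A i hj), mul_zero]
    · rw [(mem_basisSpan b).1 hα.2 j hj, zero_mul]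
  rw [refl_apply, this, mul_zero, zero_div, zero_smul, sub_zero]

namespace IsBase

variable (hb : IsBase Φ b)

include hb

theorem refl_mem_cutGroup {i : ι} (hi : i ∈ total A) :
    (ℝ ∙ b i)ᗮ.reflection ∈ cutGroup Φ b A := by
  obtain ⟨j, hj⟩ := mem_total.1 hi
  exact le_iSup (fun i => weylGroup (Φ ∩ basisSpan b (A i))) j
    (Subgroup.subset_closure ⟨b i, ⟨hb.mem i, (basis_mem_basisSpan b).2 hj⟩, rfl⟩)

theorem map_normalVec_total (h𝓑 : IsRootBuilding b 𝓑) {h : V ≃ₗᵢ[ℝ] V}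
    (hh : h ∈ cutGroup Φ b A) :
    h (normalVec Φ b 𝓑 (total A)) = normalVec Φ b 𝓑 (total A) :=
  map_eq_self_of_mem_cutGroup hh fun _ hi => hb.inner_normalVec_of_mem h𝓑 hi

theorem isPolyhedron_cutFace (hD : total A ≠ Finset.univ)
    {σ : V ≃ₗᵢ[ℝ] V} (hσ : σ ∈ weylGroup Φ) :
    IsPolyhedron (cutFace Φ b 𝓑 e A σ) (facetForm Φ b 𝓑) (fun j => lev 𝓑 e j.2)
      {(⟨σ, hσ⟩, ⟨total A, hD⟩)} := by
  intro x
  change _ ∧ _ ↔ _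
  rw [isPolyhedron_rootPolytope x]
  simp [facetForm_apply]

theorem isExposed_cutFace (hD : total A ≠ Finset.univ)
    {σ : V ≃ₗᵢ[ℝ] V} (hσ : σ ∈ weylGroup Φ) :
    IsExposed ℝ (rootPolytope Φ b 𝓑 e) (cutFace Φ b 𝓑 e A σ) := by
  have := hb.finite_index
  have h := isPolyhedron_rootPolytope (Φ := Φ) (b := b) (𝓑 := 𝓑) (e := e) |>.isExposed_of_tight
    {(⟨σ, hσ⟩, ⟨total A, hD⟩)}
  simp only [Set.mem_singleton_iff, forall_eq, facetForm_apply] at h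
  exact h

/-- The vertices of the face and, more generally, its cells. -/
theorem map_mem_cutFace (h𝓑 : IsRootBuilding b 𝓑) (hw : IsWeight 𝓑 (projCoeff Φ b) e)
    (hcut : IsCut 𝓑 A) (hD : total A ≠ Finset.univ) {σ : V ≃ₗᵢ[ℝ] V} (hσ : σ ∈ weylGroup Φ)
    {h : V ≃ₗᵢ[ℝ] V} (hh : h ∈ cutGroup Φ b A) {y : V}
    (hy : IsNestPoint 𝓑 (projCoeff Φ b) e (coords b y))
    (hyA : ∀ i, A i ∈ tightSet 𝓑 (projCoeff Φ b) e (coords b y)) :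
    σ (h y) ∈ cutFace Φ b 𝓑 e A σ := by
  have hh' := mul_mem hσ (cutGroup_le hh)
  refine ⟨map_mem_rootPolytope hh' (hb.mem_rootPolytope_of_isNestPoint h𝓑 hw hy), ?_⟩
  refine (hb.inner_map_eq_lev_iff h𝓑 hw hy hh' hσ hD).2 ⟨?_, fun K hK => ?_⟩
  · rw [mul_inv_rev, inv_mul_cancel_right]
    exact hb.map_normalVec_total h𝓑 (inv_mem hh)
  · obtain ⟨i, rfl⟩ := (hcut.comps_total h𝓑.toIsBuilding).1 K hK
    exact hyA i

/-- The face is the hull of the points `g y` on it. Moving `σ⁻¹ g y` by the parabolic subgroup into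
the chamber of the simple roots in the cut makes it dominant, hence equal to `y`, which exhibits `g
y` as `σ h y` for some `h` in that subgroup. -/
theorem cutFace_eq_convexHull (h𝓑 : IsRootBuilding b 𝓑) (hw : IsWeight 𝓑 (projCoeff Φ b) e)
    (hcut : IsCut 𝓑 A) (hD : total A ≠ Finset.univ) {σ : V ≃ₗᵢ[ℝ] V} (hσ : σ ∈ weylGroup Φ) :
    cutFace Φ b 𝓑 e A σ = convexHull ℝ (Set.range
      fun o : cutGroup Φ b A × {y : V // IsNestPoint 𝓑 (projCoeff Φ b) e (coords b y) ∧
        ∀ i, A i ∈ tightSet 𝓑 (projCoeff Φ b) e (coords b y)} => σ ((o.1 : V ≃ₗᵢ[ℝ] V) o.2)) := by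
  refine subset_antisymm ?_ (convexHull_min ?_ (hb.isPolyhedron_cutFace hD hσ).convex)
  · refine (subset_convexHull_inter_of_isExposed (hb.isExposed_cutFace hD hσ)
      (hb.rootPolytope_eq_convexHull h𝓑 hw)).trans (convexHull_mono ?_)
    rintro _ ⟨⟨⟨g, y⟩, rfl⟩, hx⟩
    obtain ⟨h, hh, hdom⟩ := hb.exists_map_inner_nonneg (H := cutGroup Φ b A) cutGroup_le
      (σ⁻¹ ((g : V ≃ₗᵢ[ℝ] V) y.1))
    set z : V := (h * (σ⁻¹ * g)) y.1 with hz
    have hgW : h * (σ⁻¹ * g) ∈ weylGroup Φ :=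
      mul_mem (cutGroup_le hh) (mul_mem (inv_mem hσ) g.2)
    have hyP := hb.mem_rootPolytope_of_isNestPoint h𝓑 hw y.2
    have hypos := hw.pos_of_isNestPoint h𝓑.toIsBuilding y.2
    have hzP : z ∈ rootPolytope Φ b 𝓑 e := map_mem_rootPolytope hgW hyP
    have htight : ⟪z, normalVec Φ b 𝓑 (total A)⟫_ℝ = lev 𝓑 e (total A) := by
      rw [← hx.2]
      change ⟪h (σ⁻¹ ((g : V ≃ₗᵢ[ℝ] V) y.1)), _⟫_ℝ = _
      rw [inner_map_eq, hb.map_normalVec_total h𝓑 (inv_mem hh), inner_map_eq, inv_inv]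
    have hzdom : ∀ i, 0 ≤ ⟪b i, z⟫_ℝ := by
      intro i
      by_cases hi : i ∈ total A
      · exact hdom i (hb.refl_mem_cutGroup hi)
      -- A simple root outside the cut with negative product would violate the inequality of the
      -- reflected normal vector, since the unreflected one is tight.
      · by_contra! hneg
        have h1 := hzP _ (hb.refl_mem_weylGroup i) _ hD
        rw [refl_apply, inner_sub_right, inner_smul_right, htight, real_inner_comm (b i) z] at h1
        have h2 := hb.inner_normalVec_of_notMem (𝓑 := 𝓑) hi
        have h3 := hb.inner_self_pos i
        have h4 := mul_neg_of_pos_of_neg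
          (div_pos (mul_pos two_pos h2) h3) hneg
        linarith
    have hzy : z = y.1 := hb.eq_of_dominant hgW (fun i => (hypos i).le) hzdom
    have hσz : σ (h⁻¹ z) = (g : V ≃ₗᵢ[ℝ] V) y.1 := by
      rw [hz]
      change (σ * (h⁻¹ * (h * (σ⁻¹ * g)))) y.1 = _
      rw [inv_mul_cancel_left, mul_inv_cancel_left]
    refine ⟨(⟨h⁻¹, inv_mem hh⟩, ⟨y.1, y.2, fun i => ?_⟩), ?_⟩
    · rw [hzy] at htight
      have h1 := ((hb.inner_map_eq_lev_iff h𝓑 hw y.2 (one_mem _) (one_mem _) hD).1 htight).2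
      exact h1 _ ((hcut.comps_total h𝓑.toIsBuilding).2 i)
    · change σ (h⁻¹ y.1) = (g : V ≃ₗᵢ[ℝ] V) y.1
      rw [← hσz, hzy]
  · rintro _ ⟨o, rfl⟩
    exact hb.map_mem_cutFace h𝓑 hw hcut hD hσ o.1.2 o.2.2.1 o.2.2.2

theorem nonempty_nonemptyFace_cutFace (h𝓑 : IsRootBuilding b 𝓑)
    (hw : IsWeight 𝓑 (projCoeff Φ b) e) (hcut : IsCut 𝓑 A) (hD : total A ≠ Finset.univ)
    {σ : V ≃ₗᵢ[ℝ] V} (hσ : σ ∈ weylGroup Φ) :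
    Nonempty (NonemptyFace (cutFace Φ b 𝓑 e A σ) ≃o Extents (cutIncidence Φ b 𝓑 A)) := by
  have := hb.finite_index
  obtain ⟨f⟩ := (hb.isPolyhedron_cutFace hD hσ).nonempty_nonemptyFace_orderIso _
    (hb.cutFace_eq_convexHull h𝓑 hw hcut hD hσ)
  set φ : cutGroup Φ b A × {y : V // IsNestPoint 𝓑 (projCoeff Φ b) e (coords b y) ∧
      ∀ i, A i ∈ tightSet 𝓑 (projCoeff Φ b) e (coords b y)} → cutGroup Φ b A × CutNested 𝓑 A :=
    fun o => (o.1, ⟨tightSet 𝓑 (projCoeff Φ b) e (coords b o.2),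
      hw.cnested_tightSet h𝓑.toIsBuilding o.2.2.1, ⟨h𝓑.univ_mem, o.2.2.1.eq⟩, o.2.2.2⟩) with hφ
  -- The element `σ` is absorbed by translating the labels of the hyperplanes.
  have key : ∀ o (j : weylGroup Φ × {B : Finset ι // B ≠ Finset.univ}),
      facetForm Φ b 𝓑 j (σ ((o.1 : V ≃ₗᵢ[ℝ] V) o.2)) = lev 𝓑 e j.2 ↔
        cutIncidence Φ b 𝓑 A (φ o) (⟨σ, hσ⟩⁻¹ * j.1, j.2) := fun o j => by
    rw [facetForm_apply]
    refine (hb.inner_map_eq_lev_iff h𝓑 hw o.2.2.1 (mul_mem hσ (cutGroup_le o.1.2)) j.1.2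
      j.2.2).trans ?_
    rw [mul_inv_rev, mul_assoc]
    rfl
  obtain ⟨g⟩ := Extents.nonempty_orderIso_of_surjective
    (r := fun (o : cutGroup Φ b A × {y : V // IsNestPoint 𝓑 (projCoeff Φ b) e (coords b y) ∧
      ∀ i, A i ∈ tightSet 𝓑 (projCoeff Φ b) e (coords b y)})
      (j : weylGroup Φ × {B : Finset ι // B ≠ Finset.univ}) =>
      facetForm Φ b 𝓑 j (σ ((o.1 : V ≃ₗᵢ[ℝ] V) o.2)) = lev 𝓑 e j.2)
    (r' := cutIncidence Φ b 𝓑 A) φ (by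
      rintro ⟨h, S, hS, htop, hAS⟩
      obtain ⟨t, ht, rfl⟩ := hw.exists_tightSet_eq h𝓑.toIsBuilding hS htop
      obtain ⟨y, rfl⟩ := exists_coords_eq b t
      exact ⟨(h, ⟨y, ht, hAS⟩), rfl⟩)
    (fun a => Or.inr ⟨{(⟨σ, hσ⟩⁻¹ * a.1, a.2)}, fun o => by rw [key]; simp⟩)
    (fun a => ⟨{(⟨σ, hσ⟩ * a.1, a.2)}, fun o => by simp [key]⟩)
  exact ⟨f.trans g⟩

/-- The components of a proper set are proper, so by `e_growth` and superadditivity of powers of two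
the sum of their `e K` stays below the value at the whole set. This makes the origin an interior
point. -/
theorem lev_pos (h𝓑 : IsRootBuilding b 𝓑) (hw : IsWeight 𝓑 (projCoeff Φ b) e) {B : Finset ι}
    (hB : B ≠ Finset.univ) : 0 < lev 𝓑 e B := by
  have hu := hw.e_pos _ h𝓑.univ_mem
  rw [lev, sub_pos]
  by_cases hc : comps 𝓑 B = ∅
  · rwa [hc, Finset.sum_empty]
  have hcne := Finset.nonempty_iff_ne_empty.2 hc
  have h1 : ∀ K ∈ comps 𝓑 B, 2 ^ (Finset.univ : Finset ι).card * e K < 2 ^ K.card * e Finset.univ :=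
    fun K hK => hw.e_growth _ h𝓑.univ_mem K (mem_of_mem_comps hK)
      (Finset.ssubset_univ_iff.2 fun h => hB (Finset.univ_subset_iff.1 (h ▸ subset_of_mem_comps hK)))
  have h2 := Finset.sum_lt_sum_of_nonempty hcne h1
  rw [← Finset.mul_sum, ← Finset.sum_mul] at h2
  have h3 := sum_two_pow_card_le hcne (fun K hK => h𝓑.nonempty K (mem_of_mem_comps hK))
    (h𝓑.pairwiseDisjoint_comps B)
  have h4 : ((comps 𝓑 B).sup id).card ≤ (Finset.univ : Finset ι).card :=
    Finset.card_le_card (Finset.subset_univ _)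
  have h5 : ∑ K ∈ comps 𝓑 B, (2 : ℝ) ^ K.card ≤ 2 ^ (Finset.univ : Finset ι).card := by
    exact_mod_cast h3.trans (Nat.pow_le_pow_right two_pos h4)
  have h6 := mul_le_mul_of_nonneg_right h5 hu.le
  exact lt_of_mul_lt_mul_left (h2.trans_le h6) (by positivity)

theorem vectorSpan_rootPolytope (h𝓑 : IsRootBuilding b 𝓑) (hw : IsWeight 𝓑 (projCoeff Φ b) e) :
    vectorSpan ℝ (rootPolytope Φ b 𝓑 e) = ⊤ := by
  have := hb.finite_index
  have h0 : (0 : V) ∈ rootPolytope Φ b 𝓑 e := fun w _ B hB => by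
    rw [inner_zero_left]
    exact (hb.lev_pos h𝓑 hw hB).le
  rw [eq_top_iff]
  intro v _
  obtain ⟨t, ht, h⟩ := isPolyhedron_rootPolytope.exists_add_smul_mem h0 (v := v) fun j hj => by
    rw [map_zero] at hj
    exact absurd hj (hb.lev_pos h𝓑 hw j.2.2).ne
  have h1 := vsub_mem_vectorSpan ℝ (h t (abs_of_pos ht).le) h0
  rw [vsub_eq_sub, zero_add, sub_zero] at h1
  have h2 := Submodule.smul_mem _ t⁻¹ h1
  rwa [smul_smul, inv_mul_cancel₀ ht.ne', one_smul] at h2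

theorem exists_mem_cutFace (h𝓑 : IsRootBuilding b 𝓑) (hw : IsWeight 𝓑 (projCoeff Φ b) e)
    (hS : CNested 𝓑 (insert Finset.univ (Set.range A))) :
    ∃ y, IsNestPoint 𝓑 (projCoeff Φ b) e (coords b y) ∧
      tightSet 𝓑 (projCoeff Φ b) e (coords b y) = insert Finset.univ (Set.range A) := by
  obtain ⟨t, ht, h⟩ := hw.exists_tightSet_eq h𝓑.toIsBuilding hS (Set.mem_insert _ _)
  obtain ⟨y, rfl⟩ := exists_coords_eq b t
  exact ⟨y, ht, h⟩

theorem vectorSpan_cutFace (h𝓑 : IsRootBuilding b 𝓑) (hw : IsWeight 𝓑 (projCoeff Φ b) e)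
    (hcut : IsCut 𝓑 A) (hD : total A ≠ Finset.univ)
    (hS : CNested 𝓑 (insert Finset.univ (Set.range A)))
    {σ : V ≃ₗᵢ[ℝ] V} (hσ : σ ∈ weylGroup Φ) :
    vectorSpan ℝ (cutFace Φ b 𝓑 e A σ) = (ℝ ∙ σ (normalVec Φ b 𝓑 (total A)))ᗮ := by
  have := hb.finite_index
  have hpoly := hb.isPolyhedron_cutFace (𝓑 := 𝓑) (e := e) hD hσ
  obtain ⟨y, hy, hyS⟩ := hb.exists_mem_cutFace h𝓑 hw hS
  have hyA : ∀ i, A i ∈ tightSet 𝓑 (projCoeff Φ b) e (coords b y) := fun i => by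
    rw [hyS]
    exact Set.mem_insert_of_mem _ ⟨i, rfl⟩
  apply le_antisymm
  · rw [vectorSpan_def, Submodule.span_le]
    rintro _ ⟨x, hx, z, hz, rfl⟩
    rw [SetLike.mem_coe, Submodule.mem_orthogonal_singleton_iff_inner_left]
    change ⟪x - z, _⟫_ℝ = 0
    rw [inner_sub_left, hx.2, hz.2, sub_self]
  · intro v hv
    rw [Submodule.mem_orthogonal_singleton_iff_inner_left] at hv
    -- At a generic point of the face, a tight inequality is tight at all the images of `y` under
    -- the parabolic subgroup. As the tight set of `y` is the given nested set, its `B` lies in the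
    -- union of the cut. As all simple reflections of the cut fix its normal vector, `B` contains
    -- that union. So only the defining inequality is tight, and `x` can be moved freely in its
    -- hyperplane.
    obtain ⟨x, hx, hmin⟩ := isPolyhedron_rootPolytope.exists_tight_minimal hpoly.convex
      (fun x hx => hx.1) ⟨_, hb.map_mem_cutFace h𝓑 hw hcut hD hσ (one_mem _) hy hyA⟩
    obtain ⟨t, ht, h⟩ := isPolyhedron_rootPolytope.exists_add_smul_mem hx.1 (v := v) fun j hj => by
      have h1 : ∀ h ∈ cutGroup Φ b A,
          ((σ * h)⁻¹ * (j.1 : V ≃ₗᵢ[ℝ] V)) (normalVec Φ b 𝓑 j.2) = normalVec Φ b 𝓑 j.2 ∧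
          ∀ K ∈ comps 𝓑 j.2, K ∈ tightSet 𝓑 (projCoeff Φ b) e (coords b y) := fun h hh => by
        have h2 := hmin _ (hb.map_mem_cutFace h𝓑 hw hcut hD hσ hh hy hyA) j hj
        rw [facetForm_apply] at h2
        exact (hb.inner_map_eq_lev_iff h𝓑 hw hy (mul_mem hσ (cutGroup_le hh)) j.1.2 j.2.2).1 h2
      obtain ⟨h2, h3⟩ := h1 1 (one_mem _)
      rw [mul_one] at h2
      have hsub : j.2.1 ⊆ total A := by
        intro i hi
        obtain ⟨K, hK, hiK⟩ := h𝓑.exists_mem_comps hi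
        have h4 := h3 K hK
        rw [hyS] at h4
        rcases h4 with rfl | ⟨k, rfl⟩
        · exact absurd (Finset.univ_subset_iff.1 (subset_of_mem_comps hK)) j.2.2
        · exact subset_total A k hiK
      have hsup : total A ⊆ j.2.1 := by
        intro i hi
        have h5 := (h1 _ (hb.refl_mem_cutGroup hi)).1
        rw [mul_inv_rev, mul_assoc] at h5
        change ((ℝ ∙ b i)ᗮ.reflection)⁻¹ ((σ⁻¹ * (j.1 : V ≃ₗᵢ[ℝ] V)) _) = _ at h5
        rw [h2, inv_eq_of_mul_eq_one_left (refl_mul_self _), refl_apply, sub_eq_self,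
          smul_eq_zero_iff_left (b.ne_zero i), div_eq_zero_iff,
          or_iff_left (hb.inner_self_pos i).ne', mul_eq_zero, or_iff_right two_ne_zero,
          hb.inner_normalVec_eq_zero h𝓑] at h5
        exact h5
      have hB : j.2.1 = total A := hsub.antisymm hsup
      have h6 : (j.1 : V ≃ₗᵢ[ℝ] V) (normalVec Φ b 𝓑 j.2) = σ (normalVec Φ b 𝓑 (total A)) := by
        rw [← hB]
        conv_rhs => rw [← h2]
        exact (σ.apply_symm_apply _).symm
      rw [facetForm_apply, h6, hv]
    have hmem : x + t • v ∈ cutFace Φ b 𝓑 e A σ := by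
      refine ⟨h t (abs_of_pos ht).le, ?_⟩
      rw [inner_add_left, inner_smul_left, hv, mul_zero, add_zero, hx.2]
    have h1 := vsub_mem_vectorSpan ℝ hmem hx
    rw [vsub_eq_sub, add_sub_cancel_left] at h1
    have h2 := Submodule.smul_mem _ t⁻¹ h1
    rwa [smul_smul, inv_mul_cancel₀ ht.ne', one_smul] at h2

theorem isFacet_cutFace (h𝓑 : IsRootBuilding b 𝓑) (hw : IsWeight 𝓑 (projCoeff Φ b) e)
    (hcut : IsCut 𝓑 A) (hD : total A ≠ Finset.univ)
    (hS : CNested 𝓑 (insert Finset.univ (Set.range A)))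
    {σ : V ≃ₗᵢ[ℝ] V} (hσ : σ ∈ weylGroup Φ) :
    IsFacet (rootPolytope Φ b 𝓑 e) (cutFace Φ b 𝓑 e A σ) := by
  obtain ⟨y, hy, hyS⟩ := hb.exists_mem_cutFace h𝓑 hw hS
  refine ⟨⟨_, hb.map_mem_cutFace h𝓑 hw hcut hD hσ (one_mem _) hy fun i => ?_⟩,
    hb.isExposed_cutFace hD hσ, ?_⟩
  · rw [hyS]
    exact Set.mem_insert_of_mem _ ⟨i, rfl⟩
  · rw [hb.vectorSpan_cutFace h𝓑 hw hcut hD hS hσ, hb.vectorSpan_rootPolytope h𝓑 hw, finrank_top,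
      ← Submodule.finrank_add_finrank_orthogonal (ℝ ∙ σ (normalVec Φ b 𝓑 (total A))),
      finrank_span_singleton, add_comm]
    obtain ⟨i, hi⟩ : ∃ i, i ∉ total A := by
      by_contra! h
      exact hD (Finset.eq_univ_iff_forall.2 h)
    intro h
    rw [map_eq_zero_iff σ σ.injective] at h
    have := hb.inner_normalVec_of_notMem (𝓑 := 𝓑) hi
    rw [h, inner_zero_right] at this
    exact lt_irrefl _ this

end IsBase

theorem labelGroup_eq_cutGroup :
    labelGroup Φ (Set.range fun i => basisSpan b (A i)) = cutGroup Φ b A := by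
  rw [labelGroup, iSup_range]
  rfl

theorem labelledFace_eq_cutFace {G : Set (Submodule ℝ V)} (hb : IsBase Φ b)
    (h𝓑 : IsRootBuilding b (fundSet b G)) {ε : ℕ → ℝ}
    (hw : IsWeight (fundSet b G) (projCoeff Φ b) fun B => ε B.card)
    (hcut : IsCut (fundSet b G) A) (hD : total A ≠ Finset.univ) {σ : V ≃ₗᵢ[ℝ] V}
    (hσ : σ ∈ weylGroup Φ) :
    labelledFace Φ (Set.range b) G ε σ (insert ⊤ (Set.range fun i => basisSpan b (A i)))
        (Set.range fun i => basisSpan b (A i)) =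
      cutFace Φ b (fundSet b G) (fun B => ε B.card) A σ := by
  have himg : insert ⊤ (Set.range fun i => basisSpan b (A i)) =
      basisSpan b '' insert Finset.univ (Set.range A) := by
    rw [Set.image_insert_eq, basisSpan_univ, ← Set.range_comp]
    rfl
  have hsub : insert Finset.univ (Set.range A) ⊆ fundSet b G := by
    rw [Set.insert_subset_iff]
    refine ⟨h𝓑.univ_mem, ?_⟩
    rintro _ ⟨i, rfl⟩
    exact hcut.mem i
  rw [labelledFace, labelGroup_eq_cutGroup, hb.cutFace_eq_convexHull h𝓑 hw hcut hD hσ, himg]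
  have := LinearMap.image_convexHull (𝕜 := ℝ) (σ.toLinearEquiv : V →ₗ[ℝ] V)
    (⋃ h ∈ cutGroup Φ b A, h '' nestedFace Φ (Set.range b) G ε
      (basisSpan b '' insert Finset.univ (Set.range A)))
  refine Eq.trans this ?_
  congr 1
  ext x
  constructor
  · rintro ⟨z, hz, rfl⟩
    simp only [Set.mem_iUnion] at hz
    obtain ⟨h, hh, y, hy, rfl⟩ := hz
    rw [mem_nestedFace_iff ε hsub] at hy
    exact ⟨(⟨h, hh⟩, ⟨y, hy.1, fun i => hy.2 (Set.mem_insert_of_mem _ ⟨i, rfl⟩)⟩), rfl⟩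
  · rintro ⟨⟨⟨h, hh⟩, y, hy, hyA⟩, rfl⟩
    refine ⟨h y, ?_, rfl⟩
    simp only [Set.mem_iUnion]
    refine ⟨h, hh, y, (mem_nestedFace_iff ε hsub).2 ⟨hy, ?_⟩, rfl⟩
    rw [Set.insert_subset_iff]
    refine ⟨⟨h𝓑.univ_mem, hy.eq⟩, ?_⟩
    rintro _ ⟨i, rfl⟩
    exact hyA i

end CutFace

end Permutonestohedron

namespace Permutonestohedron

set_option linter.unusedSectionVars false

open scoped InnerProductSpace NNReal
open Module (Basis)

/-! ### Restriction to a subspace spanned by simple roots -/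

section Restriction

variable {V : Type*} [NormedAddCommGroup V] [InnerProductSpace ℝ V] [FiniteDimensional ℝ V]
  {ι : Type*} [Fintype ι] [DecidableEq ι]

/-- The simple roots in `X` as a basis of the subspace that they span. -/
noncomputable def subBasis (b : Basis ι ℝ V) (X : Finset ι) : Basis X ℝ (basisSpan b X) :=
  Basis.mk (v := fun i : X => ⟨b i, (basis_mem_basisSpan b).2 i.2⟩)
    (LinearIndependent.of_comp (basisSpan b X).subtype
      (b.linearIndependent.comp ((↑) : X → ι) Subtype.val_injective)) (by
      rintro ⟨x, hx⟩ -
      have h : (⟨x, hx⟩ : basisSpan b X) =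
          ∑ i : X, b.repr x i • (⟨b i, (basis_mem_basisSpan b).2 i.2⟩ : basisSpan b X) := by
        refine Subtype.ext ?_
        rw [AddSubmonoidClass.coe_finsetSum]
        refine (b.sum_repr x).symm.trans ((Finset.sum_subset (Finset.subset_univ X)
          fun i _ hi => ?_).symm.trans (Finset.sum_coe_sort X fun i => b.repr x i • b i).symm)
        rw [(mem_basisSpan b).1 hx i hi, zero_smul]
      rw [h]
      exact Submodule.sum_mem _ fun i _ =>
        Submodule.smul_mem _ _ (Submodule.subset_span ⟨i, rfl⟩))

theorem coe_subBasis (b : Basis ι ℝ V) (X : Finset ι) (i : X) : (subBasis b X i : V) = b i := by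
  rw [subBasis, Basis.mk_apply]

theorem repr_subBasis (b : Basis ι ℝ V) (X : Finset ι) (x : basisSpan b X) (i : X) :
    (subBasis b X).repr x i = b.repr x i := by
  conv_rhs => rw [← (subBasis b X).sum_repr x]
  rw [AddSubmonoidClass.coe_finsetSum, map_sum, Finsupp.finsetSum_apply,
    Finset.sum_eq_single i]
  · simp [coe_subBasis]
  · intro j _ hj
    have : (j : ι) ≠ i := fun h => hj (Subtype.ext h)
    simp [coe_subBasis, this]
  · simp

theorem range_subBasis (b : Basis ι ℝ V) (X : Finset ι) :
    ((↑) ⁻¹' Set.range b : Set (basisSpan b X)) = Set.range (subBasis b X) := by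
  ext ⟨x, hx⟩
  constructor
  · rintro ⟨i, rfl⟩
    exact ⟨⟨i, (basis_mem_basisSpan b).1 hx⟩, Subtype.ext (coe_subBasis b X _)⟩
  · rintro ⟨i, hi⟩
    refine ⟨i, ?_⟩
    rw [← coe_subBasis b X i, hi]

theorem map_subtype_basisSpan (b : Basis ι ℝ V) (X : Finset ι) (B : Finset X) :
    (basisSpan (subBasis b X) B).map (basisSpan b X).subtype =
      basisSpan b (B.map (Function.Embedding.subtype _)) := by
  change Submodule.map _ (Submodule.span ℝ (subBasis b X '' B)) = Submodule.span ℝ (b '' _)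
  rw [Submodule.map_span, ← Set.image_comp, Finset.coe_map,
    ← Set.image_comp]
  congr 1
  exact Set.image_congr fun i _ => coe_subBasis b X i

theorem fundSet_restrictBuilding (b : Basis ι ℝ V) (G : Set (Submodule ℝ V)) (X : Finset ι) :
    fundSet (subBasis b X) (restrictBuilding G (basisSpan b X)) =
      {B | B.map (Function.Embedding.subtype _) ∈ fundSet b G} := by
  ext B
  change (basisSpan (subBasis b X) B).map _ ∈ G ↔ basisSpan b _ ∈ G
  rw [map_subtype_basisSpan]

variable {Φ : Set V} {b : Basis ι ℝ V} {𝓑 : Set (Finset ι)}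

theorem coe_refl {U : Submodule ℝ V} (α x : U) :
    (((ℝ ∙ α)ᗮ.reflection x : U) : V) = (ℝ ∙ (α : V))ᗮ.reflection (x : V) := by
  rw [refl_apply, refl_apply]
  rfl

theorem IsBase.isBase_subBasis (hb : IsBase Φ b) (X : Finset ι) :
    IsBase ((↑) ⁻¹' Φ : Set (basisSpan b X)) (subBasis b X) where
  root :=
    { finite := hb.root.finite.preimage Subtype.val_injective.injOn
      span_eq_top := by
        rw [eq_top_iff, ← (subBasis b X).span_eq]
        refine Submodule.span_mono ?_
        rintro _ ⟨i, rfl⟩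
        change (subBasis b X i : V) ∈ Φ
        rw [coe_subBasis]
        exact hb.mem i
      zero_notMem := hb.root.zero_notMem
      reduced := fun α hα c hc => hb.root.reduced α hα c hc
      reflection_mem := fun α hα β hβ => by
        change (((ℝ ∙ α)ᗮ.reflection β : basisSpan b X) : V) ∈ Φ
        rw [coe_refl]
        exact hb.root.reflection_mem α hα β hβ }
  mem i := by
    change (subBasis b X i : V) ∈ Φ
    rw [coe_subBasis]
    exact hb.mem i
  sign α hα := by
    simp only [repr_subBasis]
    exact (hb.sign α hα).imp (fun h i => h i) fun h i => h i

theorem IsRootBuilding.isRootBuilding_subBasis (h𝓑 : IsRootBuilding b 𝓑) {X : Finset ι} (hX : X ∈ 𝓑) :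
    IsRootBuilding (subBasis b X) {B : Finset X | B.map (Function.Embedding.subtype _) ∈ 𝓑} where
  nonempty B hB := Finset.map_nonempty.1 (h𝓑.nonempty _ hB)
  singleton i := by
    change Finset.map _ {i} ∈ 𝓑
    rw [Finset.map_singleton]
    exact h𝓑.singleton _
  union B hB C hC h := by
    change Finset.map _ (B ∪ C) ∈ 𝓑
    rw [Finset.map_union]
    exact h𝓑.union _ hB _ hC fun h' => h ((Finset.disjoint_map _).1 h')
  univ_mem := by
    change Finset.map _ Finset.univ ∈ 𝓑
    convert hX
    ext i
    simp
  pair_mem i j h := by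
    change Finset.map _ {i, j} ∈ 𝓑
    rw [Finset.map_insert, Finset.map_singleton]
    refine h𝓑.pair_mem _ _ ?_
    have h' : ⟪(subBasis b X i : V), (subBasis b X j : V)⟫_ℝ ≠ 0 := h
    rwa [coe_subBasis, coe_subBasis] at h'

end Restriction

/-! ### The parabolic subgroup of a disjoint family -/

section Parabolic

variable {V : Type*} [NormedAddCommGroup V] [InnerProductSpace ℝ V] [FiniteDimensional ℝ V]
  {ι : Type*} [Fintype ι] [DecidableEq ι] {κ : Type*} [Fintype κ] [DecidableEq κ]
  {Φ : Set V} {b : Basis ι ℝ V} {𝓑 : Set (Finset ι)} {A : κ → Finset ι}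

/-- The restriction of `h` to the subspace `U` is `g`. -/
def Restricts {U : Submodule ℝ V} (h : V ≃ₗᵢ[ℝ] V) (g : U ≃ₗᵢ[ℝ] U) : Prop :=
  ∀ x : U, h x = g x

namespace Restricts

variable {U : Submodule ℝ V} {h h' : V ≃ₗᵢ[ℝ] V} {g g' : U ≃ₗᵢ[ℝ] U}

theorem one : Restricts (1 : V ≃ₗᵢ[ℝ] V) (1 : U ≃ₗᵢ[ℝ] U) := fun _ => rfl

theorem mul (hg : Restricts h g) (hg' : Restricts h' g') : Restricts (h * h') (g * g') := fun x => by
  change h (h' x) = g (g' x)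
  rw [hg', hg]

theorem inv (hg : Restricts h g) : Restricts h⁻¹ g⁻¹ := fun x => by
  have h1 := hg (g⁻¹ x)
  have h2 : g (g⁻¹ x) = x := g.apply_symm_apply x
  rw [h2] at h1
  rw [← h1]
  exact h.symm_apply_apply _

theorem unique (hg : Restricts h g) (hg' : Restricts h g') : g = g' := by
  ext x
  rw [← hg x, hg' x]

end Restricts

/-- A non-orthogonal pair of simple roots from `A i` and `A j` would be a member inside the union of
the cut, hence inside a single member of the cut. -/
theorem IsCut.inner_eq_zero (h𝓑 : IsRootBuilding b 𝓑) (hcut : IsCut 𝓑 A) {i j : κ} (hij : i ≠ j)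
    {x y : V} (hx : x ∈ basisSpan b (A i)) (hy : y ∈ basisSpan b (A j)) : ⟪x, y⟫_ℝ = 0 := by
  have hbb : ∀ k ∈ A i, ∀ l ∈ A j, ⟪b k, b l⟫_ℝ = 0 := by
    intro k hk l hl
    by_contra h
    obtain ⟨m, hm⟩ := hcut.subset _ (h𝓑.pair_mem k l h) (by
      simp [Finset.insert_subset_iff, subset_total A i hk, subset_total A j hl])
    have h1 : i = m := by
      by_contra hne
      exact Finset.disjoint_left.1 (hcut.disjoint i m hne) hk (hm (by simp))
    have h2 : j = m := by
      by_contra hne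
      exact Finset.disjoint_left.1 (hcut.disjoint j m hne) hl (hm (by simp))
    exact hij (h1.trans h2.symm)
  rw [inner_eq_sum_repr b]
  refine Finset.sum_eq_zero fun l _ => ?_
  by_cases hl : l ∈ A j
  · rw [inner_eq_sum_repr b, Finset.sum_eq_zero, mul_zero]
    intro k _
    by_cases hk : k ∈ A i
    · rw [hbb k hk l hl, mul_zero]
    · rw [(mem_basisSpan b).1 hx k hk, zero_mul]
  · rw [(mem_basisSpan b).1 hy l hl, zero_mul]

theorem exists_restricts (h𝓑 : IsRootBuilding b 𝓑) (hcut : IsCut 𝓑 A) {h : V ≃ₗᵢ[ℝ] V}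
    (hh : h ∈ cutGroup Φ b A) (i : κ) :
    ∃ g ∈ weylGroup ((↑) ⁻¹' Φ : Set (basisSpan b (A i))), Restricts h g := by
  let S : Subgroup (V ≃ₗᵢ[ℝ] V) :=
    { carrier := {h | ∃ g ∈ weylGroup ((↑) ⁻¹' Φ : Set (basisSpan b (A i))), Restricts h g}
      mul_mem' := fun ⟨g, hg, h⟩ ⟨g', hg', h'⟩ => ⟨g * g', mul_mem hg hg', h.mul h'⟩
      one_mem' := ⟨1, one_mem _, .one⟩
      inv_mem' := fun ⟨g, hg, h⟩ => ⟨g⁻¹, inv_mem hg, h.inv⟩ }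
  suffices H : cutGroup Φ b A ≤ S from H hh
  refine iSup_le fun j => (Subgroup.closure_le _).2 ?_
  rintro _ ⟨α, ⟨hα, hαU⟩, rfl⟩
  by_cases hij : i = j
  · subst hij
    exact ⟨_, Subgroup.subset_closure ⟨⟨α, hαU⟩, hα, rfl⟩, fun x => (coe_refl ⟨α, hαU⟩ x).symm⟩
  · refine ⟨1, one_mem _, fun x => ?_⟩
    rw [refl_apply, hcut.inner_eq_zero h𝓑 (Ne.symm hij) hαU x.2, mul_zero, zero_div, zero_smul,
      sub_zero]
    rfl

theorem exists_extension (h𝓑 : IsRootBuilding b 𝓑) (hcut : IsCut 𝓑 A) {i : κ}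
    {g : basisSpan b (A i) ≃ₗᵢ[ℝ] basisSpan b (A i)}
    (hg : g ∈ weylGroup ((↑) ⁻¹' Φ : Set (basisSpan b (A i)))) :
    ∃ h ∈ cutGroup Φ b A, Restricts h g ∧
      ∀ j, j ≠ i → Restricts h (1 : basisSpan b (A j) ≃ₗᵢ[ℝ] basisSpan b (A j)) := by
  induction hg using Subgroup.closure_induction with
  | mem g hg =>
    obtain ⟨α, hα, rfl⟩ := hg
    refine ⟨(ℝ ∙ (α : V))ᗮ.reflection, le_iSup (fun i => weylGroup (Φ ∩ basisSpan b (A i))) i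
      (Subgroup.subset_closure ⟨α, ⟨hα, α.2⟩, rfl⟩), fun x => (coe_refl α x).symm,
      fun j hj x => ?_⟩
    rw [refl_apply, hcut.inner_eq_zero h𝓑 hj.symm α.2 x.2, mul_zero, zero_div, zero_smul,
      sub_zero]
    rfl
  | one => exact ⟨1, one_mem _, .one, fun _ _ => .one⟩
  | mul g g' _ _ ih ih' =>
    obtain ⟨h, h1, h2, h3⟩ := ih
    obtain ⟨h', h1', h2', h3'⟩ := ih'
    exact ⟨h * h', mul_mem h1 h1', h2.mul h2', fun j hj => by
      simpa using (h3 j hj).mul (h3' j hj)⟩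
  | inv g _ ih =>
    obtain ⟨h, h1, h2, h3⟩ := ih
    exact ⟨h⁻¹, inv_mem h1, h2.inv, fun j hj => by simpa using (h3 j hj).inv⟩

theorem exists_extension_pi (h𝓑 : IsRootBuilding b 𝓑) (hcut : IsCut 𝓑 A)
    (g : ∀ i, basisSpan b (A i) ≃ₗᵢ[ℝ] basisSpan b (A i))
    (hg : ∀ i, g i ∈ weylGroup ((↑) ⁻¹' Φ : Set (basisSpan b (A i)))) :
    ∃ h ∈ cutGroup Φ b A, ∀ i, Restricts h (g i) := by
  suffices H : ∀ s : Finset κ, ∃ h ∈ cutGroup Φ b A, (∀ i ∈ s, Restricts h (g i)) ∧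
      ∀ i ∉ s, Restricts h (1 : basisSpan b (A i) ≃ₗᵢ[ℝ] basisSpan b (A i)) by
    obtain ⟨h, h1, h2, -⟩ := H Finset.univ
    exact ⟨h, h1, fun i => h2 i (Finset.mem_univ i)⟩
  intro s
  induction s using Finset.induction_on with
  | empty => exact ⟨1, one_mem _, by simp, fun _ _ => .one⟩
  | insert i s hi ih =>
    obtain ⟨h, h1, h2, h3⟩ := ih
    obtain ⟨h', h1', h2', h3'⟩ := exists_extension h𝓑 hcut (hg i)
    refine ⟨h * h', mul_mem h1 h1', fun j hj => ?_, fun j hj => ?_⟩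
    · rcases Finset.mem_insert.1 hj with rfl | hj
      · simpa using (h3 j hi).mul h2'
      · simpa using (h2 j hj).mul (h3' j fun h => hi (h ▸ hj))
    · rw [Finset.mem_insert, not_or] at hj
      simpa using (h3 j hj.2).mul (h3' j hj.1)

/-- An element of the parabolic subgroup fixes a dominant vector if and only if its restrictions
fix dominant vectors with the corresponding zero sets. -/
theorem IsBase.map_eq_self_iff (hb : IsBase Φ b) (h𝓑 : IsRootBuilding b 𝓑) (hcut : IsCut 𝓑 A)
    {h : V ≃ₗᵢ[ℝ] V} (hh : h ∈ cutGroup Φ b A)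
    {g : ∀ i, basisSpan b (A i) ≃ₗᵢ[ℝ] basisSpan b (A i)}
    (hg : ∀ i, g i ∈ weylGroup ((↑) ⁻¹' Φ : Set (basisSpan b (A i))))
    (hres : ∀ i, Restricts h (g i)) {x : V} (hx : ∀ k, 0 ≤ ⟪b k, x⟫_ℝ)
    {y : ∀ i, basisSpan b (A i)} (hy : ∀ i k, 0 ≤ ⟪subBasis b (A i) k, y i⟫_ℝ)
    (hxy : ∀ i (k : A i), ⟪b k, x⟫_ℝ = 0 ↔ ⟪subBasis b (A i) k, y i⟫_ℝ = 0) :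
    h x = x ↔ ∀ i, g i (y i) = y i := by
  set p : ∀ i, basisSpan b (A i) := fun i => (basisSpan b (A i)).orthogonalProjectionOnto x with hp
  have hpi : ∀ i (z : basisSpan b (A i)), ⟪z, p i⟫_ℝ = ⟪(z : V), x⟫_ℝ := fun i z =>
    Submodule.inner_orthogonalProjectionOnto_eq_of_mem_left z x
  have hpb : ∀ i (k : A i), ⟪subBasis b (A i) k, p i⟫_ℝ = ⟪b k, x⟫_ℝ := fun i k => by
    rw [hpi, coe_subBasis]
  -- The projection of `x` and `y i` are dominant and orthogonal to the same simple roots, so the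
  -- same group elements fix them.
  have hiff : ∀ i, g i (p i) = p i ↔ g i (y i) = y i := fun i => by
    constructor
    · intro h1
      exact (hb.isBase_subBasis (A i)).map_eq_self_of_map_eq_self (hg i)
        (fun k => hpb i k ▸ hx k) h1 fun k hk => (hxy i k).1 (hpb i k ▸ hk)
    · intro h1
      exact (hb.isBase_subBasis (A i)).map_eq_self_of_map_eq_self (hg i) (hy i) h1 fun k hk =>
        (hpb i k).trans ((hxy i k).2 hk)
  rw [← forall_congr' hiff]
  constructor
  · intro h1 i
    refine ext_inner_left ℝ fun z => ?_
    have h2 : ⟪z, g i (p i)⟫_ℝ = ⟪(g i)⁻¹ z, p i⟫_ℝ := by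
      rw [inner_map_eq, inv_inv]
    rw [h2, hpi, hpi, ← (hres i).inv z, inner_map_eq, inv_inv, h1]
  · intro h1
    have h2 : h (∑ i, (p i : V)) = ∑ i, (p i : V) := by
      rw [map_sum]
      exact Finset.sum_congr rfl fun i _ => by rw [hres i, h1 i]
    -- What remains after removing the projections is orthogonal to every simple root of the cut and
    -- is fixed by the whole parabolic subgroup.
    have h3 : h (x - ∑ i, (p i : V)) = x - ∑ i, (p i : V) := by
      refine map_eq_self_of_mem_cutGroup hh fun k hk => ?_
      obtain ⟨i, hi⟩ := mem_total.1 hk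
      rw [inner_sub_right, inner_sum, Finset.sum_eq_single i, sub_eq_zero]
      · have := hpb i ⟨k, hi⟩
        rw [← this, ← coe_subBasis b (A i) ⟨k, hi⟩]
        rfl
      · exact fun j _ hj => hcut.inner_eq_zero h𝓑 hj.symm ((basis_mem_basisSpan b).2 hi) (p j).2
      · exact fun h => absurd (Finset.mem_univ i) h
    rw [map_sub, h2, sub_left_inj] at h3
    exact h3

end Parabolic

end Permutonestohedron

namespace Permutonestohedron

set_option linter.unusedSectionVars false

open scoped InnerProductSpace NNReal
open Module (Basis)

/-! ### Quotients -/

section Quotient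

variable {M : Type*} [AddCommGroup M] [Module ℝ M] {ι ι' : Type*} [Fintype ι] [DecidableEq ι]
  [Fintype ι'] [DecidableEq ι']

/-- The basis of the quotient by the span of some basis vectors, given by the other ones. -/
noncomputable def quotBasis (b : Basis ι ℝ M) (D : Finset ι) (f : ι' ↪ ι)
    (hf : ∀ i, i ∈ Set.range f ↔ i ∉ D) : Basis ι' ℝ (M ⧸ basisSpan b D) :=
  Basis.mk (v := fun i => (basisSpan b D).mkQ (b (f i))) (by
    rw [Fintype.linearIndependent_iff]
    intro c hc i
    have h1 : ∑ j, c j • b (f j) ∈ basisSpan b D := by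
      rw [← (basisSpan b D).ker_mkQ, LinearMap.mem_ker, map_sum, ← hc]
      exact Finset.sum_congr rfl fun j _ => map_smul _ _ _
    have h2 := (mem_basisSpan b).1 h1 (f i) ((hf _).1 ⟨i, rfl⟩)
    rw [map_sum, Finsupp.finsetSum_apply, Finset.sum_eq_single i] at h2
    · simpa using h2
    · intro j _ hj
      simp [hj]
    · simp) (by
    rw [← LinearMap.range_eq_top.2 (basisSpan b D).mkQ_surjective, ← Submodule.map_top, ← b.span_eq,
      Submodule.map_span, Submodule.span_le]
    rintro _ ⟨_, ⟨i, rfl⟩, rfl⟩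
    by_cases hi : i ∈ D
    · have h0 : (basisSpan b D).mkQ (b i) = 0 := by
        rw [← LinearMap.mem_ker, Submodule.ker_mkQ]
        exact (basis_mem_basisSpan b).2 hi
      rw [h0]
      exact Submodule.zero_mem _
    · obtain ⟨j, rfl⟩ := (hf i).2 hi
      exact Submodule.subset_span ⟨j, rfl⟩)

theorem quotBasis_apply (b : Basis ι ℝ M) (D : Finset ι) (f : ι' ↪ ι)
    (hf : ∀ i, i ∈ Set.range f ↔ i ∉ D) (i : ι') :
    quotBasis b D f hf i = (basisSpan b D).mkQ (b (f i)) := by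
  rw [quotBasis, Basis.mk_apply]

theorem map_mkQ_basisSpan (b : Basis ι ℝ M) (D : Finset ι) (f : ι' ↪ ι)
    (hf : ∀ i, i ∈ Set.range f ↔ i ∉ D) {C : Finset ι} {Q : Finset ι'} (h : C \ D = Q.map f) :
    (basisSpan b C).map (basisSpan b D).mkQ = basisSpan (quotBasis b D f hf) Q := by
  apply le_antisymm
  · change Submodule.map _ (Submodule.span ℝ (b '' C)) ≤ _
    rw [Submodule.map_span, Submodule.span_le]
    rintro _ ⟨_, ⟨i, hi, rfl⟩, rfl⟩
    by_cases hiD : i ∈ D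
    · have h0 : (basisSpan b D).mkQ (b i) = 0 := by
        rw [← LinearMap.mem_ker, Submodule.ker_mkQ]
        exact (basis_mem_basisSpan b).2 hiD
      rw [h0]
      exact Submodule.zero_mem _
    · have hi' : i ∈ Q.map f := h ▸ Finset.mem_sdiff.2 ⟨hi, hiD⟩
      obtain ⟨j, hj, rfl⟩ := Finset.mem_map.1 hi'
      rw [← quotBasis_apply b D f hf]
      exact (basis_mem_basisSpan _).2 hj
  · change Submodule.span ℝ (quotBasis b D f hf '' Q) ≤ _
    rw [Submodule.span_le]
    rintro _ ⟨j, hj, rfl⟩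
    rw [quotBasis_apply]
    refine ⟨_, (basis_mem_basisSpan b).2 ?_, rfl⟩
    have : f j ∈ C \ D := h ▸ Finset.mem_map_of_mem f hj
    exact (Finset.mem_sdiff.1 this).1

theorem exists_sdiff_eq_map (D : Finset ι) (f : ι' ↪ ι) (hf : ∀ i, i ∈ Set.range f ↔ i ∉ D)
    (C : Finset ι) : ∃ Q : Finset ι', C \ D = Q.map f := by
  obtain ⟨Q, -, hQ⟩ := Finset.subset_map_iff.1 (show C \ D ⊆ Finset.univ.map f from fun i hi => by
    obtain ⟨j, rfl⟩ := (hf i).2 (Finset.mem_sdiff.1 hi).2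
    exact Finset.mem_map_of_mem f (Finset.mem_univ j))
  exact ⟨Q, hQ⟩

theorem quotientBuilding_eq (b : Basis ι ℝ M) (𝓑 : Set (Finset ι)) (D : Finset ι) (f : ι' ↪ ι)
    (hf : ∀ i, i ∈ Set.range f ↔ i ∉ D) :
    quotientBuilding (basisSpan b '' 𝓑) (basisSpan b D) =
      basisSpan (quotBasis b D f hf) '' {Q | Q.map f ∈ contr 𝓑 D} := by
  ext K
  constructor
  · rintro ⟨hK, _, ⟨B, hB, rfl⟩, rfl⟩
    obtain ⟨Q, hQ⟩ := exists_sdiff_eq_map D f hf B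
    rw [map_mkQ_basisSpan b D f hf hQ] at hK ⊢
    refine ⟨Q, ⟨?_, B, hB, hQ⟩, rfl⟩
    rw [Finset.map_nonempty]
    by_contra h
    rw [Finset.not_nonempty_iff_eq_empty] at h
    exact hK (by rw [h, basisSpan_empty])
  · rintro ⟨Q, ⟨hne, B, hB, hQ⟩, rfl⟩
    refine ⟨fun h => ?_, _, ⟨B, hB, rfl⟩, map_mkQ_basisSpan b D f hf hQ⟩
    rw [← basisSpan_empty (quotBasis b D f hf)] at h
    rw [basisSpan_injective _ h] at hne
    simp at hne

theorem isBuilding_contr {𝓑 : Set (Finset ι)} (h𝓑 : IsBuilding 𝓑) (D : Finset ι) (f : ι' ↪ ι)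
    (hf : ∀ i, i ∈ Set.range f ↔ i ∉ D) : IsBuilding {Q | Q.map f ∈ contr 𝓑 D} where
  nonempty Q hQ := Finset.map_nonempty.1 hQ.1
  singleton i := by
    refine ⟨by simp, {f i}, h𝓑.singleton _, ?_⟩
    rw [Finset.map_singleton]
    exact Finset.sdiff_eq_self_of_disjoint (Finset.disjoint_singleton_left.2 ((hf _).1 ⟨i, rfl⟩))
  union Q hQ Q' hQ' h := by
    obtain ⟨hne, B, hB, hBQ⟩ := hQ
    obtain ⟨-, B', hB', hBQ'⟩ := hQ'
    change Finset.map f (Q ∪ Q') ∈ contr 𝓑 D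
    rw [Finset.map_union]
    refine ⟨hne.mono Finset.subset_union_left, B ∪ B', h𝓑.union B hB B' hB' fun hd => h ?_, ?_⟩
    · rw [← Finset.disjoint_map f, ← hBQ, ← hBQ']
      exact hd.mono Finset.sdiff_subset Finset.sdiff_subset
    · rw [Finset.union_sdiff_distrib, hBQ, hBQ']

theorem univ_mem_contr {𝓑 : Set (Finset ι)} (hu : Finset.univ ∈ 𝓑) {D : Finset ι}
    (hD : D ≠ Finset.univ) (f : ι' ↪ ι) (hf : ∀ i, i ∈ Set.range f ↔ i ∉ D) :
    (Finset.univ : Finset ι').map f ∈ contr 𝓑 D ∧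
      Finset.univ \ D = (Finset.univ : Finset ι').map f := by
  have h : Finset.univ \ D = (Finset.univ : Finset ι').map f := by
    ext i
    have := hf i
    simp only [Set.mem_range] at this
    simp [this]
  refine ⟨⟨?_, _, hu, h⟩, h⟩
  rw [← h, Finset.sdiff_nonempty]
  exact fun h => hD (Finset.univ_subset_iff.1 h)

end Quotient

/-! ### Nestohedra -/

section Nestohedra

variable {ι : Type*} [Fintype ι] [DecidableEq ι] {𝓑 : Set (Finset ι)}

/-- Membership in nested sets, as an incidence relation. -/
def nestIncidence (𝓑 : Set (Finset ι)) (S : TopNested 𝓑) (B : {B // B ∈ 𝓑}) : Prop := B.1 ∈ S.1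

/-- A nonempty extent consists of all nested sets containing a given one: the prescribed members
together with the whole set form a nested set, being part of an element of the extent. Inclusion of
extents reverses inclusion of nested sets. -/
theorem nonempty_extents_nestIncidence (𝓑 : Set (Finset ι)) :
    Nonempty ((Extents (nestIncidence 𝓑))ᵒᵈ ≃o TopNested 𝓑) := by
  let F : (TopNested 𝓑)ᵒᵈ → Extents (nestIncidence 𝓑) := fun S =>
    ⟨{o | ∀ B ∈ {B : {B // B ∈ 𝓑} | B.1 ∈ (OrderDual.ofDual S).1}, nestIncidence 𝓑 o B},
      ⟨OrderDual.ofDual S, fun _ hB => hB⟩, _, rfl⟩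
  have hF : ∀ S T, F S ≤ F T ↔ S ≤ T := fun S T => by
    change (F S).1 ⊆ (F T).1 ↔ (OrderDual.ofDual T).1 ⊆ (OrderDual.ofDual S).1
    constructor
    · intro h B hB
      exact h (show OrderDual.ofDual S ∈ (F S).1 from fun _ hB => hB)
        ⟨B, (OrderDual.ofDual T).2.1.subset hB⟩ hB
    · exact fun h o ho B hB => ho B (h hB)
  suffices hsurj : Function.Surjective F by
    let g : (TopNested 𝓑)ᵒᵈ ≃o Extents (nestIncidence 𝓑) :=
      RelIso.ofSurjective (OrderEmbedding.ofMapLEIff F hF) hsurj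
    exact ⟨g.symm.dual.trans (OrderIso.dualDual _).symm⟩
  rintro ⟨T, ⟨o, ho⟩, s, hs⟩
  rw [hs] at ho
  refine ⟨OrderDual.toDual ⟨insert Finset.univ (Subtype.val '' s), o.2.1.mono ?_,
    Set.mem_insert _ _⟩, Subtype.ext ?_⟩
  · rw [Set.insert_subset_iff]
    refine ⟨o.2.2, ?_⟩
    rintro _ ⟨B, hB, rfl⟩
    exact ho B hB
  · refine Eq.trans ?_ hs.symm
    ext p
    constructor
    · exact fun h B hB => h B (Set.mem_insert_of_mem _ ⟨B, hB, rfl⟩)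
    · rintro h ⟨B, hB⟩ (rfl | ⟨C, hC, rfl⟩)
      exacts [p.2.2, h C hC]

/-- The quotient comes without a root system, so its nestohedron is built from constant
coefficients; any base larger than `2` would satisfy the growth condition. -/
theorem isWeight_three_pow (𝓑 : Set (Finset ι)) :
    IsWeight 𝓑 (fun _ _ => 1) fun B => 3 ^ B.card := by
  have key : ∀ A B : Finset ι, B ⊂ A → (2 : ℝ) ^ A.card * 3 ^ B.card < 2 ^ B.card * 3 ^ A.card := by
    intro A B h
    obtain ⟨k, hk⟩ := Nat.exists_eq_add_of_lt (Finset.card_lt_card h)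
    rw [hk, add_assoc, pow_add, pow_add (3 : ℝ), mul_assoc, mul_comm ((3 : ℝ) ^ B.card)]
    have h1 : (2 : ℝ) ^ (k + 1) < 3 ^ (k + 1) :=
      pow_lt_pow_left₀ (by norm_num) (by norm_num) (by omega)
    exact mul_lt_mul_of_pos_left (mul_lt_mul_of_pos_right h1 (by positivity)) (by positivity)
  refine ⟨fun _ _ _ _ => one_pos, fun _ _ => by positivity, fun A _ B _ h _ _ => ?_,
    fun A _ B _ h => key A B h⟩
  rw [one_mul, one_mul]
  exact key A B h

/-- Nestohedra exist. -/
theorem exists_nestohedron (h𝓑 : IsBuilding 𝓑) (hu : Finset.univ ∈ 𝓑) :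
    ∃ N : Set (EuclideanSpace ℝ ι), IsPolytope N ∧
      Nonempty (NonemptyFace N ≃o Extents (nestIncidence 𝓑)) := by
  set c : Finset ι → ι → ℝ := fun _ _ => 1 with hc
  set e : Finset ι → ℝ := fun B => 3 ^ B.card with he
  have hw : IsWeight 𝓑 c e := isWeight_three_pow 𝓑
  let N : Set (EuclideanSpace ℝ ι) := {x | IsNestPoint 𝓑 c e x.ofLp}
  let f : {B // B ∈ 𝓑} → StrongDual ℝ (EuclideanSpace ℝ ι) := fun B =>
    -∑ i ∈ B.1, EuclideanSpace.proj i
  have hf : ∀ B x, f B x = -wsum c x.ofLp B.1 := fun B x => by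
    simp [f, wsum, hc]
  have hN : IsPolyhedron N f (fun B => -e B.1) {⟨Finset.univ, hu⟩} := by
    intro x
    simp only [hf, neg_le_neg_iff, neg_inj, Set.mem_singleton_iff, forall_eq]
    exact ⟨fun h => ⟨fun B => h.le B.1 B.2, h.eq⟩, fun h => ⟨h.2, fun B hB => h.1 ⟨B, hB⟩⟩⟩
  have hbdd : Bornology.IsBounded N := by
    have h1 : Bornology.IsBounded ((WithLp.ofLp : EuclideanSpace ℝ ι → ι → ℝ) ⁻¹'
        Set.Icc 0 fun _ => e Finset.univ) :=
      (PiLp.antilipschitzWith_ofLp 2 fun _ : ι => ℝ).isBounded_preimage (Metric.isBounded_Icc _ _)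
    refine h1.subset fun x hx => ⟨fun i => (hw.pos_of_isNestPoint h𝓑 hx i).le, fun i => ?_⟩
    have h2 : wsum c x.ofLp Finset.univ = e Finset.univ := hx.eq
    rw [← h2, wsum]
    simp only [hc, one_mul]
    exact Finset.single_le_sum (f := fun i => x.ofLp i)
      (fun j _ => (hw.pos_of_isNestPoint h𝓑 hx j).le) (Finset.mem_univ i)
  have hcomp : IsCompact N := Metric.isCompact_of_isClosed_isBounded hN.isClosed hbdd
  refine ⟨N, ⟨_, hN.finite_extremePoints, (hN.convexHull_extremePoints hcomp).symm⟩, ?_⟩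
  obtain ⟨g⟩ := hN.nonempty_nonemptyFace_orderIso (Subtype.val : N → _) (by
    rw [Subtype.range_coe, hN.convex.convexHull_eq])
  set φ : N → TopNested 𝓑 := fun x => ⟨tightSet 𝓑 c e x.1.ofLp, hw.cnested_tightSet h𝓑 x.2,
    hu, x.2.eq⟩ with hφ
  have key : ∀ (x : N) (B : {B // B ∈ 𝓑}), f B x = -e B.1 ↔ nestIncidence 𝓑 (φ x) B :=
    fun x B => by
      rw [hf, neg_inj]
      exact ⟨fun h => ⟨B.2, h⟩, fun h => h.2⟩
  obtain ⟨g'⟩ := Extents.nonempty_orderIso_of_surjective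
    (r := fun (x : N) (B : {B // B ∈ 𝓑}) => f B x = -e B.1) (r' := nestIncidence 𝓑) φ (by
      rintro ⟨S, hS, htop⟩
      obtain ⟨t, ht, rfl⟩ := hw.exists_tightSet_eq h𝓑 hS htop
      exact ⟨⟨WithLp.toLp 2 t, ht⟩, rfl⟩)
    (fun a => Or.inr ⟨{a}, fun o => by rw [key]; simp⟩)
    (fun a => ⟨{a}, fun o => by simp [key]⟩)
  exact ⟨g.trans g'⟩

end Nestohedra

end Permutonestohedron

namespace Permutonestohedron

set_option linter.unusedSectionVars false

open scoped InnerProductSpace NNReal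
open Module (Basis)

/-! ### The face as a product -/

section Product

variable {V : Type*} [NormedAddCommGroup V] [InnerProductSpace ℝ V] [FiniteDimensional ℝ V]
  {ι : Type*} [Fintype ι] [DecidableEq ι] {κ : Type*} [Fintype κ] [DecidableEq κ]
  {Φ : Set V} {b : Basis ι ℝ V} {𝓑 : Set (Finset ι)} {A : κ → Finset ι}

theorem map_subtype_univ (X : Finset ι) :
    (Finset.univ : Finset X).map (Function.Embedding.subtype _) = X := by
  ext i
  simp

theorem mem_subtype_iff {X B : Finset ι} {k : X} : k ∈ B.subtype (· ∈ X) ↔ (k : ι) ∈ B := by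
  simp

theorem map_subtype_subtype (X B : Finset ι) :
    (B.subtype (· ∈ X)).map (Function.Embedding.subtype _) = B ∩ X := by
  rw [Finset.subtype_map, Finset.filter_mem_eq_inter]

theorem subtype_eq_univ_iff {X B : Finset ι} : B.subtype (· ∈ X) = Finset.univ ↔ X ⊆ B := by
  rw [Finset.eq_univ_iff_forall]
  exact ⟨fun h i hi => mem_subtype_iff.1 (h ⟨i, hi⟩), fun h i => mem_subtype_iff.2 (h i.2)⟩

theorem normalVec_univ (h𝓑 : IsRootBuilding b 𝓑) : normalVec Φ b 𝓑 Finset.univ = 0 := by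
  rw [normalVec, h𝓑.comps_of_mem h𝓑.univ_mem, Finset.sum_singleton, projDelta_univ, sub_self]

/-- The building set on a set of simple roots. -/
abbrev subBuilding (𝓑 : Set (Finset ι)) (X : Finset ι) : Set (Finset X) :=
  {B | B.map (Function.Embedding.subtype _) ∈ 𝓑}

/-- The normal vector in `A i` need not be the projection of that of `B`, but both are dominant and
orthogonal to the same simple roots of `A i`, which is all that matters for stabilizers. -/
theorem IsBase.map_normalVec_eq_self_iff (hb : IsBase Φ b) (h𝓑 : IsRootBuilding b 𝓑)
    (hcut : IsCut 𝓑 A) {h : V ≃ₗᵢ[ℝ] V} (hh : h ∈ cutGroup Φ b A)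
    {g : ∀ i, basisSpan b (A i) ≃ₗᵢ[ℝ] basisSpan b (A i)}
    (hg : ∀ i, g i ∈ weylGroup ((↑) ⁻¹' Φ : Set (basisSpan b (A i))))
    (hres : ∀ i, Restricts h (g i)) (B : Finset ι) :
    h (normalVec Φ b 𝓑 B) = normalVec Φ b 𝓑 B ↔ ∀ i,
      g i (normalVec ((↑) ⁻¹' Φ) (subBasis b (A i)) (subBuilding 𝓑 (A i))
        (B.subtype (· ∈ A i))) =
      normalVec ((↑) ⁻¹' Φ) (subBasis b (A i)) (subBuilding 𝓑 (A i)) (B.subtype (· ∈ A i)) :=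
  have h𝓑' := fun i => h𝓑.isRootBuilding_subBasis (hcut.mem i)
  hb.map_eq_self_iff h𝓑 hcut hh hg hres (hb.inner_normalVec_nonneg h𝓑 B)
    (fun i => (hb.isBase_subBasis (A i)).inner_normalVec_nonneg (h𝓑' i) _)
    fun i k => by
      rw [hb.inner_normalVec_eq_zero h𝓑, (hb.isBase_subBasis (A i)).inner_normalVec_eq_zero (h𝓑' i),
        mem_subtype_iff]

variable {ι₀ : Type*} [Fintype ι₀] [DecidableEq ι₀]

/-- The building set on the simple roots outside a union. -/
abbrev quotBuilding (𝓑 : Set (Finset ι)) (D : Finset ι) (f : ι₀ ↪ ι) : Set (Finset ι₀) :=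
  {Q | Q.map f ∈ contr 𝓑 D}

/-- The nested sets of the quotient and of the members of the cut, from a nested set. -/
def CutNested.quot (h𝓑 : IsRootBuilding b 𝓑) (hcut : IsCut 𝓑 A) (hD : total A ≠ Finset.univ)
    (f : ι₀ ↪ ι) (hf : ∀ i, i ∈ Set.range f ↔ i ∉ total A) (S : CutNested 𝓑 A) :
    TopNested (quotBuilding 𝓑 (total A) f) :=
  ⟨{Q | Q.map f ∈ {Q | Q ∈ contr 𝓑 (total A) ∧ lift 𝓑 (total A) Q ∈ S.1}},
    cnested_preimage_map f (hcut.cnested_contr h𝓑.toIsBuilding S.2.1 S.2.2.2), by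
      obtain ⟨h1, h2⟩ := univ_mem_contr h𝓑.univ_mem hD f hf
      refine ⟨h1, ?_⟩
      rw [← h2, hcut.lift_sdiff_eq h𝓑.toIsBuilding S.2.1 S.2.2.2 S.2.2.1 fun h =>
        hD (Finset.univ_subset_iff.1 h)]
      exact S.2.2.1⟩

def CutNested.restrict (S : CutNested 𝓑 A) (i : κ) : TopNested (subBuilding 𝓑 (A i)) :=
  ⟨{B | B.map (Function.Embedding.subtype _) ∈ S.1}, cnested_preimage_map _ S.2.1, by
    change Finset.map _ _ ∈ S.1
    rw [map_subtype_univ]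
    exact S.2.2.2 i⟩

theorem CutNested.exists_eq (h𝓑 : IsRootBuilding b 𝓑) (hcut : IsCut 𝓑 A)
    (hD : total A ≠ Finset.univ)
    (f : ι₀ ↪ ι) (hf : ∀ i, i ∈ Set.range f ↔ i ∉ total A)
    (S₀ : TopNested (quotBuilding 𝓑 (total A) f)) (Sᵢ : ∀ i, TopNested (subBuilding 𝓑 (A i))) :
    ∃ S : CutNested 𝓑 A, S.quot h𝓑 hcut hD f hf = S₀ ∧ ∀ i, S.restrict i = Sᵢ i := by
  have h₀ : CNested (contr 𝓑 (total A)) (Finset.map f '' S₀.1) := cnested_image_map f S₀.2.1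
  have hᵢ : ∀ i, CNested (restr 𝓑 (A i))
      (Finset.map (Function.Embedding.subtype (· ∈ A i)) '' (Sᵢ i).1) := fun i => by
    convert cnested_restr (cnested_image_map (Function.Embedding.subtype (· ∈ A i)) (Sᵢ i).2.1)
      (A i) using 1
    ext B
    refine ⟨fun h => ⟨h, ?_⟩, fun h => h.1⟩
    obtain ⟨C, -, rfl⟩ := h
    exact Finset.map_subtype_subset C
  have hg := hcut.cnested_glue h𝓑.toIsBuilding h₀ hᵢ
  have hlift := fun {Q} => hcut.mem_glue_lift h𝓑.toIsBuilding h₀.subset (fun i => (hᵢ i).subset)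
    (Q := Q)
  have hrestr := fun {i B} => hcut.mem_glue_restr h𝓑.toIsBuilding h₀.subset
    (fun i => (hᵢ i).subset) (i := i) (B := B)
  obtain ⟨hu1, hu2⟩ := univ_mem_contr h𝓑.univ_mem hD f hf
  refine ⟨⟨_, hg, ?_, fun i => ?_⟩, ?_, fun i => ?_⟩
  · have h1 := (hlift hu1).2 ⟨_, S₀.2.2, rfl⟩
    have hne := h𝓑.nonempty _ (lift_mem h𝓑.toIsBuilding hu1)
    have h2 := subset_lift_of_not_disjoint h𝓑.toIsBuilding hu1 h𝓑.univ_mem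
      (fun h => hne.ne_empty (Finset.disjoint_self_iff_empty _ |>.1
        (h.mono_left (Finset.subset_univ _)))) hu2.subset
    rwa [Finset.univ_subset_iff.1 h2] at h1
  · refine (hrestr subset_rfl).2 ⟨_, (Sᵢ i).2.2, map_subtype_univ (A i)⟩
  · refine Subtype.ext (Set.ext fun Q => ?_)
    change Q.map f ∈ contr 𝓑 (total A) ∧ _ ↔ _
    constructor
    · rintro ⟨h1, h2⟩
      obtain ⟨Q', hQ', h⟩ := (hlift h1).1 h2
      exact Finset.map_injective f h ▸ hQ'
    · intro h
      have h1 := S₀.2.1.subset h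
      exact ⟨h1, (hlift h1).2 ⟨Q, h, rfl⟩⟩
  · refine Subtype.ext (Set.ext fun B => ?_)
    refine (hrestr (Finset.map_subtype_subset B)).trans ⟨?_, fun h => ⟨B, h, rfl⟩⟩
    rintro ⟨C, hC, h⟩
    exact Finset.map_injective _ h ▸ hC

theorem exists_restriction (h𝓑 : IsRootBuilding b 𝓑) (hcut : IsCut 𝓑 A) :
    ∃ res : cutGroup Φ b A → ∀ i, weylGroup ((↑) ⁻¹' Φ : Set (basisSpan b (A i))),
      ∀ (h : cutGroup Φ b A) i, Restricts (h : V ≃ₗᵢ[ℝ] V)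
        (res h i : basisSpan b (A i) ≃ₗᵢ[ℝ] basisSpan b (A i)) := by
  choose g hg hres using fun (h : cutGroup Φ b A) i => exists_restricts h𝓑 hcut h.2 i
  exact ⟨fun h i => ⟨g h i, hg h i⟩, hres⟩

/-- The incidence relation of the polytope attached to a set of simple roots. -/
abbrev subIncidence (Φ : Set V) (b : Basis ι ℝ V) (𝓑 : Set (Finset ι)) (X : Finset ι) :=
  incidence ((↑) ⁻¹' Φ : Set (basisSpan b X)) (subBasis b X) (subBuilding 𝓑 X)

/-- The incidence relation of the face is that of a product. -/
theorem IsBase.nonempty_extents_cutIncidence (hb : IsBase Φ b) (h𝓑 : IsRootBuilding b 𝓑)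
    (hcut : IsCut 𝓑 A) (hD : total A ≠ Finset.univ) (f : ι₀ ↪ ι)
    (hf : ∀ i, i ∈ Set.range f ↔ i ∉ total A) :
    Nonempty (Extents (cutIncidence Φ b 𝓑 A) ≃o
      Extents (prodRel (nestIncidence (quotBuilding 𝓑 (total A) f))
        (piRel fun i => subIncidence Φ b 𝓑 (A i)))) := by
  obtain ⟨res, hres⟩ := exists_restriction (Φ := Φ) h𝓑 hcut
  have h𝓑' := fun i => h𝓑.isRootBuilding_subBasis (hcut.mem i)
  have hfix : ∀ (h u : cutGroup Φ b A) (B : Finset ι),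
      ((h : V ≃ₗᵢ[ℝ] V)⁻¹ * u) (normalVec Φ b 𝓑 B) = normalVec Φ b 𝓑 B ↔
        ∀ i, ¬ A i ⊆ B → (((res h i)⁻¹ * res u i :
            weylGroup ((↑) ⁻¹' Φ : Set (basisSpan b (A i)))) :
            basisSpan b (A i) ≃ₗᵢ[ℝ] basisSpan b (A i))
          (normalVec ((↑) ⁻¹' Φ) (subBasis b (A i)) (subBuilding 𝓑 (A i))
            (B.subtype (· ∈ A i))) =
          normalVec ((↑) ⁻¹' Φ) (subBasis b (A i)) (subBuilding 𝓑 (A i))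
            (B.subtype (· ∈ A i)) := by
    intro h u B
    rw [hb.map_normalVec_eq_self_iff h𝓑 hcut (mul_mem (inv_mem h.2) u.2)
      (fun i => ((res h i)⁻¹ * res u i).2) (fun i => (hres h i).inv.mul (hres u i))]
    refine forall_congr' fun i => ⟨fun h _ => h, fun h => ?_⟩
    -- Only proper subsets of `A i` label hyperplanes there; when `A i ⊆ B` the normal vector is
    -- zero and the condition is void.
    by_cases hi : A i ⊆ B
    · rw [subtype_eq_univ_iff.2 hi, normalVec_univ (h𝓑' i), map_zero]
    · exact h hi
  have hsub : ∀ (S : CutNested 𝓑 A) i (B : Finset (A i)),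
      (∀ K ∈ comps 𝓑 (B.map (Function.Embedding.subtype _)), K ∈ S.1) ↔
        ∀ K ∈ comps (subBuilding 𝓑 (A i)) B, K ∈ (S.restrict i).1 := fun S i B =>
    forall_mem_comps_map (Function.Embedding.subtype (· ∈ A i))
  refine Extents.nonempty_orderIso_of_surjective
    (fun o => (o.2.quot h𝓑 hcut hD f hf, fun i => (res o.1 i, o.2.restrict i))) ?_ ?_ ?_
  · rintro ⟨S₀, p⟩
    obtain ⟨S, hS₀, hSᵢ⟩ := CutNested.exists_eq h𝓑 hcut hD f hf S₀ fun i => (p i).2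
    obtain ⟨h, hh, hp⟩ := exists_extension_pi h𝓑 hcut (fun i => (p i).1) fun i => (p i).1.2
    refine ⟨(⟨h, hh⟩, S), Prod.ext hS₀ (funext fun i => Prod.ext (Subtype.ext ?_) (hSᵢ i))⟩
    exact (hres ⟨h, hh⟩ i).unique (hp i)
  · rintro ⟨w, B, hB⟩
    -- A hyperplane meeting no cell of the face is discarded. For any other one, an incident cell
    -- `(h₀, S₀)` provides a representative of `w` in the parabolic subgroup and a nested set
    -- containing the components of `B`.
    by_cases hne : ∃ o, cutIncidence Φ b 𝓑 A o (w, ⟨B, hB⟩)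
    swap
    · exact Or.inl (not_exists.1 hne)
    obtain ⟨⟨h₀, S₀⟩, hw, hS₀⟩ := hne
    refine Or.inr ⟨Sum.inl '' {Q | ∃ K ∈ comps 𝓑 B, ¬ K ⊆ total A ∧ K \ total A = Q.1.map f} ∪
      Set.range fun i : {i // ¬ A i ⊆ B} => Sum.inr ⟨i.1, res h₀ i.1,
        ⟨B.subtype (· ∈ A i.1), fun h => i.2 (subtype_eq_univ_iff.1 h)⟩⟩, ?_⟩
    rintro ⟨h, S⟩
    have hw' : ((h : V ≃ₗᵢ[ℝ] V)⁻¹ * w) (normalVec Φ b 𝓑 B) = normalVec Φ b 𝓑 B ↔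
        ((h : V ≃ₗᵢ[ℝ] V)⁻¹ * h₀) (normalVec Φ b 𝓑 B) = normalVec Φ b 𝓑 B := by
      have h1 : (w : V ≃ₗᵢ[ℝ] V) (normalVec Φ b 𝓑 B) =
          (h₀ : V ≃ₗᵢ[ℝ] V) (normalVec Φ b 𝓑 B) :=
        ((h₀ : V ≃ₗᵢ[ℝ] V).symm_apply_eq).1 hw
      change (h : V ≃ₗᵢ[ℝ] V)⁻¹ ((w : V ≃ₗᵢ[ℝ] V) _) = _ ↔
        (h : V ≃ₗᵢ[ℝ] V)⁻¹ ((h₀ : V ≃ₗᵢ[ℝ] V) _) = _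
      rw [h1]
    change _ ∧ _ ↔ _
    rw [hw', hfix, hcut.comps_subset_iff h𝓑.toIsBuilding S₀.2.1 S₀.2.2.2 S.2.2.2 hS₀]
    constructor
    · rintro ⟨h1, h2, h3⟩ _ (⟨⟨Q, hQ⟩, ⟨K, hK, hKD, hKQ⟩, rfl⟩ | ⟨⟨i, hi⟩, rfl⟩)
      · exact ⟨hQ, hKQ ▸ h2 K hK hKD⟩
      · refine ⟨h1 i hi, (hsub S i _).1 ?_⟩
        rw [map_subtype_subtype]
        exact h3 i hi
    · intro H
      have H' : ∀ i (hi : ¬ A i ⊆ B), subIncidence Φ b 𝓑 (A i) (res h i, S.restrict i)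
          (res h₀ i, ⟨B.subtype (· ∈ A i), fun h => hi (subtype_eq_univ_iff.1 h)⟩) :=
        fun i hi => H _ (Or.inr ⟨⟨i, hi⟩, rfl⟩)
      refine ⟨fun i hi => (H' i hi).1, fun K hK hKD => ?_, fun i hi => ?_⟩
      · obtain ⟨Q, hQ⟩ := exists_sdiff_eq_map (total A) f hf K
        have hQ' : Q.map f ∈ contr 𝓑 (total A) := hQ ▸
          hcut.sdiff_mem_contr h𝓑.toIsBuilding (mem_of_mem_comps hK) hKD
        rw [hQ]
        exact (H _ (Or.inl ⟨⟨Q, hQ'⟩, ⟨K, hK, hKD, hQ⟩, rfl⟩)).2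
      · rw [← map_subtype_subtype]
        exact (hsub S i _).2 (H' i hi).2
  · rintro (⟨Q, hQ⟩ | ⟨i, u, C, hC⟩)
    · have hQiff : ∀ S : CutNested 𝓑 A, Q ∈ (S.quot h𝓑 hcut hD f hf).1 ↔
          ∀ K ∈ comps 𝓑 (Q.map f ∪ total A), K ∈ S.1 := fun S => by
        rw [hcut.comps_union_total h𝓑.toIsBuilding S.2.2.2 hQ]
        exact and_iff_right hQ
      -- Then the condition is that the whole set belongs to `S`, which always holds, and no
      -- hyperplane is needed.
      by_cases hu : Q.map f ∪ total A = Finset.univ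
      · refine ⟨∅, fun o => iff_of_true ((hQiff o.2).2 fun K hK => ?_) (by simp)⟩
        rw [hu, h𝓑.comps_of_mem h𝓑.univ_mem, Finset.mem_singleton] at hK
        exact hK ▸ o.2.2.2.1
      · refine ⟨{(1, ⟨_, hu⟩)}, fun o => ?_⟩
        simp only [Set.mem_singleton_iff, forall_eq]
        refine (hQiff o.2).trans (and_iff_right ?_).symm
        refine map_eq_self_of_mem_cutGroup (mul_mem (inv_mem o.1.2) (one_mem _)) fun j hj => ?_
        exact hb.inner_normalVec_of_mem h𝓑 (Finset.mem_union_right _ hj)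
    · obtain ⟨w, hw, hwu, -⟩ := exists_extension h𝓑 hcut u.2
      have hwi : res ⟨w, hw⟩ i = u := Subtype.ext ((hres ⟨w, hw⟩ i).unique hwu)
      -- With every other `A j` inside `B`, all the conditions outside `A i` become void and only
      -- the one given by `C` and `u` remains.
      set B : Finset ι := C.map (Function.Embedding.subtype _) ∪ (Finset.univ.erase i).biUnion A
        with hBdef
      have hBi : B.subtype (· ∈ A i) = C := by
        ext k
        rw [mem_subtype_iff, hBdef, Finset.mem_union]
        constructor
        · rintro (h | h)
          · obtain ⟨l, hl, hlk⟩ := Finset.mem_map.1 h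
            exact (Subtype.ext hlk : l = k) ▸ hl
          · obtain ⟨j, hj, hk⟩ := Finset.mem_biUnion.1 h
            exact absurd k.2 (Finset.disjoint_left.1
              (hcut.disjoint j i (Finset.ne_of_mem_erase hj)) hk)
        · exact fun h => Or.inl (Finset.mem_map_of_mem _ h)
      have hBj : ∀ j, j ≠ i → A j ⊆ B := fun j hj =>
        (Finset.subset_biUnion_of_mem A (Finset.mem_erase.2 ⟨hj, Finset.mem_univ j⟩)).trans
          Finset.subset_union_right
      have hi : ¬ A i ⊆ B := fun h => hC (hBi ▸ subtype_eq_univ_iff.2 h)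
      have hB : B ≠ Finset.univ := fun h => hi (h ▸ Finset.subset_univ _)
      refine ⟨{(⟨w, cutGroup_le hw⟩, ⟨B, hB⟩)}, fun o => ?_⟩
      simp only [Set.mem_singleton_iff, forall_eq]
      refine and_congr ?_ ((hsub o.2 i C).symm.trans (hcut.comps_union_erase h𝓑.toIsBuilding
        o.2.2.2.2 (Finset.map_subtype_subset C)).symm)
      refine Iff.trans ?_ (hfix o.1 ⟨w, hw⟩ B).symm
      constructor
      · intro h j hj
        obtain rfl : j = i := by
          by_contra hne
          exact hj (hBj j hne)
        rw [hBi, hwi]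
        exact h
      · intro h
        have := h i hi
        rw [hBi, hwi] at this
        exact this

end Product

end Permutonestohedron

namespace Permutonestohedron

set_option linter.unusedSectionVars false

open scoped InnerProductSpace NNReal
open Module (Basis)

/-! ### The face of the permutonestohedron -/

section Face

theorem nonempty_orderIso_prod {α β γ δ : Type*} [Preorder α] [Preorder β] [Preorder γ]
    [Preorder δ] (e : α ≃o β) (f : γ ≃o δ) : Nonempty (α × γ ≃o β × δ) :=
  ⟨{ toEquiv := e.toEquiv.prodCongr f.toEquiv
     map_rel_iff' := and_congr e.le_iff_le f.le_iff_le }⟩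

theorem nonempty_orderIso_pi {κ : Type*} {α β : κ → Type*} [∀ i, Preorder (α i)]
    [∀ i, Preorder (β i)] (e : ∀ i, Nonempty (α i ≃o β i)) : Nonempty ((∀ i, α i) ≃o ∀ i, β i) :=
  ⟨{ toEquiv := Equiv.piCongrRight fun i => (e i).some.toEquiv
     map_rel_iff' := forall_congr' fun i => (e i).some.le_iff_le }⟩

theorem exists_embedding_range {ι : Type*} [Fintype ι] [DecidableEq ι] (D : Finset ι) :
    ∃ (m : ℕ) (f : Fin m ↪ ι), ∀ i, i ∈ Set.range f ↔ i ∉ D := by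
  obtain ⟨m, ⟨g⟩⟩ := Finite.exists_equiv_fin {i // i ∉ D}
  refine ⟨m, g.symm.toEmbedding.trans (Function.Embedding.subtype _), fun i => ⟨?_, fun hi => ?_⟩⟩
  · rintro ⟨j, rfl⟩
    exact (g.symm j).2
  · exact ⟨g ⟨i, hi⟩, by simp⟩

variable {V : Type*} [NormedAddCommGroup V] [InnerProductSpace ℝ V] [FiniteDimensional ℝ V]
  {ι : Type*} [Fintype ι] [DecidableEq ι] {κ : Type*} [Fintype κ] [DecidableEq κ]
  {Φ : Set V} {b : Basis ι ℝ V} {G : Set (Submodule ℝ V)} {A : κ → Finset ι}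

theorem IsBase.nonempty_nonemptyFace_smallPermutonestohedron (hb : IsBase Φ b)
    (h𝓑 : IsRootBuilding b (fundSet b G)) {X : Finset ι} (hX : X ∈ fundSet b G) {η : ℕ → ℝ}
    (hη : IsSuitableList ((↑) ⁻¹' Φ : Set (basisSpan b X)) ((↑) ⁻¹' Set.range b)
      (restrictBuilding G (basisSpan b X)) η) :
    Nonempty (NonemptyFace (smallPermutonestohedron Φ (Set.range b) G (basisSpan b X) η) ≃o
      Extents (subIncidence Φ b (fundSet b G) X)) := by
  have hb' := hb.isBase_subBasis X
  have h𝓑' := h𝓑.isRootBuilding_subBasis hX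
  rw [range_subBasis] at hη
  rw [smallPermutonestohedron, range_subBasis]
  rw [← fundSet_restrictBuilding] at h𝓑'
  have hw := hb'.isWeight h𝓑' hη
  rw [permutonestohedron_eq hb' h𝓑']
  have h := hb'.nonempty_nonemptyFace_rootPolytope h𝓑' hw
  rw [fundSet_restrictBuilding] at h ⊢
  exact h

variable {E : Type*} [AddCommGroup E] [Module ℝ E] [TopologicalSpace E]

theorem nonempty_nonemptyFace_of_isNestohedron {M : Type*} [AddCommGroup M] [Module ℝ M]
    (b : Basis ι ℝ M) {𝓑 : Set (Finset ι)} (hne : ∀ B ∈ 𝓑, B.Nonempty) {N : Set E} :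
    Nonempty (NonemptyFace N ≃o Extents (nestIncidence 𝓑)) ↔
      Nonempty ((NonemptyFace N)ᵒᵈ ≃o NestedComplex (basisSpan b '' 𝓑)) := by
  obtain ⟨g⟩ := nonempty_nestedComplex_orderIso b hne
  obtain ⟨g'⟩ := nonempty_extents_nestIncidence 𝓑
  constructor
  · rintro ⟨h⟩
    exact ⟨h.dual.trans (g'.trans g)⟩
  · rintro ⟨h⟩
    exact ⟨(OrderIso.dualDual _).trans
      (((h.trans g.symm).trans g'.symm).dual.trans (OrderIso.dualDual _).symm)⟩

theorem iSup_basisSpan (b : Basis ι ℝ V) (A : κ → Finset ι) :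
    ⨆ i, basisSpan b (A i) = basisSpan b (total A) := by
  refine le_antisymm (iSup_le fun i => (basisSpan_le b).2 (subset_total A i)) ?_
  change Submodule.span ℝ (b '' total A) ≤ _
  rw [Submodule.span_le]
  rintro _ ⟨j, hj, rfl⟩
  obtain ⟨i, hi⟩ := mem_total.1 hj
  exact le_iSup (fun i => basisSpan b (A i)) i ((basis_mem_basisSpan b).2 hi)

theorem exists_isNestohedron (h𝓑 : IsRootBuilding b (fundSet b G))
    (hD : total A ≠ Finset.univ) :
    ∃ (m : ℕ) (N : Set (EuclideanSpace ℝ (Fin m))), IsNestohedron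
      (quotientBuilding (fund (Set.range b) G) (⨆ i, basisSpan b (A i))) N := by
  obtain ⟨m, f, hf⟩ := exists_embedding_range (total A)
  have h := isBuilding_contr h𝓑.toIsBuilding (total A) f hf
  obtain ⟨N, hN, hN'⟩ := exists_nestohedron h (univ_mem_contr h𝓑.univ_mem hD f hf).1
  refine ⟨m, N, hN, ?_⟩
  rw [iSup_basisSpan, fund_range, quotientBuilding_eq b _ _ f hf]
  exact (nonempty_nonemptyFace_of_isNestohedron _ h.nonempty).1 hN'

theorem IsBase.combEquiv_cutFace (hb : IsBase Φ b) (h𝓑 : IsRootBuilding b (fundSet b G))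
    {e : Finset ι → ℝ} (hw : IsWeight (fundSet b G) (projCoeff Φ b) e)
    (hcut : IsCut (fundSet b G) A) (hD : total A ≠ Finset.univ) {σ : V ≃ₗᵢ[ℝ] V}
    (hσ : σ ∈ weylGroup Φ) {η : κ → ℕ → ℝ}
    (hη : ∀ i, IsSuitableList ((↑) ⁻¹' Φ : Set (basisSpan b (A i))) ((↑) ⁻¹' Set.range b)
      (restrictBuilding G (basisSpan b (A i))) (η i)) {N : Set E}
    (hN : IsNestohedron (quotientBuilding (fund (Set.range b) G) (⨆ i, basisSpan b (A i))) N) :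
    CombEquiv (cutFace Φ b (fundSet b G) e A σ)
      (N ×ˢ Set.univ.pi fun i =>
        smallPermutonestohedron Φ (Set.range b) G (basisSpan b (A i)) (η i)) := by
  obtain ⟨m, f, hf⟩ := exists_embedding_range (total A)
  have h := isBuilding_contr h𝓑.toIsBuilding (total A) f hf
  have hN' := hN.2
  rw [iSup_basisSpan, fund_range, quotientBuilding_eq b _ _ f hf,
    ← nonempty_nonemptyFace_of_isNestohedron _ h.nonempty] at hN'
  obtain ⟨g₀⟩ := hN'
  obtain ⟨g₁⟩ := nonempty_orderIso_pi fun i =>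
    hb.nonempty_nonemptyFace_smallPermutonestohedron h𝓑 (hcut.mem i) (hη i)
  obtain ⟨g₂⟩ := nonempty_nonemptyFace_prod N (Set.univ.pi fun i =>
    smallPermutonestohedron Φ (Set.range b) G (basisSpan b (A i)) (η i))
  obtain ⟨g₃⟩ := nonempty_nonemptyFace_pi fun i =>
    smallPermutonestohedron Φ (Set.range b) G (basisSpan b (A i)) (η i)
  obtain ⟨g₄⟩ := Extents.nonempty_pi_orderIso fun i => subIncidence Φ b (fundSet b G) (A i)
  obtain ⟨g₅⟩ := nonempty_orderIso_prod g₀ (g₃.trans (g₁.trans g₄.symm))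
  obtain ⟨g₆⟩ := Extents.nonempty_prod_orderIso
    (nestIncidence (quotBuilding (fundSet b G) (total A) f))
    (piRel fun i => subIncidence Φ b (fundSet b G) (A i))
  obtain ⟨g₇⟩ := hb.nonempty_nonemptyFace_cutFace h𝓑 hw hcut hD hσ
  obtain ⟨g₈⟩ := hb.nonempty_extents_cutIncidence h𝓑 hcut hD f hf
  exact combEquiv_of_nonemptyFace (g₇.trans (g₈.trans (g₆.trans (g₂.trans g₅).symm)))

end Face

end Permutonestohedron

/-! ### The theorem, read in a base of simple roots. -/

theorem mainTheorem4 {V : Type*} [NormedAddCommGroup V] [InnerProductSpace ℝ V]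
    [FiniteDimensional ℝ V]
    -- a root system, its simple roots, an invariant building set containing `V`, a suitable list
    (Φ Δ : Set V) (hΦ : IsRootSystem Φ) (hΔ : IsSimpleSystem Φ Δ)
    (G : Set (Submodule ℝ V)) (hG : IsBuildingSet Φ G) (hGV : ⊤ ∈ G)
    (hGW : ∀ σ ∈ weylGroup Φ, ∀ C ∈ G, C.map (σ.toLinearEquiv : V →ₗ[ℝ] V) ∈ G)
    (ε : ℕ → ℝ) (hε : IsSuitableList Φ Δ G ε)
    -- the pair consisting of a coset and of a nested set `{V, A_1, …, A_k}`, the `A_i` labelled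
    (k : ℕ) (A : Fin k → Submodule ℝ V) (hAV : ∀ i, A i ≠ ⊤)
    (hmin : ∀ i j, A i ≤ A j → i = j)
    (hA : IsNested (fund Δ G) (insert ⊤ (Set.range A)))
    (σ : V ≃ₗᵢ[ℝ] V) (hσ : σ ∈ weylGroup Φ)
    -- suitable lists for the smaller permutonestohedra
    (η : Fin k → ℕ → ℝ)
    (hη : ∀ i, IsSuitableList ((↑) ⁻¹' Φ : Set (A i)) ((↑) ⁻¹' Δ) (restrictBuilding G (A i))
      (η i)) :
    IsFacet (permutonestohedron Φ Δ G ε)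
      (labelledFace Φ Δ G ε σ (insert ⊤ (Set.range A)) (Set.range A)) ∧
    (∃ (m : ℕ) (N : Set (EuclideanSpace ℝ (Fin m))),
      IsNestohedron (quotientBuilding (fund Δ G) (⨆ i, A i)) N) ∧
    ∀ (m : ℕ) (N : Set (EuclideanSpace ℝ (Fin m))),
      IsNestohedron (quotientBuilding (fund Δ G) (⨆ i, A i)) N →
      CombEquiv (labelledFace Φ Δ G ε σ (insert ⊤ (Set.range A)) (Set.range A))
        (N ×ˢ Set.univ.pi fun i => smallPermutonestohedron Φ Δ G (A i) (η i)) := by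
  obtain ⟨n, b, rfl, hb⟩ := hΔ.exists_basis hΦ
  have h𝓑 := hG.isRootBuilding hb hGV
  have hw := hb.isWeight h𝓑 hε
  have hfund : ∀ i, ∃ B, basisSpan b B = A i := fun i => by
    have h := hA.1 (Set.mem_insert_of_mem _ ⟨i, rfl⟩)
    rw [fund_range] at h
    obtain ⟨B, -, hB⟩ := h
    exact ⟨B, hB⟩
  choose A' hA' using hfund
  obtain rfl : (fun i => basisSpan b (A' i)) = A := funext hA'
  have hS : CNested (fundSet b G) (insert Finset.univ (Set.range A')) := by
    rw [← isNested_image_iff b h𝓑.nonempty, Set.image_insert_eq, basisSpan_univ, ← Set.range_comp,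
      ← fund_range]
    exact hA
  have hcut : IsCut (fundSet b G) A' := IsCut.of_cnested h𝓑.toIsBuilding
    (hS.mono (Set.subset_insert _ _)) fun i j h => hmin i j ((basisSpan_le b).2 h)
  have hD : total A' ≠ Finset.univ := hcut.total_ne_univ h𝓑.univ_mem fun i h =>
    hAV i (basisSpan_eq_top_iff.2 h)
  rw [labelledFace_eq_cutFace hb h𝓑 hw hcut hD hσ, permutonestohedron_eq hb h𝓑]
  exact ⟨hb.isFacet_cutFace h𝓑 hw hcut hD hS hσ, exists_isNestohedron h𝓑 hD,
    fun m N hN => hb.combEquiv_cutFace h𝓑 hw hcut hD hσ hη hN⟩
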